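/- **Setting.** Let $d\ge 1$, $T\ge 1$, $0\le\underline p<\overline p\le 1$, $\mathcal X=[0,1]^d$. In period $t=1,\dots,T$ a customer with context $x_t$ arrives, a price $p_t\in[\underline p,\overline p]$ is offered and a demand $y_t\in[0,1]$ is realized. The contexts are i.i.d. with law $P_X$, which has a density on $\mathcal X$ bounded by $C_X$; $x_t$ is independent of the past and of the internal randomness of the algorithm, and, given these and $x_t$ (hence $p_t$), the mean of $y_t$ is $\lambda(p_t,x_t)$. Put $f(p,x)=p\,\lambda(p,x)$ and $p^*(x)\in\arg\max_{p\in[\underline p,\overline p]}f(p,x)$. Assume that * $|f(p,x)-f(p',x')|\le C_L(|p-p'|+\|x-x'\|_2)$; * there are $0<\sigma_H\le C_H$ and $C_p$ such that for every closed axis-parallel hypercube $B\subseteq\mathcal X$ of positive side with $P_X(B)>0$, the function $f_B(p)=\mathbb E_{P_X}[f(p,x)\mid x\in B]$ is twice continuously differentiable on $(\underline p,\overline p)$ with $\sigma_H^2\le -f_B''\le C_H^2$ there, it attains its maximum over $[\underline p,\overline p]$ at a point $p^*(B)\in(\underline p,\overline p)$, $\inf_{B}p^*(\cdot)\le p^*(B)\le\sup_{B}p^*(\cdot)$,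 and $\sup_{B}p^*(\cdot)-\inf_{B}p^*(\cdot)\le C_p\operatorname{diam}(B)$. **Tree-based aggregation** with level $\varepsilon_0$ and horizon $T$, for a stream $u_1,u_2,\dots$: let $L=\lfloor\log_2T\rfloor$ and $\alpha_\ell=\hat\alpha_\ell=0$ initially. At time $t$, with binary digits $b_\ell(t)$ and lowest nonzero digit at position $\ell_{\min}$, set $\alpha_{\ell_{\min}}\gets\sum_{\ell<\ell_{\min}}\alpha_\ell+u_t$ and $\hat\alpha_{\ell_{\min}}\gets\alpha_{\ell_{\min}}+w_t$ with fresh independent Laplace noise $w_t$ of scale $2(L+1)/\varepsilon_0$, then set $\alpha_\ell=\hat\alpha_\ell=0$ for $\ell<\ell_{\min}$; the output at time $t$ is $\sum_{\ell=0}^L b_\ell(t)\hat\alpha_\ell$. **The CPPQ algorithm** with parameters $\varepsilon>0$, $J=m^d$ ($m\ge1$ an integer), $c_1,c_1',c_2\in\mathbb R$. Partition $[0,1]^d$ into $J$ hypercubes $B_j$ of side $1/m$. Each $B_j$ carries a vector $\rho_j=(\rho_{j1},\dots,\rho_{j5})$ of five equidistant increasing prices, initially from $\underline p$ to $\overline p$,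 and a time $\varsigma_j$, initially $0$. In period $t$, let $x_t\in B_{j_t}$ and $k_t\in\{1,\dots,5\}$, $k_t\equiv t\pmod 5$; offer $p_t=\rho_{j_t,k_t}$ and observe $y_t$. For every $j,k$ run two tree-based aggregations, each with level $\varepsilon/2$, on the streams $u_{t,j,k}=\mathbf 1\{j_t=j,k_t=k\}\,y_tp_t$ and $v_{t,j,k}=\mathbf 1\{j_t=j,k_t=k\}$, and let $r_{j,k}(t),\mu_{j,k}(t)$ be their outputs at the last period $\tau\le t$ with $k_\tau=k$ ($0$ if there is none). At the end of period $t$, for every $j$, put $\hat r_k=r_{j,k}(t)-r_{j,k}(\varsigma_j)$ and $\hat\mu_k=\mu_{j,k}(t)-\mu_{j,k}(\varsigma_j)$. For a triple $(a,b,c)$ of price indices let $\underline\mu=\min\{\hat\mu_a,\hat\mu_b,\hat\mu_c\}$ and call the triple decisive if $\underline\mu\ge c_2$ and $\min\{\hat r_a/\hat\mu_a-\hat r_b/\hat\mu_b,\ \hat r_b/\hat\mu_b-\hat r_c/\hat\mu_c\}>3c_1/\sqrt{\underline\mu}+3c_1'/\underline\mu$. If $(3,2,1)$ is decisive, replace $\rho_j$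 by five equidistant prices from $\rho_{j2}$ to $\rho_{j5}$ and set $\varsigma_j=t$; otherwise, if $(3,4,5)$ is decisive, replace $\rho_j$ by five equidistant prices from $\rho_{j1}$ to $\rho_{j4}$ and set $\varsigma_j=t$. **Theorem.** 1. *Privacy.* For all $J=m^d$, $c_1,c_1',c_2$ and $\varepsilon>0$, CPPQ satisfies $\varepsilon$-central differential privacy. That is, write $A_t(U\mid x_t,s_1,\dots,s_{t-1})$ for the probability, over the noise, that the price computed in period $t$ for context $x_t$ lies in $U$ when the algorithm has been fed the past data $s_i=(x_i,y_i,p_i)\in[0,1]^d\times[0,1]\times[\underline p,\overline p]$, $i<t$. Then for all $1\le j<t\le T$, all data sequences $s,s'$ that differ only in entry $j$, all $x_t\in[0,1]^d$ and all measurable $U\subseteq[\underline p,\overline p]$, $$A_t(U\mid x_t,s_1,\dots,s_j,\dots,s_{t-1})\le e^{\varepsilon}A_t(U\mid x_t,s_1,\dots,s_j',\dots,s_{t-1}).$$ 2. *Regret.* There are a numerical constant $c>0$ and numbers $K_d$ depending only on $d$ such that the following holds. Let CPPQ be run with $J=\lceil T^{d/(d+4)}\rceil$, rounded up to the next $d$-th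 power of an integer if it is not one, and with $c_1=\sqrt{\ln(2T^3)}$, $c_2=76\,\varepsilon^{-1}\ln^2(2T^3)$, $c_1'=4c_2$. If the assumptions above hold and $2C_H^2T^3\ge1$, then $$\mathbb E\Big[\sum_{t=1}^T f(p^*(x_t),x_t)-f(p_t,x_t)\Big]\le\bar C_1\,T^{(d+2)/(d+4)}+\bar C_1'\,\varepsilon^{-1}\,T^{d/(d+4)}+K_d,$$ where $$\bar C_1=c\,C_H^2\big(\sigma_H^{-4}+C_H\sqrt{C_X}\big)\ln^2(2C_H^2T^3)+\tfrac12C_H^2C_p^2d,\qquad \bar C_1'=c\,C_H^2\sigma_H^{-2}\ln^3(2C_H^2T^3).$$ -/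

import Mathlib

open MeasureTheory ProbabilityTheory

noncomputable section

namespace CPPQ

/-! ### Data and pricing policies -/

/-- Customer contexts. -/
abbrev Ctx (d : ℕ) : Type := EuclideanSpace ℝ (Fin d)

/-- The context domain `[0,1]^d`. -/
def unitCube (d : ℕ) : Set (Ctx d) := {x | ∀ i, 0 ≤ x i ∧ x i ≤ 1}

/-- The data `(x, y, p)` of one customer: context, realized demand, offered price. -/
structure Obs (d : ℕ) where
  x : Ctx d
  y : ℝ
  p : ℝ

/-- The data of one customer lies in `[0,1]^d × [0,1] × [pLo, pHi]`. -/
def Obs.InDomain {d : ℕ} (pLo pHi : ℝ) (s : Obs d) : Prop :=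
  s.x ∈ unitCube d ∧ s.y ∈ Set.Icc (0 : ℝ) 1 ∧ s.p ∈ Set.Icc pLo pHi

/-- `ε`-central (anticipating) differential privacy over the periods `1, …, T` of a randomized
pricing policy. The internal randomness of the policy is a seed `w` with law `ν`; the price of
period `t`, for past data `s 1, …, s (t - 1)` and current context `x`, is `price t s x w`, so that
`A_t(U | x, s_1, …, s_{t-1}) = ν {w | price t s x w ∈ U}`. The past data are an arbitrary input. -/
def IsCDP {d : ℕ} {Seed : Type*} [MeasurableSpace Seed] (ν : Measure Seed) (T : ℕ) (pLo pHi ε : ℝ)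
    (price : ℕ → (ℕ → Obs d) → Ctx d → Seed → ℝ) : Prop :=
  ∀ t ∈ Finset.Icc 1 T, ∀ j ∈ Finset.Ico 1 t, ∀ s s' : ℕ → Obs d,
    (∀ i, (s i).InDomain pLo pHi) → (∀ i, (s' i).InDomain pLo pHi) →
    (∀ i, i ≠ j → s' i = s i) → ∀ x ∈ unitCube d,
    ∀ U : Set ℝ, MeasurableSet U → U ⊆ Set.Icc pLo pHi →
      ν {w | price t s x w ∈ U} ≤ ENNReal.ofReal (Real.exp ε) * ν {w | price t s' x w ∈ U}

/-! ### Laplace noise and tree-based aggregation -/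

/-- The centered Laplace distribution with scale `b`, of density `exp (-|z| / b) / (2 b)`. -/
def laplace (b : ℝ) : Measure ℝ :=
  volume.withDensity fun z => ENNReal.ofReal (1 / (2 * b) * Real.exp (-|z| / b))

/-- The position of the lowest nonzero binary digit of `t`. -/
def lowBit (t : ℕ) : ℕ := sInf {l | t.testBit l = true}

/-- Partial sums `α_ℓ` and their noisy versions `α̂_ℓ`. -/
structure TreeState where
  a : ℕ → ℝ
  ahat : ℕ → ℝ

/-- One step of tree-based aggregation, at time `t` with new input `u` and noise `w`. -/
def treeStep (t : ℕ) (u w : ℝ) (S : TreeState) : TreeState :=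
  let merged : ℝ := (∑ l ∈ Finset.range (lowBit t), S.a l) + u
  { a := fun l => if l < lowBit t then 0 else if l = lowBit t then merged else S.a l
    ahat := fun l => if l < lowBit t then 0 else if l = lowBit t then merged + w else S.ahat l }

/-- The state after the inputs `u 1, …, u t`, with noises `w 1, …, w t`. -/
def treeState (u w : ℕ → ℝ) : ℕ → TreeState
  | 0 => ⟨fun _ => 0, fun _ => 0⟩
  | t + 1 => treeStep (t + 1) (u (t + 1)) (w (t + 1)) (treeState u w t)

/-- The released noisy version of `∑ τ ≤ t, u τ`: the sum of `α̂_ℓ` over the binary digits of `t`. -/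
def treeAgg (T : ℕ) (u w : ℕ → ℝ) (t : ℕ) : ℝ :=
  ∑ l ∈ Finset.range (Nat.log 2 T + 1), if t.testBit l = true then (treeState u w t).ahat l else 0

/-- The noise scale `2 / ε'`, `ε' = ε / (L + 1)`, `L = ⌊log₂ T⌋`, of the aggregation called with
privacy level `ε` and horizon `T`. -/
def treeScale (ε : ℝ) (T : ℕ) : ℝ := 2 / (ε / ((Nat.log 2 T : ℝ) + 1))

/-! ### The algorithm -/

/-- The input of the algorithm, apart from the number of hypercubes. -/
structure Params where
  T : ℕ
  ε : ℝ
  pLo : ℝ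
  pHi : ℝ
  c1 : ℝ
  c1' : ℝ
  c2 : ℝ

/-- The partition of `[0,1]^d` into `J = m ^ d` hypercubes of side `1 / m`; a hypercube is given by
its integer coordinates. -/
abbrev Cell (d m : ℕ) : Type := Fin d → Fin m

/-- The hypercube that contains `x`. -/
def cellOf {d m : ℕ} [NeZero m] (x : Ctx d) : Cell d m := fun i =>
  ⟨min ⌊(m : ℝ) * x i⌋₊ (m - 1),
    lt_of_le_of_lt (min_le_right _ _) (Nat.sub_lt (Nat.pos_of_ne_zero (NeZero.ne m)) one_pos)⟩

/-- The index `k_t ≡ t mod 5` of the price offered in period `t`; the indices `1, …, 5` are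
represented by `0, …, 4`. -/
def priceIdx (t : ℕ) : Fin 5 := ⟨(t + 4) % 5, Nat.mod_lt _ (by norm_num)⟩

/-- The two statistics kept for each hypercube and price index. -/
inductive StatKind where
  | revenue
  | count

instance : DecidableEq StatKind := Classical.decEq _

instance : Fintype StatKind := ⟨{.revenue, .count}, by intro q; cases q <;> simp⟩

/-- One noise variable per statistic, hypercube, price index and period. -/
abbrev NoiseIdx (d m T : ℕ) : Type :=
  StatKind × Cell d m × Fin 5 × {t : ℕ // t ∈ Finset.Icc 1 T}

/-- A realization of all noise variables. -/
abbrev Noise (d m T : ℕ) : Type := NoiseIdx d m T → ℝ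

/-- The noise variables are independent and Laplace; every aggregation runs with level `ε / 2`. -/
def noiseLaw (d m T : ℕ) (ε : ℝ) : Measure (Noise d m T) :=
  Measure.pi fun _ => laplace (treeScale (ε / 2) T)

/-- The noises `w 1, …, w T` of one aggregation. -/
def Noise.seq {d m T : ℕ} (W : Noise d m T) (q : StatKind) (j : Cell d m) (k : Fin 5) (t : ℕ) : ℝ :=
  if h : t ∈ Finset.Icc 1 T then W (q, j, k, ⟨t, h⟩) else 0

/-- The input of the aggregations in period `t`: `u_{t,j,k} = 1{j_t = j, k_t = k} y_t p_t` and
`v_{t,j,k} = 1{j_t = j, k_t = k}`. -/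
def increment {d m : ℕ} [NeZero m] (s : ℕ → Obs d) (q : StatKind) (j : Cell d m) (k : Fin 5)
    (t : ℕ) : ℝ :=
  if cellOf (s t).x = j ∧ priceIdx t = k then
    match q with
    | .revenue => (s t).y * (s t).p
    | .count => 1
  else 0

/-- The private statistics `r_{j,k}(t)` and `μ_{j,k}(t)`, refreshed in the periods with `k_t = k`. -/
def stat {d m : ℕ} [NeZero m] (T : ℕ) (s : ℕ → Obs d) (W : Noise d m T) (q : StatKind)
    (j : Cell d m) (k : Fin 5) : ℕ → ℝ
  | 0 => 0
  | t + 1 =>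
    if priceIdx (t + 1) = k then treeAgg T (increment s q j k) (W.seq q j k) (t + 1)
    else stat T s W q j k t

/-- Five equidistant prices from `a` to `b`. -/
def grid (a b : ℝ) (k : Fin 5) : ℝ := (1 - (k : ℝ) / 4) * a + (k : ℝ) / 4 * b

/-- The price vector of a hypercube and the period of its last update. -/
structure CellState where
  rho : Fin 5 → ℝ
  start : ℕ

/-- The update condition for three consecutive prices, of which `k₀` should be the best and `k₂` the
worst: `μ ≥ c₂` and
`min (r̂_{k₀}/μ̂_{k₀} - r̂_{k₁}/μ̂_{k₁}) (r̂_{k₁}/μ̂_{k₁} - r̂_{k₂}/μ̂_{k₂}) > 3 c₁ / √μ + 3 c₁' / μ`,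
where `μ = min (μ̂_{k₀}, μ̂_{k₁}, μ̂_{k₂})`. -/
def Increasing (A : Params) (rhat muhat : Fin 5 → ℝ) (k₀ k₁ k₂ : Fin 5) : Prop :=
  let mu : ℝ := min (muhat k₀) (min (muhat k₁) (muhat k₂))
  A.c2 ≤ mu ∧
    3 * A.c1 / Real.sqrt mu + 3 * A.c1' / mu
      < min (rhat k₀ / muhat k₀ - rhat k₁ / muhat k₁) (rhat k₁ / muhat k₁ - rhat k₂ / muhat k₂)

open Classical in
/-- The state of hypercube `j` at the end of period `t`. -/
def cellState {d m : ℕ} [NeZero m] (A : Params) (s : ℕ → Obs d) (W : Noise d m A.T)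
    (j : Cell d m) : ℕ → CellState
  | 0 => ⟨grid A.pLo A.pHi, 0⟩
  | t + 1 =>
    let S : CellState := cellState A s W j t
    let rhat : Fin 5 → ℝ := fun k =>
      stat A.T s W .revenue j k (t + 1) - stat A.T s W .revenue j k S.start
    let muhat : Fin 5 → ℝ := fun k =>
      stat A.T s W .count j k (t + 1) - stat A.T s W .count j k S.start
    if Increasing A rhat muhat 2 1 0 then ⟨grid (S.rho 1) (S.rho 4), t + 1⟩
    else if Increasing A rhat muhat 2 3 4 then ⟨grid (S.rho 0) (S.rho 3), t + 1⟩
    else S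

/-- The price that the algorithm offers in period `t ≥ 1` to a customer with context `x`; it only
reads the data `s 1, …, s (t - 1)`. -/
def price (m : ℕ) {d : ℕ} [NeZero m] (A : Params) (t : ℕ) (s : ℕ → Obs d) (x : Ctx d)
    (W : Noise d m A.T) : ℝ :=
  (cellState A s W (cellOf x) (t - 1)).rho (priceIdx t)

/-! ### The demand model -/

/-- Expected revenue `f(p, x) = p λ(p, x)`. -/
def revenue {d : ℕ} (lam : ℝ → Ctx d → ℝ) (p : ℝ) (x : Ctx d) : ℝ := p * lam p x

/-- The closed axis-parallel hypercube with lower corner `a` and side `r`. -/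
def hypercube {d : ℕ} (a : Ctx d) (r : ℝ) : Set (Ctx d) := {x | ∀ i, a i ≤ x i ∧ x i ≤ a i + r}

/-- `f_B(p) = E[f(p, x) | x ∈ B]`. -/
def revenueOn {d : ℕ} (PX : Measure (Ctx d)) (lam : ℝ → Ctx d → ℝ) (B : Set (Ctx d)) (p : ℝ) : ℝ :=
  ∫ x, revenue lam p x ∂(ProbabilityTheory.cond PX B)

/-- The assumptions on the context distribution `PX`, the demand function `lam` and the optimal
price `pstar`, with context domain `[0,1]^d`. -/
structure Model {d : ℕ} (pLo pHi CX CL σH CH Cp : ℝ) (PX : Measure (Ctx d))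
    (lam : ℝ → Ctx d → ℝ) (pstar : Ctx d → ℝ) : Prop where
  /-- Prices lie in `[0,1]`. -/
  price_range : 0 ≤ pLo ∧ pLo < pHi ∧ pHi ≤ 1
  /-- The contexts have a density on `[0,1]^d` that is bounded by `CX`. -/
  prob : IsProbabilityMeasure PX
  density : ∃ χ : Ctx d → ℝ, Measurable χ ∧ (∀ x ∈ unitCube d, 0 ≤ χ x ∧ χ x ≤ CX) ∧
    PX = (volume.restrict (unitCube d)).withDensity fun x => ENNReal.ofReal (χ x)
  /-- Demands lie in `[0,1]`, hence so do their means. -/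
  demand_range : ∀ p ∈ Set.Icc pLo pHi, ∀ x ∈ unitCube d, lam p x ∈ Set.Icc (0 : ℝ) 1
  /-- `pstar x` maximizes `f(·, x)`. -/
  pstar_mem : ∀ x ∈ unitCube d, pstar x ∈ Set.Icc pLo pHi
  pstar_max : ∀ x ∈ unitCube d, IsMaxOn (fun p => revenue lam p x) (Set.Icc pLo pHi) (pstar x)
  /-- Lipschitz continuity. -/
  lipschitz : ∀ p ∈ Set.Icc pLo pHi, ∀ p' ∈ Set.Icc pLo pHi, ∀ x ∈ unitCube d, ∀ x' ∈ unitCube d,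
    |revenue lam p x - revenue lam p' x'| ≤ CL * (|p - p'| + ‖x - x'‖)
  /-- Strong concavity and smoothness of `f_B`, and control of the optimal prices, on every
  hypercube `B` that has customers. -/
  constants : 0 < σH ∧ σH ≤ CH
  cubes : ∀ (a : Ctx d) (r : ℝ), 0 < r → hypercube a r ⊆ unitCube d → PX (hypercube a r) ≠ 0 →
    ContDiffOn ℝ 2 (revenueOn PX lam (hypercube a r)) (Set.Ioo pLo pHi) ∧
    (∀ p ∈ Set.Ioo pLo pHi,
      σH ^ 2 ≤ -(iteratedDeriv 2 (revenueOn PX lam (hypercube a r)) p) ∧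
      -(iteratedDeriv 2 (revenueOn PX lam (hypercube a r)) p) ≤ CH ^ 2) ∧
    (∃ pB ∈ Set.Ioo pLo pHi,
      IsMaxOn (revenueOn PX lam (hypercube a r)) (Set.Icc pLo pHi) pB ∧
      sInf (pstar '' hypercube a r) ≤ pB ∧ pB ≤ sSup (pstar '' hypercube a r)) ∧
    sSup (pstar '' hypercube a r) - sInf (pstar '' hypercube a r)
      ≤ Cp * Metric.diam (hypercube a r)

/-! ### Interaction of the algorithm with the customers -/

/-- The events known before customer `t` arrives: all contexts and demands of the past, together
with the whole noise of the algorithm. -/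
@[reducible] def past {d m T : ℕ} {Ω : Type*} (x : ℕ → Ω → Ctx d) (y : ℕ → Ω → ℝ) (W : Ω → Noise d m T)
    (t : ℕ) : MeasurableSpace Ω :=
  (⨆ i ∈ Finset.Ico 1 t,
    (MeasurableSpace.comap (x i) inferInstance ⊔ MeasurableSpace.comap (y i) inferInstance)) ⊔
  MeasurableSpace.comap W inferInstance

/-- The random contexts `x t`, demands `y t` and prices `p t`, `1 ≤ t ≤ T`, and the noise `W`, arise
when the algorithm is run: the contexts are i.i.d. with law `PX`, the noise is independent of the
customers, every price is the one that the algorithm computes from the past, and, given the past,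
the current context and hence the price, the demand has mean `lam (p t) (x t)`. -/
structure IsRun {d m : ℕ} [NeZero m] (A : Params) (PX : Measure (Ctx d)) (lam : ℝ → Ctx d → ℝ)
    {Ω : Type*} [mΩ : MeasurableSpace Ω] (P : Measure Ω) (x : ℕ → Ω → Ctx d) (y p : ℕ → Ω → ℝ)
    (W : Ω → Noise d m A.T) : Prop where
  prob : IsProbabilityMeasure P
  measurable_x : ∀ t, Measurable (x t)
  measurable_y : ∀ t, Measurable (y t)
  measurable_W : Measurable W
  noise_law : P.map W = noiseLaw d m A.T A.ε
  price_eq : ∀ t ∈ Finset.Icc 1 A.T, ∀ ω,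
    p t ω = price m A t (fun i => ⟨x i ω, y i ω, p i ω⟩) (x t ω) (W ω)
  context_law : ∀ t ∈ Finset.Icc 1 A.T, P.map (x t) = PX
  context_indep : ∀ t ∈ Finset.Icc 1 A.T,
    Indep (MeasurableSpace.comap (x t) inferInstance) (past x y W t) P
  demand_range : ∀ t ∈ Finset.Icc 1 A.T, ∀ᵐ ω ∂P, y t ω ∈ Set.Icc (0 : ℝ) 1
  demand_mean : ∀ t ∈ Finset.Icc 1 A.T,
    P[y t | past x y W t ⊔ MeasurableSpace.comap (x t) inferInstance]
      =ᵐ[P] fun ω => lam (p t ω) (x t ω)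

/-- The regret `∑ t ≤ T, (f(p*(x_t), x_t) - f(p_t, x_t))` of one run. -/
def regret {d : ℕ} (T : ℕ) (lam : ℝ → Ctx d → ℝ) (pstar : Ctx d → ℝ) {Ω : Type*}
    (x : ℕ → Ω → Ctx d) (p : ℕ → Ω → ℝ) (ω : Ω) : ℝ :=
  ∑ t ∈ Finset.Icc 1 T,
    (revenue lam (pstar (x t ω)) (x t ω) - revenue lam (p t ω) (x t ω))

/-- The tuned parameters: `c₁ = √(ln (2T³))`, `c₂ = 76 ε⁻¹ ln² (2T³)`, `c₁' = 4 c₂`. -/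
def tuned (T : ℕ) (ε pLo pHi : ℝ) : Params where
  T := T
  ε := ε
  pLo := pLo
  pHi := pHi
  c1 := Real.sqrt (Real.log (2 * (T : ℝ) ^ 3))
  c1' := 4 * (76 * ε⁻¹ * Real.log (2 * (T : ℝ) ^ 3) ^ 2)
  c2 := 76 * ε⁻¹ * Real.log (2 * (T : ℝ) ^ 3) ^ 2

/-- `J = m ^ d` is the number `⌈T ^ (d / (d + 4))⌉`, rounded up to the next `d`-th power of an
integer, so that a partition of `[0,1]^d` into `J` equal hypercubes exists. -/
def IsTunedSide (d T m : ℕ) : Prop :=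
  IsLeast {n : ℕ | ⌈(T : ℝ) ^ ((d : ℝ) / ((d : ℝ) + 4))⌉₊ ≤ n ^ d} m

end CPPQ

end

/-! Privacy. The registers of tree-based aggregation hold sums over dyadic blocks, so an output
depends on data and noise only through the values "block sum plus noise" (`treeState_eq`,
`treeAgg_congr`). One customer enters at most `⌊log₂ T⌋ + 1` blocks of a stream. The price for a
given context reads the streams of one cell only, and among these only the two whose price index is
that of the changed period are affected. The change of one entry is therefore undone by translating
the noise by a vector of ℓ¹-norm at most `2 (⌊log₂ T⌋ + 1)`, which costs a bounded factor
(`pi_laplace_translate_le`).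

Regret. In a cell `B` of probability `q` the algorithm searches for the maximum of the concave
function `f_B` by comparing values. On a path with accurate statistics a decisive triple tells on
which side of a grid price the maximizer lies, so the price interval shrinks by the factor `3/4` and
keeps the maximizer. By strong concavity neighbouring grid prices on one side of the maximizer
differ in revenue by order `σ²Δ²`, where `Δ` is the width. So a phase ends after order `Λ/(σ⁴Δ⁴) +
e/(σ²Δ²)` samples per price, up to lower-order terms, `e` being the noise level. By smoothness a
period loses at most `C²Δ²/2`. A phase thus loses order `C²(Λ/(σ⁴Δ²) + e/σ²)`, and all phases of
width at most `D` together lose at most `C² q T D² / 2` (`GoodPath.regret_le`).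

Accuracy. The revenues of a cell estimate `f_B`, since the current context is independent of the
past, which determines the price of the cell. Hoeffding's lemma then gives an exponential
supermartingale (`IsRun.lintegral_exp_centered_le`). Arrivals and Laplace sums have exponential
tails too, and a union bound leaves exceptional paths of probability at most `30 / T`
(`IsRun.measure_not_goodPath_le`).

Tuning. Using the maximizer of `f_B` instead of `p*(x)` costs only the square of the side `1/m`,
because cubes shrinking to `x` carry the quadratic upper bound over to `f(·, x)`
(`Model.ae_revenue_sub_le`). Summing over the cells (`IsRun.integral_regret_le`) with `D =
T^(-1/(d+4))` and `m` of order `T^(1/(d+4))` brings the search, the narrow phases and the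
discretization to the same power `T^((d+2)/(d+4))`, besides the privacy term. -/

noncomputable section

namespace CPPQ

/-! ### Closed form of tree-based aggregation -/

/-- `t` with its binary digits below position `l` cleared. -/
def node (t l : ℕ) : ℕ := t / 2 ^ l * 2 ^ l

/-- The partial sum `u 1 + ⋯ + u t`. -/
def prefixSum (u : ℕ → ℝ) (t : ℕ) : ℝ := ∑ τ ∈ Finset.Icc 1 t, u τ

/-- The exact partial sum stored at time `τ`, which covers `(τ - 2 ^ lowBit τ, τ]`. -/
def blockSum (u : ℕ → ℝ) (τ : ℕ) : ℝ := prefixSum u τ - prefixSum u (τ - 2 ^ lowBit τ)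

lemma prefixSum_succ (u : ℕ → ℝ) (t : ℕ) : prefixSum u (t + 1) = prefixSum u t + u (t + 1) :=
  Finset.sum_Icc_succ_top (by omega) _

lemma testBit_iff (t l : ℕ) : t.testBit l = true ↔ t / 2 ^ l % 2 = 1 := by
  simp [Nat.testBit_eq_decide_div_mod_eq]

lemma lowBit_spec {t : ℕ} (ht : t ≠ 0) : t.testBit (lowBit t) = true := by
  obtain ⟨i, hi⟩ := Nat.exists_testBit_of_ne_zero ht
  exact Nat.sInf_mem (s := {l | t.testBit l = true}) ⟨i, hi⟩

lemma testBit_of_lt_lowBit {t l : ℕ} (h : l < lowBit t) : t.testBit l = false := by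
  have := Nat.notMem_of_lt_sInf (s := {l | t.testBit l = true}) h
  simpa using this

lemma exists_eq_lowBit {t : ℕ} (ht : t ≠ 0) : ∃ k, t = 2 ^ lowBit t * (2 * k + 1) := by
  have hdvd : 2 ^ lowBit t ∣ t := by
    have : ∀ l ≤ lowBit t, 2 ^ l ∣ t := by
      intro l
      induction l with
      | zero => simp
      | succ l ih =>
        intro hl
        obtain ⟨r, hr⟩ := ih (by omega)
        have h0 := testBit_of_lt_lowBit (t := t) (l := l) (by omega)
        have h1 : ¬ (t / 2 ^ l % 2 = 1) := by rw [← testBit_iff]; simp [h0]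
        rw [hr, Nat.mul_div_cancel_left _ (by positivity)] at h1
        obtain ⟨r', hr'⟩ : 2 ∣ r := by omega
        exact ⟨r', by rw [hr, hr', pow_succ]; ring⟩
    exact this _ le_rfl
  obtain ⟨r, hr⟩ := hdvd
  have h1 := (testBit_iff _ _).1 (lowBit_spec ht)
  have h2 : t / 2 ^ lowBit t = r := Nat.div_eq_of_eq_mul_right (by positivity) hr
  rw [h2] at h1
  exact ⟨r / 2, by rw [show 2 * (r / 2) + 1 = r by omega]; exact hr⟩

lemma lowBit_mul (l k : ℕ) : lowBit (2 ^ l * (2 * k + 1)) = l := by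
  apply le_antisymm
  · apply Nat.sInf_le
    change Nat.testBit _ l = true
    rw [testBit_iff, Nat.mul_div_cancel_left _ (by positivity)]
    omega
  · by_contra! h
    have hs := lowBit_spec (t := 2 ^ l * (2 * k + 1)) (by positivity)
    set a := lowBit (2 ^ l * (2 * k + 1))
    rw [testBit_iff] at hs
    obtain ⟨e, he⟩ := Nat.exists_eq_add_of_lt h
    rw [he, show 2 ^ (a + e + 1) * (2 * k + 1) = 2 ^ a * (2 * (2 ^ e * (2 * k + 1))) by
      rw [pow_succ, pow_add]; ring, Nat.mul_div_cancel_left _ (by positivity)] at hs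
    omega

lemma node_succ (t l : ℕ) :
    node t (l + 1) = if t.testBit l = true then node t l - 2 ^ l else node t l := by
  unfold node
  have h : t / 2 ^ (l + 1) = t / 2 ^ l / 2 := by rw [pow_succ, Nat.div_div_eq_div_mul]
  rw [h, pow_succ]
  set r := t / 2 ^ l with hr
  have hb := testBit_iff t l
  rw [← hr] at hb
  split_ifs with hc
  · rw [hb] at hc
    obtain ⟨k, hk⟩ : ∃ k, r = 2 * k + 1 := ⟨r / 2, by omega⟩
    rw [hk, show (2 * k + 1) / 2 = k by omega, show (2 * k + 1) * 2 ^ l = k * (2 ^ l * 2) + 2 ^ l by ring]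
    simp
  · rw [hb] at hc
    obtain ⟨k, hk⟩ : ∃ k, r = 2 * k := ⟨r / 2, by omega⟩
    rw [hk, show (2 * k) / 2 = k by omega]
    ring

lemma lowBit_node {t l : ℕ} (h : t.testBit l = true) : lowBit (node t l) = l := by
  rw [testBit_iff] at h
  unfold node
  generalize t / 2 ^ l = r at h ⊢
  obtain ⟨k, rfl⟩ : ∃ k, r = 2 * k + 1 := ⟨r / 2, by omega⟩
  rw [mul_comm, lowBit_mul]

lemma node_le (t l : ℕ) : node t l ≤ t := Nat.div_mul_le_self _ _

lemma node_pos {t l : ℕ} (h : t.testBit l = true) : 1 ≤ node t l := by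
  rw [testBit_iff] at h
  unfold node
  generalize t / 2 ^ l = r at h ⊢
  exact Nat.mul_pos (by omega) (by positivity)

lemma node_zero (t : ℕ) : node t 0 = t := by simp [node]

lemma node_of_lt {t l : ℕ} (h : t < 2 ^ l) : node t l = 0 := by simp [node, Nat.div_eq_of_lt h]

/-- As `l` grows, `node t l` descends from `t` to `0`, losing one set digit at a time, as in a
Fenwick tree. The lowest digit of `node t l` is `l` when that digit is set, so the block stored at
this node is exactly the step of the descent. -/
lemma prefixSum_node_sub (u : ℕ → ℝ) (t l : ℕ) :
    prefixSum u (node t l) - prefixSum u (node t (l + 1)) =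
      if t.testBit l = true then blockSum u (node t l) else 0 := by
  rw [node_succ]
  split_ifs with h
  · rw [blockSum, lowBit_node h]
  · simp

lemma sum_blockSum (u : ℕ → ℝ) (t n : ℕ) :
    ∑ l ∈ Finset.range n, (if t.testBit l = true then blockSum u (node t l) else 0) =
      prefixSum u t - prefixSum u (node t n) := by
  simp_rw [← prefixSum_node_sub]
  rw [Finset.sum_range_sub', node_zero]

/-- Binary carry: with `t + 1 = 2 ^ a * (2 k + 1)`, the number `t` has a zero at position `a`, ones
below it, and the same digits above it. -/
lemma node_succ_lowBit (t : ℕ) :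
    node (t + 1) (lowBit (t + 1)) = t + 1 ∧
    t + 1 - 2 ^ lowBit (t + 1) = node t (lowBit (t + 1)) ∧
    (∀ l, lowBit (t + 1) < l → (t + 1) / 2 ^ l = t / 2 ^ l) ∧
    t.testBit (lowBit (t + 1)) = false := by
  obtain ⟨k, hk⟩ := exists_eq_lowBit (t := t + 1) (by omega)
  set a := lowBit (t + 1)
  have hpos : 0 < 2 ^ a := by positivity
  have hdiv : t / 2 ^ a = 2 * k := by
    have ht : t = 2 ^ a - 1 + 2 ^ a * (2 * k) := by
      have : 2 ^ a * (2 * k + 1) = 2 ^ a * (2 * k) + 2 ^ a := by ring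
      omega
    rw [ht, Nat.add_mul_div_left _ _ hpos, Nat.div_eq_of_lt (by omega)]
    simp
  refine ⟨?_, ?_, ?_, ?_⟩
  · unfold node
    rw [hk, Nat.mul_div_cancel_left _ hpos]; ring
  · unfold node
    rw [hdiv, hk, show 2 ^ a * (2 * k + 1) = 2 * k * 2 ^ a + 2 ^ a by ring]
    simp
  · intro l hl
    rw [Nat.succ_div, if_neg, add_zero]
    intro hd
    obtain ⟨e, rfl⟩ := Nat.exists_eq_add_of_lt hl
    rw [hk, add_assoc, pow_add] at hd
    have h2 := Nat.dvd_of_mul_dvd_mul_left hpos hd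
    have : 2 ∣ 2 * k + 1 := dvd_trans (by rw [pow_succ]; exact dvd_mul_left _ _) h2
    omega
  · rw [Bool.eq_false_iff, Ne, testBit_iff, hdiv]
    omega

/-- Loop invariant: a register with a set digit holds the block that ends at the corresponding node,
and its noise is the one drawn when that node was reached. -/
theorem treeState_eq (u w : ℕ → ℝ) (t l : ℕ) :
    (treeState u w t).a l = (if t.testBit l = true then blockSum u (node t l) else 0) ∧
    (treeState u w t).ahat l =
      if t.testBit l = true then blockSum u (node t l) + w (node t l) else 0 := by
  induction t generalizing l with
  | zero => simp [treeState]
  | succ t ih =>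
    obtain ⟨h1, h2, h3, h4⟩ := node_succ_lowBit t
    rcases lt_trichotomy l (lowBit (t + 1)) with h | h | h
    · simp [treeState, treeStep, h, testBit_of_lt_lowBit h]
    -- The registers below the carry position telescope to the sum over `(node t a, t]` with `a =
    -- lowBit (t + 1)`, and `node t a` is the left end of the new block.
    · have hm : (∑ l ∈ Finset.range (lowBit (t + 1)), (treeState u w t).a l) + u (t + 1) =
          blockSum u (t + 1) := by
        simp_rw [fun l => (ih l).1]
        rw [sum_blockSum, blockSum, h2, prefixSum_succ]
        ring
      subst h
      simp [treeState, treeStep, lowBit_spec, h1, hm]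
    · have hb : (t + 1).testBit l = t.testBit l := by
        simp [Nat.testBit_eq_decide_div_mod_eq, h3 l h]
      have hn : node (t + 1) l = node t l := by simp [node, h3 l h]
      simp [treeState, treeStep, not_lt.2 h.le, h.ne', hb, hn, ih l]

lemma treeAgg_eq_sum (T : ℕ) (u w : ℕ → ℝ) (t : ℕ) :
    treeAgg T u w t = ∑ l ∈ Finset.range (Nat.log 2 T + 1),
      if t.testBit l = true then blockSum u (node t l) + w (node t l) else 0 := by
  unfold treeAgg
  refine Finset.sum_congr rfl fun l _ => ?_
  split_ifs with h
  · rw [(treeState_eq u w t l).2, if_pos h]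
  · rfl

/-- The released value is the exact partial sum plus the noises of the binary digits. -/
theorem treeAgg_eq {T t : ℕ} (ht : t ≤ T) (u w : ℕ → ℝ) :
    treeAgg T u w t = prefixSum u t +
      ∑ l ∈ Finset.range (Nat.log 2 T + 1), if t.testBit l = true then w (node t l) else 0 := by
  rw [treeAgg_eq_sum]
  have h := sum_blockSum u t (Nat.log 2 T + 1)
  rw [node_of_lt (lt_of_le_of_lt ht (Nat.lt_pow_succ_log_self (by norm_num) T))] at h
  have h0 : prefixSum u 0 = 0 := by simp [prefixSum]
  rw [h0, sub_zero] at h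
  rw [← h, ← Finset.sum_add_distrib]
  refine Finset.sum_congr rfl fun l _ => ?_
  split_ifs <;> simp

/-- The output depends on the input only through the noisy block sums. -/
lemma treeAgg_congr {T t : ℕ} (ht : t ≤ T) {u w u' w' : ℕ → ℝ}
    (h : ∀ τ ∈ Finset.Icc 1 T, blockSum u τ + w τ = blockSum u' τ + w' τ) :
    treeAgg T u w t = treeAgg T u' w' t := by
  rw [treeAgg_eq_sum, treeAgg_eq_sum]
  refine Finset.sum_congr rfl fun l _ => ?_
  split_ifs with hb
  · exact h _ (Finset.mem_Icc.2 ⟨node_pos hb, (node_le t l).trans ht⟩)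
  · rfl

/-- A change of one input by at most one changes the block sums by at most `⌊log₂ T⌋ + 1` in
total. -/
lemma sum_abs_blockSum_sub_le {T j : ℕ} {u u' : ℕ → ℝ} (h1 : |u j - u' j| ≤ 1)
    (hne : ∀ i, i ≠ j → u i = u' i) :
    ∑ τ ∈ Finset.Icc 1 T, |blockSum u τ - blockSum u' τ| ≤ (Nat.log 2 T : ℝ) + 1 := by
  have hpre : ∀ n, prefixSum u n - prefixSum u' n = if j ∈ Finset.Icc 1 n then u j - u' j else 0 := by
    intro n
    unfold prefixSum
    rw [← Finset.sum_sub_distrib]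
    rw [← Finset.sum_ite_eq' (Finset.Icc 1 n) j (fun i => u i - u' i)]
    refine Finset.sum_congr rfl fun i _ => ?_
    split_ifs with hi
    · rfl
    · rw [hne i hi, sub_self]
  -- The end points of the blocks that contain `j`; the other block sums do not change.
  set S := (Finset.Icc 1 T).filter fun τ => τ - 2 ^ lowBit τ < j ∧ j ≤ τ with hS
  have hb : ∀ τ ∈ Finset.Icc 1 T, |blockSum u τ - blockSum u' τ| ≤ if τ ∈ S then 1 else 0 := by
    intro τ hτ
    have : blockSum u τ - blockSum u' τ = (if j ∈ Finset.Icc 1 τ then u j - u' j else 0) -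
        (if j ∈ Finset.Icc 1 (τ - 2 ^ lowBit τ) then u j - u' j else 0) := by
      rw [← hpre, ← hpre]; unfold blockSum; ring
    rw [this]
    have hsub : τ - 2 ^ lowBit τ ≤ τ := Nat.sub_le _ _
    simp only [hS, Finset.mem_filter, hτ, true_and, Finset.mem_Icc]
    split_ifs <;> first | omega | simp_all
  refine (Finset.sum_le_sum hb).trans ?_
  rw [Finset.sum_ite_mem, Finset.sum_const, nsmul_eq_mul, mul_one,
    Finset.inter_eq_right.2 (Finset.filter_subset _ _)]
  have hcard : S.card ≤ (Finset.range (Nat.log 2 T + 1)).card := by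
    apply Finset.card_le_card_of_injOn lowBit
    · intro τ hτ
      simp only [hS, Finset.coe_filter, Set.mem_ofPred_eq, Finset.mem_Icc] at hτ
      obtain ⟨k, hk⟩ := exists_eq_lowBit (t := τ) (by omega)
      have : 2 ^ lowBit τ ≤ T := by
        refine le_trans ?_ hτ.1.2
        conv_rhs => rw [hk]
        exact Nat.le_mul_of_pos_right _ (by omega)
      simpa [Nat.lt_succ_iff] using Nat.le_log_of_pow_le (by norm_num) this
    · intro τ hτ τ' hτ' hl
      simp only [hS, Finset.coe_filter, Set.mem_ofPred_eq, Finset.mem_Icc] at hτ hτ'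
      obtain ⟨k, hk⟩ := exists_eq_lowBit (t := τ) (by omega)
      obtain ⟨k', hk'⟩ := exists_eq_lowBit (t := τ') (by omega)
      rw [hl] at hk hτ
      set B := 2 ^ lowBit τ' with hB
      have hBpos : 0 < B := by positivity
      -- Blocks of equal length `B` end at odd multiples of `B`, so distinct ones are disjoint: at
      -- most one block of each level contains `j`.
      have e1 : k = k' := by
        by_contra hkk
        rcases lt_or_gt_of_ne hkk with h | h
        · have : B * (2 * k + 1) + B ≤ B * (2 * k' + 1) := by nlinarith
          omega
        · have : B * (2 * k' + 1) + B ≤ B * (2 * k + 1) := by nlinarith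
          omega
      rw [hk, hk', e1]
  rw [Finset.card_range] at hcard
  exact_mod_cast hcard

/-! ### The Laplace distribution -/

lemma lintegral_exp_neg_abs_div {b : ℝ} (hb : 0 < b) :
    ∫⁻ z : ℝ, ENNReal.ofReal (1 / (2 * b) * Real.exp (-|z| / b)) = 1 := by
  have hint : Integrable (fun z : ℝ => Real.exp (-|z| / b)) := by
    have hb' : 0 < b⁻¹ := by positivity
    rw [← integrableOn_univ, ← Set.Iic_union_Ioi (a := (0 : ℝ))]
    refine IntegrableOn.union ?_ ?_
    · refine (integrableOn_exp_mul_Iic hb' 0).congr_fun (fun z hz => ?_) measurableSet_Iic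
      simp only [abs_of_nonpos (Set.mem_Iic.1 hz), neg_neg, div_eq_inv_mul]
    · refine (integrableOn_exp_mul_Ioi (neg_lt_zero.2 hb') 0).congr_fun (fun z hz => ?_)
        measurableSet_Ioi
      simp only [abs_of_pos (Set.mem_Ioi.1 hz), div_eq_inv_mul, mul_neg, neg_mul]
  rw [← ofReal_integral_eq_lintegral_ofReal (hint.const_mul _)
    (Filter.Eventually.of_forall fun z => by positivity), integral_const_mul]
  have : ∫ z : ℝ, Real.exp (-|z| / b) = 2 * b := by
    have h := integral_comp_abs (f := fun z => Real.exp (-z / b))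
    rw [h]
    have h2 := integral_exp_mul_Ioi (a := -b⁻¹) (by simpa using hb) 0
    simp only [mul_zero, Real.exp_zero] at h2
    rw [show (fun x : ℝ => Real.exp (-x / b)) = fun x => Real.exp (-b⁻¹ * x) by
      ext x; congr 1; field_simp, h2]
    field_simp
  rw [this]
  rw [one_div_mul_cancel (by positivity)]; simp

lemma isProbabilityMeasure_laplace {b : ℝ} (hb : 0 < b) : IsProbabilityMeasure (laplace b) :=
  ⟨by rw [laplace, withDensity_apply _ MeasurableSet.univ, Measure.restrict_univ,
    lintegral_exp_neg_abs_div hb]⟩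

/-- Translation invariance of Lebesgue measure puts both sides under one integral; the densities
then compare by `|z + h| ≤ |z| + |h|`. -/
lemma map_add_laplace_le {b : ℝ} (hb : 0 < b) (h : ℝ) :
    (laplace b).map (fun z => z + h) ≤ ENNReal.ofReal (Real.exp (|h| / b)) • laplace b := by
  refine Measure.le_iff.2 fun s hs => ?_
  have hm : Measurable fun z : ℝ => ENNReal.ofReal (1 / (2 * b) * Real.exp (-|z| / b)) := by
    fun_prop
  rw [Measure.map_apply (by fun_prop) hs, laplace, Measure.smul_apply, smul_eq_mul,
    withDensity_apply _ (hs.preimage (by fun_prop)), withDensity_apply _ hs,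
    ← lintegral_indicator (hs.preimage (by fun_prop)), ← lintegral_indicator hs,
    ← lintegral_const_mul _ (hm.indicator hs),
    ← lintegral_add_right_eq_self (fun z => ENNReal.ofReal (Real.exp (|h| / b)) * s.indicator
      (fun z => ENNReal.ofReal (1 / (2 * b) * Real.exp (-|z| / b))) z) h]
  refine lintegral_mono fun z => ?_
  by_cases hz : z + h ∈ s
  · rw [Set.indicator_of_mem (by exact hz), Set.indicator_of_mem hz,
      ← ENNReal.ofReal_mul (by positivity)]
    refine ENNReal.ofReal_le_ofReal ?_
    rw [mul_left_comm, ← Real.exp_add, ← add_div]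
    gcongr
    have := abs_add_le z h
    linarith
  · rw [Set.indicator_of_notMem (by exact hz)]
    exact zero_le

/-- The product measure comes from the largest outer measure that is bounded by the product on
boxes. Comparing on boxes is therefore enough, once the factor is moved to the left side. -/
lemma pi_le_smul_pi {ι : Type*} [Fintype ι] {μ ν : ι → Measure ℝ} [∀ i, SigmaFinite (μ i)]
    [∀ i, SigmaFinite (ν i)] {c : ι → ℝ} (h : ∀ i, μ i ≤ ENNReal.ofReal (Real.exp (c i)) • ν i) :
    Measure.pi μ ≤ ENNReal.ofReal (Real.exp (∑ i, c i)) • Measure.pi ν := by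
  set C := ENNReal.ofReal (Real.exp (∑ i, c i)) with hC
  have hC0 : C ≠ 0 := by simp [hC, Real.exp_pos]
  have hCt : C ≠ ⊤ := ENNReal.ofReal_ne_top
  have hle : (C⁻¹ • Measure.pi μ).toOuterMeasure ≤ OuterMeasure.pi fun i => (ν i).toOuterMeasure := by
    rw [OuterMeasure.le_pi]
    intro s _
    simp only [Measure.coe_toOuterMeasure, Measure.smul_apply, smul_eq_mul, Measure.pi_pi]
    have : ∏ i, μ i (s i) ≤ C * ∏ i, ν i (s i) := by
      rw [hC, Real.exp_sum, ENNReal.ofReal_prod_of_nonneg (fun i _ => (Real.exp_pos _).le),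
        ← Finset.prod_mul_distrib]
      exact Finset.prod_le_prod' fun i _ => h i (s i)
    rw [ENNReal.inv_mul_le_iff hC0 hCt]
    exact this
  refine Measure.le_iff.2 fun s hs => ?_
  have h2 := hle s
  rw [Measure.coe_toOuterMeasure, Measure.smul_apply, smul_eq_mul,
    ENNReal.inv_mul_le_iff hC0 hCt] at h2
  refine h2.trans ?_
  rw [Measure.smul_apply, smul_eq_mul, Measure.pi, toMeasure_apply _ _ hs]

/-- Translating independent Laplace variables changes probabilities by a bounded factor. -/
lemma pi_laplace_translate_le {ι : Type*} [Fintype ι] {b : ℝ} (hb : 0 < b) (h : ι → ℝ)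
    (E : Set (ι → ℝ)) :
    Measure.pi (fun _ : ι => laplace b) {w | w + h ∈ E} ≤
      ENNReal.ofReal (Real.exp (∑ i, |h i| / b)) * Measure.pi (fun _ : ι => laplace b) E := by
  have := isProbabilityMeasure_laplace hb
  have hprob : ∀ i, IsProbabilityMeasure ((laplace b).map fun z => z + h i) := fun i =>
    Measure.isProbabilityMeasure_map (by fun_prop)
  have hmap := Measure.pi_map_pi (μ := fun _ : ι => laplace b) (f := fun i z => z + h i)
    (fun i => by fun_prop)
  have hle := pi_le_smul_pi (c := fun i => |h i| / b) fun i => map_add_laplace_le hb (h i)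
  -- A measurable equivalence gives the image formula for every set, so privacy needs no
  -- measurability of the price.
  have h1 := (MeasurableEquiv.addRight h).map_apply (μ := Measure.pi fun _ : ι => laplace b) E
  have h2 : (Measure.pi fun _ : ι => laplace b).map (MeasurableEquiv.addRight h) =
      Measure.pi fun i => (laplace b).map fun z => z + h i := by
    rw [← hmap]; rfl
  rw [h2] at h1
  have h3 := hle E
  rw [h1] at h3
  exact h3

/-! ### Privacy -/

section Privacy

variable {d m : ℕ} [NeZero m]

lemma treeScale_half {ε : ℝ} (T : ℕ) : treeScale (ε / 2) T = 4 * ((Nat.log 2 T : ℝ) + 1) / ε := by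
  unfold treeScale
  have : ((Nat.log 2 T : ℝ) + 1) ≠ 0 := by positivity
  rcases eq_or_ne ε 0 with rfl | h
  · simp
  · field_simp; norm_num

lemma treeScale_half_pos {ε : ℝ} (hε : 0 < ε) (T : ℕ) : 0 < treeScale (ε / 2) T := by
  rw [treeScale_half]; positivity

lemma stat_congr {T : ℕ} {s s' : ℕ → Obs d} {W W' : Noise d m T} {q : StatKind} {j : Cell d m}
    {k : Fin 5}
    (h : ∀ τ ∈ Finset.Icc 1 T, blockSum (increment s q j k) τ + W.seq q j k τ =
      blockSum (increment s' q j k) τ + W'.seq q j k τ) {t : ℕ} (ht : t ≤ T) :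
    stat T s W q j k t = stat T s' W' q j k t := by
  induction t with
  | zero => rfl
  | succ t ih =>
    simp only [stat]
    rw [treeAgg_congr ht h, ih (by omega)]

/-- The increase of the private statistics from the end of period `ς` to the end of period `t`. -/
def statDiff {T : ℕ} (s : ℕ → Obs d) (W : Noise d m T) (q : StatKind) (j : Cell d m) (ς t : ℕ) :
    Fin 5 → ℝ := fun k => stat T s W q j k t - stat T s W q j k ς

open Classical in
lemma cellState_succ (A : Params) (s : ℕ → Obs d) (W : Noise d m A.T) (j : Cell d m) (t : ℕ) :
    cellState A s W j (t + 1) =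
      if Increasing A (statDiff s W .revenue j (cellState A s W j t).start (t + 1))
        (statDiff s W .count j (cellState A s W j t).start (t + 1)) 2 1 0
      then ⟨grid ((cellState A s W j t).rho 1) ((cellState A s W j t).rho 4), t + 1⟩
      else if Increasing A (statDiff s W .revenue j (cellState A s W j t).start (t + 1))
        (statDiff s W .count j (cellState A s W j t).start (t + 1)) 2 3 4
      then ⟨grid ((cellState A s W j t).rho 0) ((cellState A s W j t).rho 3), t + 1⟩
      else cellState A s W j t := rfl

lemma cellState_start_le (A : Params) (s : ℕ → Obs d) (W : Noise d m A.T) (j : Cell d m) (t : ℕ) :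
    (cellState A s W j t).start ≤ t := by
  induction t with
  | zero => simp [cellState]
  | succ t ih =>
    rw [cellState_succ]
    split_ifs
    · exact le_rfl
    · exact le_rfl
    · omega

lemma cellState_congr {A : Params} {s s' : ℕ → Obs d} {W W' : Noise d m A.T} {j : Cell d m}
    (h : ∀ q k, ∀ τ ∈ Finset.Icc 1 A.T, blockSum (increment s q j k) τ + W.seq q j k τ =
      blockSum (increment s' q j k) τ + W'.seq q j k τ) {t : ℕ} (ht : t ≤ A.T) :
    cellState A s W j t = cellState A s' W' j t := by
  induction t with
  | zero => rfl
  | succ t ih =>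
    have hs := cellState_start_le A s' W' j t
    rw [cellState_succ, cellState_succ, ih (by omega)]
    have e : ∀ r ≤ A.T, ∀ q, statDiff s W q j r (t + 1) = statDiff s' W' q j r (t + 1) := by
      intro r hr q
      funext k
      rw [statDiff, statDiff, stat_congr (h q k) ht, stat_congr (h q k) hr]
    rw [e _ (by omega), e _ (by omega)]

lemma increment_mem_Icc {pLo pHi : ℝ} (h0 : 0 ≤ pLo) (h1 : pHi ≤ 1) {s : ℕ → Obs d} {t : ℕ}
    (hs : (s t).InDomain pLo pHi) (q : StatKind) (j : Cell d m) (k : Fin 5) :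
    increment s q j k t ∈ Set.Icc (0 : ℝ) 1 := by
  obtain ⟨-, ⟨hy0, hy1⟩, hp0, hp1⟩ := hs
  unfold increment
  split_ifs
  · cases q
    · exact ⟨mul_nonneg hy0 (h0.trans hp0), mul_le_one₀ hy1 (h0.trans hp0) (hp1.trans h1)⟩
    · simp
  · simp

theorem isCDP_price (A : Params) (hε : 0 < A.ε) (h0 : 0 ≤ A.pLo) (h1 : A.pHi ≤ 1) :
    IsCDP (d := d) (noiseLaw d m A.T A.ε) A.T A.pLo A.pHi A.ε (price m A) := by
  intro t ht j hj s s' hs hs' hne x _ U _ _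
  rw [Finset.mem_Icc] at ht
  set c₀ : Cell d m := cellOf x
  -- The translation that makes the noisy block sums of `s'` equal to those of `s` in the cell of
  -- `x`. The price for `x` reads no other cell, even if entry `j` moves between cells.
  set h : Noise d m A.T := fun i =>
    if i.2.1 = c₀ then blockSum (increment s i.1 i.2.1 i.2.2.1) i.2.2.2 -
      blockSum (increment s' i.1 i.2.1 i.2.2.1) i.2.2.2 else 0 with hh
  set b := treeScale (A.ε / 2) A.T with hbdef
  have hb : 0 < b := treeScale_half_pos hε _
  have hprice : ∀ W, price m A t s x W = price m A t s' x (W + h) := by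
    intro W
    unfold price
    rw [cellState_congr (W' := W + h) (s' := s') _ (by omega)]
    intro q k τ hτ
    simp only [Noise.seq, hτ, dite_true, Pi.add_apply, hh]
    simp only [c₀, if_true]
    ring
  have hsub : {W | price m A t s x W ∈ U} = {W | W + h ∈ {W | price m A t s' x W ∈ U}} := by
    ext W
    simp [hprice]
  rw [hsub, noiseLaw]
  refine (pi_laplace_translate_le hb h _).trans ?_
  gcongr
  -- The price index is a function of the period and not of the data, so entry `j` enters only
  -- streams with index `priceIdx j`.
  have hinc : ∀ q c k i, (i ≠ j ∨ k ≠ priceIdx j) →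
      increment (m := m) s q c k i = increment s' q c k i := by
    intro q c k i hi
    rcases eq_or_ne i j with rfl | hij
    · have : ¬ priceIdx i = k := by tauto
      simp [increment, this]
    · simp [increment, hne i hij]
  have hL : (0 : ℝ) < (Nat.log 2 A.T : ℝ) + 1 := by positivity
  have hsum : ∑ i, |h i| ≤ 2 * ((Nat.log 2 A.T : ℝ) + 1) := by
    have hone : ∀ q c k, ∑ τ : {t : ℕ // t ∈ Finset.Icc 1 A.T}, |h (q, c, k, τ)| ≤
        if c = c₀ then if k = priceIdx j then (Nat.log 2 A.T : ℝ) + 1 else 0 else 0 := by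
      intro q c k
      simp only [hh]
      split_ifs with hc hk
      · rw [Finset.univ_eq_attach, Finset.sum_attach (Finset.Icc 1 A.T) fun τ =>
          |blockSum (increment s q c k) τ - blockSum (increment s' q c k) τ|]
        refine sum_abs_blockSum_sub_le (j := j) ?_ fun i hi => hinc q c k i (Or.inl hi)
        obtain ⟨a1, a2⟩ := increment_mem_Icc h0 h1 (hs j) q c k
        obtain ⟨a3, a4⟩ := increment_mem_Icc h0 h1 (hs' j) q c k
        rw [abs_le]; constructor <;> linarith
      · rw [show increment s q c k = increment s' q c k from
          funext fun i => hinc q c k i (Or.inr hk)]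
        simp
      · simp
    simp_rw [Fintype.sum_prod_type]
    calc _ ≤ ∑ q : StatKind, ∑ c : Cell d m, ∑ k : Fin 5,
          (if c = c₀ then if k = priceIdx j then (Nat.log 2 A.T : ℝ) + 1 else 0 else 0) := by
          gcongr with q _ c _ k _
          exact hone q c k
      _ = ∑ q : StatKind, ((Nat.log 2 A.T : ℝ) + 1) := by
          refine Finset.sum_congr rfl fun q _ => ?_
          simp_rw [← Finset.sum_comm (s := (Finset.univ : Finset (Fin 5))), Finset.sum_ite_eq',
            Finset.mem_univ, if_true]
          simp
      _ = 2 * ((Nat.log 2 A.T : ℝ) + 1) := by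
          rw [Finset.sum_const, nsmul_eq_mul]
          have : (Finset.univ : Finset StatKind).card = 2 := by
            have : (Finset.univ : Finset StatKind) = {.revenue, .count} := by
              ext q; cases q <;> simp
            rw [this]; simp
          rw [this]; norm_num
  -- An ℓ¹-shift of `2 (L + 1)` at scale `4 (L + 1) / ε` gives the exponent `ε / 2`, within the
  -- level `ε`.
  rw [← Finset.sum_div, div_le_iff₀ hb]
  refine hsum.trans ?_
  rw [hbdef, treeScale_half]
  field_simp
  norm_num

end Privacy

/-! ### Accuracy of the private statistics -/

/-- The tilted density is twice the Laplace density of scale `2 b`. -/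
lemma lintegral_exp_abs_laplace {b : ℝ} (hb : 0 < b) :
    ∫⁻ z, ENNReal.ofReal (Real.exp (|z| / (2 * b))) ∂(laplace b) = 2 := by
  rw [laplace, lintegral_withDensity_eq_lintegral_mul _ (by fun_prop) (by fun_prop)]
  have : ∀ z : ℝ, ((fun z : ℝ => ENNReal.ofReal (1 / (2 * b) * Real.exp (-|z| / b))) *
      fun z => ENNReal.ofReal (Real.exp (|z| / (2 * b)))) z =
      2 * ENNReal.ofReal (1 / (2 * (2 * b)) * Real.exp (-|z| / (2 * b))) := by
    intro z
    rw [Pi.mul_apply, ← ENNReal.ofReal_mul (by positivity), show (2 : ENNReal) = ENNReal.ofReal 2 by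
      simp, ← ENNReal.ofReal_mul (by positivity), mul_assoc, ← Real.exp_add, ← mul_assoc]
    congr 2
    · field_simp
    · congr 1; field_simp; ring
  simp_rw [this]
  rw [lintegral_const_mul _ (by fun_prop), lintegral_exp_neg_abs_div (by positivity), mul_one]

/-- Markov's inequality for the exponential of the sum at rate `1 / (2 b)`. Injectivity of `g` makes
the factors independent, and each has expectation two. -/
lemma pi_laplace_sum_abs_tail {ι κ : Type*} [Fintype ι] [Fintype κ] {b : ℝ} (hb : 0 < b)
    {g : κ → ι} (hg : Function.Injective g) (N : ℝ) :
    Measure.pi (fun _ : ι => laplace b) {w | N ≤ ∑ k, |w (g k)|} ≤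
      ENNReal.ofReal (2 ^ Fintype.card κ * Real.exp (-N / (2 * b))) := by
  have hP := isProbabilityMeasure_laplace hb
  set X : ι → (ι → ℝ) → ENNReal := fun i w => ENNReal.ofReal (Real.exp (|w i| / (2 * b))) with hX
  have hmeas : ∀ i, Measurable (X i) := fun i => by fun_prop
  have hind : iIndepFun X (Measure.pi fun _ : ι => laplace b) :=
    iIndepFun_pi (X := fun _ z => ENNReal.ofReal (Real.exp (|z| / (2 * b))))
      fun i => by fun_prop
  have hone : ∀ i, ∫⁻ w, X i w ∂(Measure.pi fun _ : ι => laplace b) = 2 := by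
    intro i
    rw [← lintegral_exp_abs_laplace hb,
      ← (measurePreserving_eval (fun _ : ι => laplace b) i).lintegral_comp (by fun_prop)]
  have hprod := lintegral_prod_eq_prod_lintegral_of_indepFun Finset.univ (fun k => X (g k))
    (hind.precomp hg) fun k => hmeas _
  simp_rw [hone, Finset.prod_const, Finset.card_univ] at hprod
  have hmk := mul_meas_ge_le_lintegral (μ := Measure.pi fun _ : ι => laplace b)
    (f := fun w => ∏ k, X (g k) w) (by fun_prop) (ENNReal.ofReal (Real.exp (N / (2 * b))))
  rw [hprod] at hmk
  have hset : {w : ι → ℝ | N ≤ ∑ k, |w (g k)|} ⊆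
      {w | ENNReal.ofReal (Real.exp (N / (2 * b))) ≤ ∏ k, X (g k) w} := by
    intro w hw
    have hw' : N ≤ ∑ k, |w (g k)| := hw
    change _ ≤ ∏ k, X (g k) w
    rw [hX, ← ENNReal.ofReal_prod_of_nonneg fun _ _ => (Real.exp_pos _).le, ← Real.exp_sum,
      ← Finset.sum_div]
    gcongr
  have h1 := (mul_le_mul_right (measure_mono (μ := Measure.pi fun _ : ι => laplace b) hset)
    (ENNReal.ofReal (Real.exp (N / (2 * b))))).trans hmk
  rw [ENNReal.ofReal_mul (by positivity), neg_div, Real.exp_neg, ENNReal.ofReal_inv_of_pos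
    (Real.exp_pos _), mul_comm, ENNReal.ofReal_pow (by norm_num)]
  rw [← ENNReal.div_eq_inv_mul, ENNReal.le_div_iff_mul_le (by simp [Real.exp_pos])
    (by simp), mul_comm]
  simpa using h1

section Accuracy

variable {d m : ℕ}

/-- The sum of the absolute values of the noises in the output of an aggregation at time `t`. -/
def noiseSum {T : ℕ} (W : Noise d m T) (q : StatKind) (j : Cell d m) (k : Fin 5) (t : ℕ) : ℝ :=
  ∑ l ∈ Finset.range (Nat.log 2 T + 1), if t.testBit l = true then |W.seq q j k (node t l)| else 0

lemma noiseSum_zero {T : ℕ} (W : Noise d m T) (q : StatKind) (j : Cell d m) (k : Fin 5) :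
    noiseSum W q j k 0 = 0 := by simp [noiseSum]

lemma noiseSum_tail {T : ℕ} {ε : ℝ} (hε : 0 < ε) {t : ℕ} (ht : t ≤ T) (hT : 1 ≤ T)
    (q : StatKind) (j : Cell d m) (k : Fin 5) :
    noiseLaw d m T ε {W | 2 * treeScale (ε / 2) T * Real.log (2 * (T : ℝ) ^ 3) ≤
      noiseSum W q j k t} ≤ ENNReal.ofReal (1 / (T : ℝ) ^ 2) := by
  have hb := treeScale_half_pos hε T
  have hT0 : (0 : ℝ) < T := by exact_mod_cast hT
  set B := (Finset.range (Nat.log 2 T + 1)).filter fun l => t.testBit l = true with hB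
  have hmem : ∀ l : B, node t l ∈ Finset.Icc 1 T := by
    rintro ⟨l, hl⟩
    have := (Finset.mem_filter.1 hl).2
    exact Finset.mem_Icc.2 ⟨node_pos this, (node_le _ _).trans ht⟩
  set g : B → NoiseIdx d m T := fun l => (q, j, k, ⟨node t l, hmem l⟩) with hg
  have hinj : Function.Injective g := by
    rintro ⟨l, hl⟩ ⟨l', hl'⟩ h
    simp only [hg, Prod.mk.injEq, Subtype.mk.injEq, true_and] at h
    have h1 := lowBit_node (Finset.mem_filter.1 hl).2
    rw [h, lowBit_node (Finset.mem_filter.1 hl').2] at h1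
    exact Subtype.ext h1.symm
  have hsum : ∀ W : Noise d m T, noiseSum W q j k t = ∑ l, |W (g l)| := by
    intro W
    rw [noiseSum, ← Finset.sum_filter, ← Finset.sum_attach]
    refine Finset.sum_congr rfl fun l _ => ?_
    simp [hg, Noise.seq, Finset.mem_Icc.1 (hmem l)]
  simp_rw [hsum]
  refine (pi_laplace_sum_abs_tail hb hinj _).trans (ENNReal.ofReal_le_ofReal ?_)
  have hcard : Fintype.card B ≤ Nat.log 2 T + 1 := by
    rw [Fintype.card_coe, hB]
    exact (Finset.card_filter_le _ _).trans (by simp)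
  -- One output adds at most `L + 1` noises, so the factor `2 ^ (L + 1) ≤ 2 T` only weakens the tail
  -- `1 / (2 T³)` to `1 / T²`.
  have h2 : (2 : ℝ) ^ Fintype.card B ≤ 2 * T := by
    calc (2 : ℝ) ^ Fintype.card B ≤ 2 ^ (Nat.log 2 T + 1) := pow_le_pow_right₀ (by norm_num) hcard
      _ = 2 * ((2 ^ Nat.log 2 T : ℕ) : ℝ) := by rw [pow_succ]; push_cast; ring
      _ ≤ 2 * T := by gcongr; exact Nat.pow_log_le_self 2 (by omega)
  have h3 : Real.exp (-(2 * treeScale (ε / 2) T * Real.log (2 * (T : ℝ) ^ 3)) /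
      (2 * treeScale (ε / 2) T)) = (2 * (T : ℝ) ^ 3)⁻¹ := by
    rw [neg_div, mul_div_cancel_left₀ _ (by positivity), Real.exp_neg, Real.exp_log (by positivity)]
  rw [h3]
  calc _ ≤ 2 * (T : ℝ) * (2 * (T : ℝ) ^ 3)⁻¹ := by gcongr
    _ = _ := by field_simp

/-- The confidence width `2 b ln (2T³)` of the aggregations is at most a sixth of
`c₂ = 76 ε⁻¹ ln² (2T³)`. -/
lemma noise_width_le {T : ℕ} {ε : ℝ} (hε : 0 < ε) (hT : 1 ≤ T) :
    2 * treeScale (ε / 2) T * Real.log (2 * (T : ℝ) ^ 3) ≤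
      76 * ε⁻¹ * Real.log (2 * (T : ℝ) ^ 3) ^ 2 / 6 := by
  have hT1 : (1 : ℝ) ≤ T := by exact_mod_cast hT
  set Λ := Real.log (2 * (T : ℝ) ^ 3) with hΛ
  have hlog : ((Nat.log 2 T : ℝ) + 1) * Real.log 2 ≤ Λ := by
    have h1 : (2 : ℝ) ^ (Nat.log 2 T + 1) ≤ 2 * (T : ℝ) ^ 3 := by
      have h2 : ((2 ^ Nat.log 2 T : ℕ) : ℝ) ≤ T := by exact_mod_cast Nat.pow_log_le_self 2 (by omega)
      push_cast at h2
      have h3 : (T : ℝ) ≤ (T : ℝ) ^ 3 := le_self_pow₀ hT1 (by norm_num)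
      rw [pow_succ]; linarith
    have := Real.log_le_log (by positivity) h1
    rw [Real.log_pow] at this
    push_cast at this
    exact this
  have hl2 := Real.log_two_gt_d9
  have hL : (0 : ℝ) < (Nat.log 2 T : ℝ) + 1 := by positivity
  have hΛ0 : 0 ≤ Λ := le_trans (by positivity) hlog
  rw [treeScale_half]
  -- Origin of the constant 76: the claim reads `48 (L + 1) ≤ 76 Λ`, and `L + 1 ≤ Λ / ln 2` with `48
  -- / ln 2 < 76`.
  have h1 : (Nat.log 2 T : ℝ) + 1 ≤ 76 / 48 * Λ := by nlinarith
  calc 2 * (4 * ((Nat.log 2 T : ℝ) + 1) / ε) * Λ ≤ 2 * (4 * (76 / 48 * Λ) / ε) * Λ := by gcongr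
    _ = _ := by field_simp; ring

variable [NeZero m]

/-- A private statistic is the exact cumulative sum up to the noise of one output. -/
lemma exists_abs_stat_sub_le {T : ℕ} (s : ℕ → Obs d) (W : Noise d m T) (q : StatKind)
    (j : Cell d m) (k : Fin 5) {t : ℕ} (ht : t ≤ T) :
    ∃ τ ≤ t, |stat T s W q j k t - prefixSum (increment s q j k) t| ≤ noiseSum W q j k τ := by
  induction t with
  | zero => exact ⟨0, le_rfl, by simp [stat, prefixSum, noiseSum]⟩
  | succ t ih =>
    simp only [stat]
    split_ifs with hk
    · refine ⟨t + 1, le_rfl, ?_⟩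
      rw [treeAgg_eq ht, add_sub_cancel_left]
      refine (Finset.abs_sum_le_sum_abs _ _).trans (le_of_eq (Finset.sum_congr rfl fun l _ => ?_))
      split_ifs <;> simp
    -- Between refreshes the stream of index `k` receives only zeros, so the old output still
    -- estimates the current sum.
    · obtain ⟨τ, hτ, h⟩ := ih (by omega)
      refine ⟨τ, by omega, ?_⟩
      rw [prefixSum_succ, show increment s q j k (t + 1) = 0 by simp [increment, hk], add_zero]
      exact h

end Accuracy

/-! ### Strongly concave and smooth functions on an interval -/

/-- A concave function increases up to its critical point and decreases after it. It is applied
below to `g` corrected by a parabola at its maximizer, which keeps `c` critical. -/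
lemma monotoneOn_antitoneOn_of_deriv2_nonpos {a b c : ℝ} {k k' k'' : ℝ → ℝ} (hc : c ∈ Set.Ioo a b)
    (hcont : ContinuousOn k (Set.Icc a b)) (h1 : ∀ p ∈ Set.Ioo a b, HasDerivAt k (k' p) p)
    (h2 : ∀ p ∈ Set.Ioo a b, HasDerivAt k' (k'' p) p) (hneg : ∀ p ∈ Set.Ioo a b, k'' p ≤ 0)
    (h0 : k' c = 0) :
    MonotoneOn k (Set.Icc a c) ∧ AntitoneOn k (Set.Icc c b) := by
  have hanti : AntitoneOn k' (Set.Ioo a b) := by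
    refine antitoneOn_of_deriv_nonpos (convex_Ioo a b)
      (fun p hp => (h2 p hp).continuousAt.continuousWithinAt) ?_ ?_
    · rw [interior_Ioo]
      exact fun p hp => (h2 p hp).differentiableAt.differentiableWithinAt
    · rw [interior_Ioo]
      intro p hp
      rw [(h2 p hp).deriv]
      exact hneg p hp
  constructor
  · refine monotoneOn_of_deriv_nonneg (convex_Icc a c)
      (hcont.mono (Set.Icc_subset_Icc_right hc.2.le)) ?_ ?_
    · rw [interior_Icc]
      exact fun p hp => (h1 p ⟨hp.1, hp.2.trans hc.2⟩).differentiableAt.differentiableWithinAt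
    · rw [interior_Icc]
      intro p hp
      have hp' : p ∈ Set.Ioo a b := ⟨hp.1, hp.2.trans hc.2⟩
      rw [(h1 p hp').deriv, ← h0]
      exact hanti hp' hc hp.2.le
  · refine antitoneOn_of_deriv_nonpos (convex_Icc c b)
      (hcont.mono (Set.Icc_subset_Icc_left hc.1.le)) ?_ ?_
    · rw [interior_Icc]
      exact fun p hp => (h1 p ⟨hc.1.trans hp.1, hp.2⟩).differentiableAt.differentiableWithinAt
    · rw [interior_Icc]
      intro p hp
      have hp' : p ∈ Set.Ioo a b := ⟨hc.1.trans hp.1, hp.2⟩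
      rw [(h1 p hp').deriv, ← h0]
      exact hanti hc hp' hp.1.le

lemma hasDerivAt_half_mul_sq (s c p : ℝ) :
    HasDerivAt (fun p => s / 2 * (p - c) ^ 2) (s * (p - c)) p := by
  refine ((((hasDerivAt_id' p).sub_const c).pow 2).const_mul (s / 2)).congr_deriv ?_
  simp only [Nat.cast_ofNat]
  ring

lemma hasDerivAt_mul_sub (s c p : ℝ) : HasDerivAt (fun p => s * (p - c)) s p :=
  (((hasDerivAt_id' p).sub_const c).const_mul s).congr_deriv (mul_one s)

/-- `g` is continuous on `[a, b]`, has its maximum at the interior point `c`, and `-g''` lies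
between `σ²` and `C²`. -/
structure Curved (a b σ C c : ℝ) (g : ℝ → ℝ) : Prop where
  mem : c ∈ Set.Ioo a b
  isMax : IsMaxOn g (Set.Icc a b) c
  cont : ContinuousOn g (Set.Icc a b)
  smooth : ContDiffOn ℝ 2 g (Set.Ioo a b)
  curv : ∀ p ∈ Set.Ioo a b, σ ^ 2 ≤ -(iteratedDeriv 2 g p) ∧ -(iteratedDeriv 2 g p) ≤ C ^ 2

namespace Curved

variable {a b σ C c : ℝ} {g : ℝ → ℝ}

lemma hasDerivAt (h : Curved a b σ C c g) {p : ℝ} (hp : p ∈ Set.Ioo a b) :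
    HasDerivAt g (deriv g p) p :=
  ((h.smooth.contDiffAt (isOpen_Ioo.mem_nhds hp)).differentiableAt (by norm_num)).hasDerivAt

lemma hasDerivAt_deriv (h : Curved a b σ C c g) {p : ℝ} (hp : p ∈ Set.Ioo a b) :
    HasDerivAt (deriv g) (iteratedDeriv 2 g p) p := by
  have h1 : ContDiffOn ℝ 1 (deriv g) (Set.Ioo a b) :=
    h.smooth.deriv_of_isOpen isOpen_Ioo (by norm_num)
  have h2 : DifferentiableAt ℝ (deriv g) p :=
    (h1.contDiffAt (isOpen_Ioo.mem_nhds hp)).differentiableAt (by norm_num)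
  rw [iteratedDeriv_succ, iteratedDeriv_one]
  exact h2.hasDerivAt

lemma deriv_eq_zero (h : Curved a b σ C c g) : deriv g c = 0 :=
  (h.isMax.isLocalMax (Icc_mem_nhds h.mem.1 h.mem.2)).deriv_eq_zero

lemma lower (h : Curved a b σ C c g) :
    MonotoneOn (fun p => g p + σ ^ 2 / 2 * (p - c) ^ 2) (Set.Icc a c) ∧
    AntitoneOn (fun p => g p + σ ^ 2 / 2 * (p - c) ^ 2) (Set.Icc c b) := by
  refine monotoneOn_antitoneOn_of_deriv2_nonpos (k' := fun p => deriv g p + σ ^ 2 * (p - c))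
    (k'' := fun p => iteratedDeriv 2 g p + σ ^ 2) h.mem (h.cont.add (by fun_prop)) ?_ ?_ ?_ ?_
  · exact fun p hp => (h.hasDerivAt hp).add (hasDerivAt_half_mul_sq (σ ^ 2) c p)
  · exact fun p hp => (h.hasDerivAt_deriv hp).add (hasDerivAt_mul_sub (σ ^ 2) c p)
  · intro p hp
    linarith [(h.curv p hp).1]
  · simp [h.deriv_eq_zero]

lemma upper (h : Curved a b σ C c g) :
    MonotoneOn (fun p => -g p - C ^ 2 / 2 * (p - c) ^ 2) (Set.Icc a c) ∧
    AntitoneOn (fun p => -g p - C ^ 2 / 2 * (p - c) ^ 2) (Set.Icc c b) := by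
  refine monotoneOn_antitoneOn_of_deriv2_nonpos (k' := fun p => -deriv g p - C ^ 2 * (p - c))
    (k'' := fun p => -iteratedDeriv 2 g p - C ^ 2) h.mem (h.cont.neg.sub (by fun_prop)) ?_ ?_ ?_ ?_
  · exact fun p hp => (h.hasDerivAt hp).neg.sub (hasDerivAt_half_mul_sq (C ^ 2) c p)
  · exact fun p hp => (h.hasDerivAt_deriv hp).neg.sub (hasDerivAt_mul_sub (C ^ 2) c p)
  · intro p hp
    linarith [(h.curv p hp).2]
  · simp [h.deriv_eq_zero]

/-- Monotonicity of `g + σ²/2 (· - c)²` gives the bound `σ²/2 ((c - p)² - (c - p')²)`, which is at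
least the claimed one for `p ≤ p' ≤ c`. So prices on one side of the maximizer are separated by the
square of their distance. -/
lemma gap_left (h : Curved a b σ C c g) {p p' : ℝ} (h1 : a ≤ p) (h2 : p ≤ p') (h3 : p' ≤ c) :
    σ ^ 2 / 2 * (p' - p) ^ 2 ≤ g p' - g p := by
  have := h.lower.1 ⟨h1, h2.trans h3⟩ ⟨h1.trans h2, h3⟩ h2
  simp only at this
  have hs : 0 ≤ σ ^ 2 := sq_nonneg σ
  nlinarith [mul_nonneg hs (mul_nonneg (sub_nonneg.2 h2) (sub_nonneg.2 h3))]

lemma gap_right (h : Curved a b σ C c g) {p p' : ℝ} (h1 : c ≤ p) (h2 : p ≤ p') (h3 : p' ≤ b) :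
    σ ^ 2 / 2 * (p' - p) ^ 2 ≤ g p - g p' := by
  have := h.lower.2 ⟨h1, h2.trans h3⟩ ⟨h1.trans h2, h3⟩ h2
  simp only at this
  have hs : 0 ≤ σ ^ 2 := sq_nonneg σ
  nlinarith [mul_nonneg hs (mul_nonneg (sub_nonneg.2 h2) (sub_nonneg.2 h1))]

lemma le_quadratic (h : Curved a b σ C c g) {p : ℝ} (hp : p ∈ Set.Icc a b) :
    g c - g p ≤ C ^ 2 / 2 * (p - c) ^ 2 := by
  rcases le_total p c with hpc | hpc
  · have := h.upper.1 ⟨hp.1, hpc⟩ ⟨h.mem.1.le, le_rfl⟩ hpc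
    simp only [sub_self] at this
    linarith
  · have := h.upper.2 ⟨le_rfl, h.mem.2.le⟩ ⟨hpc, hp.2⟩ hpc
    simp only [sub_self] at this
    linarith

/-- Two values locate the maximizer: if the lower price were beyond it, the revenue could not
increase. This justifies discarding a quarter of the interval. -/
lemma lt_max_of_lt (h : Curved a b σ C c g) {p p' : ℝ} (h2 : p < p') (h3 : p' ≤ b)
    (hg : g p < g p') : p < c := by
  by_contra! hc
  have := h.gap_right hc h2.le h3
  nlinarith [sq_nonneg σ, sq_nonneg (p' - p), mul_nonneg (sq_nonneg σ) (sq_nonneg (p' - p))]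

lemma max_lt_of_lt (h : Curved a b σ C c g) {p p' : ℝ} (h1 : a ≤ p) (h2 : p < p')
    (hg : g p' < g p) : c < p' := by
  by_contra! hc
  have := h.gap_left h1 h2.le hc
  nlinarith [mul_nonneg (sq_nonneg σ) (sq_nonneg (p' - p))]

/-- The maximizer exceeds the two end points by at most one each, and one of them is at least half
the width away. This later bounds terms in `Δ²` by multiples of `σ⁻²`. -/
lemma sq_mul_sq_width_le (h : Curved a b σ C c g) (h01 : ∀ p ∈ Set.Icc a b, g p ∈ Set.Icc (0 : ℝ) 1) :
    σ ^ 2 * (b - a) ^ 2 ≤ 8 := by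
  obtain ⟨hac, hcb⟩ := h.mem
  have hca := h01 a ⟨le_rfl, by linarith⟩
  have hcc := h01 c ⟨hac.le, hcb.le⟩
  have hcb' := h01 b ⟨by linarith, le_rfl⟩
  have h1 := h.gap_left le_rfl hac.le le_rfl
  have h2 := h.gap_right le_rfl hcb.le le_rfl
  have h3 : σ ^ 2 / 2 * (c - a) ^ 2 + σ ^ 2 / 2 * (b - c) ^ 2 ≤ 2 := by
    linarith [hca.1, hcc.2, hcb'.1]
  nlinarith [mul_nonneg (sq_nonneg σ) (sq_nonneg ((c - a) - (b - c)))]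

end Curved

/-! ### Consequences of the model assumptions -/

section Geometry

variable {d : ℕ}

lemma isClosed_unitCube (d : ℕ) : IsClosed (unitCube d) := by
  simp only [unitCube, Set.ofPred_forall, Set.ofPred_and]
  exact isClosed_iInter fun i => (isClosed_le (by fun_prop) (by fun_prop)).inter
    (isClosed_le (by fun_prop) (by fun_prop))

lemma isClosed_hypercube (a : Ctx d) (r : ℝ) : IsClosed (hypercube a r) := by
  simp only [hypercube, Set.ofPred_forall, Set.ofPred_and]
  exact isClosed_iInter fun i => (isClosed_le (by fun_prop) (by fun_prop)).inter
    (isClosed_le (by fun_prop) (by fun_prop))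

lemma norm_sub_le_of_mem_hypercube {a : Ctx d} {r : ℝ} {x y : Ctx d}
    (hx : x ∈ hypercube a r) (hy : y ∈ hypercube a r) : ‖x - y‖ ≤ Real.sqrt d * r := by
  rcases Nat.eq_zero_or_pos d with rfl | hd
  · have : x = y := Subsingleton.elim _ _
    simp [this]
  have hr : 0 ≤ r := by have := hx ⟨0, hd⟩; linarith [this.1, this.2]
  rw [EuclideanSpace.norm_eq]
  apply Real.sqrt_le_iff.2 ⟨by positivity, ?_⟩
  rw [mul_pow, Real.sq_sqrt (by positivity)]
  calc ∑ i, ‖(x - y) i‖ ^ 2 ≤ ∑ _i : Fin d, r ^ 2 := by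
        gcongr with i _
        rw [PiLp.sub_apply, Real.norm_eq_abs, abs_le]
        have h1 := hx i
        have h2 := hy i
        constructor <;> linarith [h1.1, h1.2, h2.1, h2.2]
    _ = d * r ^ 2 := by simp

lemma diam_hypercube_le (a : Ctx d) {r : ℝ} (hr : 0 ≤ r) :
    Metric.diam (hypercube a r) ≤ Real.sqrt d * r :=
  Metric.diam_le_of_forall_dist_le (by positivity) fun x hx y hy => by
    rw [dist_eq_norm]; exact norm_sub_le_of_mem_hypercube hx hy

lemma volume_coord_eq (i : Fin d) (c : ℝ) : volume {x : Ctx d | x i = c} = 0 := by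
  have h := (PiLp.volume_preserving_ofLp (Fin d)).measure_preimage
    (s := {f : Fin d → ℝ | f i = c})
    (measurableSet_eq_fun (by fun_prop) (by fun_prop)).nullMeasurableSet
  have h2 : volume {f : Fin d → ℝ | f i = c} = 0 := by
    rw [volume_pi]
    exact Measure.pi_hyperplane (fun _ : Fin d => (volume : Measure ℝ)) i c
  rw [h2] at h
  exact h

/-- The cube with center `x` and side `r`. -/
def centeredCube (x : Ctx d) (r : ℝ) : Set (Ctx d) :=
  hypercube (WithLp.toLp 2 fun i => x i - r / 2) r

lemma mem_centeredCube {x y : Ctx d} {r : ℝ} :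
    y ∈ centeredCube x r ↔ ∀ i, x i - r / 2 ≤ y i ∧ y i ≤ x i + r / 2 := by
  refine forall_congr' fun i => and_congr Iff.rfl ?_
  change y i ≤ x i - r / 2 + r ↔ _
  rw [show x i - r / 2 + r = x i + r / 2 by ring]

lemma centeredCube_mem_nhds (x : Ctx d) {r : ℝ} (hr : 0 < r) : centeredCube x r ∈ nhds x := by
  refine Filter.mem_of_superset (Metric.ball_mem_nhds x (half_pos hr)) fun y hy => ?_
  rw [mem_centeredCube]
  intro i
  have h1 := PiLp.norm_apply_le (y - x) i
  rw [PiLp.sub_apply, Real.norm_eq_abs] at h1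
  rw [Metric.mem_ball, dist_eq_norm] at hy
  have h2 := abs_le.1 (h1.trans hy.le)
  constructor <;> linarith [h2.1, h2.2]

end Geometry

/-- A continuous function that agrees with the expected revenue on the domain. -/
structure IsExtension {d : ℕ} (pLo pHi : ℝ) (lam : ℝ → Ctx d → ℝ) (F : ℝ × Ctx d → ℝ) : Prop where
  cont : Continuous F
  mem01 : ∀ z, F z ∈ Set.Icc (0 : ℝ) 1
  eq : ∀ p ∈ Set.Icc pLo pHi, ∀ x ∈ unitCube d, F (p, x) = revenue lam p x

namespace Model

variable {d : ℕ} {pLo pHi CX CL σH CH Cp : ℝ} {PX : Measure (Ctx d)} {lam : ℝ → Ctx d → ℝ}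
  {pstar : Ctx d → ℝ}

lemma revenue_mem (hM : Model pLo pHi CX CL σH CH Cp PX lam pstar) {p : ℝ}
    (hp : p ∈ Set.Icc pLo pHi) {x : Ctx d} (hx : x ∈ unitCube d) :
    revenue lam p x ∈ Set.Icc (0 : ℝ) 1 := by
  obtain ⟨h0, -, h1⟩ := hM.price_range
  obtain ⟨h2, h3⟩ := hM.demand_range p hp x hx
  exact ⟨mul_nonneg (h0.trans hp.1) h2, mul_le_one₀ (hp.2.trans h1) h2 h3⟩

lemma CL_nonneg (hM : Model pLo pHi CX CL σH CH Cp PX lam pstar) : 0 ≤ CL := by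
  obtain ⟨h0, h, h1⟩ := hM.price_range
  have hx : (0 : Ctx d) ∈ unitCube d := fun i => by simp
  have := hM.lipschitz pHi ⟨h.le, le_rfl⟩ pLo ⟨le_rfl, h.le⟩ 0 hx 0 hx
  rw [sub_self, norm_zero, add_zero, abs_of_pos (sub_pos.2 h)] at this
  have h2 := (abs_nonneg _).trans this
  exact nonneg_of_mul_nonneg_left h2 (sub_pos.2 h)

/-- Nothing is known about `lam` off the domain. A Lipschitz extension, clamped to `[0,1]`, supplies
a jointly measurable integrand with values in `[0,1]` everywhere. -/
lemma exists_isExtension (hM : Model pLo pHi CX CL σH CH Cp PX lam pstar) :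
    ∃ F, IsExtension pLo pHi lam F := by
  have hCL := hM.CL_nonneg
  have hlip : LipschitzOnWith (Real.toNNReal (2 * CL)) (fun z : ℝ × Ctx d => revenue lam z.1 z.2)
      (Set.Icc pLo pHi ×ˢ unitCube d) := by
    refine LipschitzOnWith.of_dist_le_mul fun z hz z' hz' => ?_
    rw [Real.dist_eq, Real.coe_toNNReal _ (by positivity)]
    refine (hM.lipschitz _ hz.1 _ hz'.1 _ hz.2 _ hz'.2).trans ?_
    have h1 : |z.1 - z'.1| ≤ dist z z' := le_max_left _ _
    have h2 : ‖z.2 - z'.2‖ ≤ dist z z' := by rw [← dist_eq_norm]; exact le_max_right _ _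
    nlinarith
  obtain ⟨F, hF, hEq⟩ := hlip.extend_real
  refine ⟨fun z => max 0 (min 1 (F z)), ?_, ?_, ?_⟩
  · exact continuous_const.max (continuous_const.min hF.continuous)
  · exact fun z => ⟨le_max_left _ _, max_le zero_le_one (min_le_left _ _)⟩
  · intro p hp x hx
    have h1 : revenue lam p x = F (p, x) := hEq (Set.mk_mem_prod hp hx)
    have h2 := hM.revenue_mem hp hx
    change max 0 (min 1 (F (p, x))) = _
    rw [← h1, min_eq_right h2.2, max_eq_right h2.1]

lemma absolutelyContinuous (hM : Model pLo pHi CX CL σH CH Cp PX lam pstar) :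
    PX ≪ volume.restrict (unitCube d) := by
  obtain ⟨χ, -, -, h⟩ := hM.density
  rw [h]
  exact withDensity_absolutelyContinuous _ _

lemma ae_mem_unitCube (hM : Model pLo pHi CX CL σH CH Cp PX lam pstar) :
    ∀ᵐ x ∂PX, x ∈ unitCube d :=
  hM.absolutelyContinuous.ae_le (ae_restrict_mem (isClosed_unitCube d).measurableSet)

lemma ae_coord_ne (hM : Model pLo pHi CX CL σH CH Cp PX lam pstar) (i : Fin d) (c : ℝ) :
    ∀ᵐ x ∂PX, x i ≠ c := by
  have h : ∀ᵐ x : Ctx d, x i ≠ c := by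
    rw [ae_iff]; simpa using volume_coord_eq i c
  exact (hM.absolutelyContinuous.trans Measure.absolutelyContinuous_restrict).ae_le h

/-- The density bound is at least one. -/
lemma one_le_CX (hM : Model pLo pHi CX CL σH CH Cp PX lam pstar) : 1 ≤ CX := by
  obtain ⟨χ, -, hχ, h⟩ := hM.density
  have hP := hM.prob
  have hv : volume (unitCube d) ≤ 1 := by
    have h1 := (PiLp.volume_preserving_ofLp (Fin d)).measure_preimage
      (s := Set.pi Set.univ fun _ => Set.Icc (0 : ℝ) 1)
      (MeasurableSet.univ_pi fun _ => measurableSet_Icc).nullMeasurableSet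
    rw [volume_pi_pi] at h1
    simp only [Real.volume_Icc, sub_zero, ENNReal.ofReal_one, Finset.prod_const_one] at h1
    rw [← h1]
    exact measure_mono fun x hx i _ => hx i
  have h1 : (1 : ENNReal) ≤ ENNReal.ofReal CX := by
    calc (1 : ENNReal) = PX Set.univ := measure_univ.symm
      _ = ∫⁻ x in unitCube d, ENNReal.ofReal (χ x) := by
          rw [h, withDensity_apply _ MeasurableSet.univ, Measure.restrict_univ]
      _ ≤ ∫⁻ _ in unitCube d, ENNReal.ofReal CX :=
          setLIntegral_mono measurable_const fun x hx => ENNReal.ofReal_le_ofReal (hχ x hx).2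
      _ = ENNReal.ofReal CX * volume (unitCube d) := by simp
      _ ≤ ENNReal.ofReal CX * 1 := by gcongr
      _ = _ := mul_one _
  simpa using h1

variable {F : ℝ × Ctx d → ℝ}

lemma integrable_extension (hF : IsExtension pLo pHi lam F) (μ : Measure (Ctx d))
    [IsFiniteMeasure μ] (p : ℝ) : Integrable (fun x => F (p, x)) μ :=
  Integrable.of_bound (C := 1) (by have := hF.cont; fun_prop)
    (Filter.Eventually.of_forall fun x => by
      have := hF.mem01 (p, x)
      rw [Real.norm_eq_abs, abs_of_nonneg this.1]; exact this.2)

lemma revenueOn_eq (hF : IsExtension pLo pHi lam F) {B : Set (Ctx d)} (hB : MeasurableSet B)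
    (hBc : B ⊆ unitCube d) {p : ℝ} (hp : p ∈ Set.Icc pLo pHi) :
    revenueOn PX lam B p = ∫ x, F (p, x) ∂(cond PX B) := by
  refine integral_congr_ae ?_
  filter_upwards [ae_cond_mem hB] with x hx
  exact (hF.eq p hp x (hBc hx)).symm

lemma revenueOn_sub_le (hM : Model pLo pHi CX CL σH CH Cp PX lam pstar) {B : Set (Ctx d)}
    (hB : MeasurableSet B) (hBc : B ⊆ unitCube d) (hPB : PX B ≠ 0) {p p' : ℝ}
    (hp : p ∈ Set.Icc pLo pHi) (hp' : p' ∈ Set.Icc pLo pHi) :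
    |revenueOn PX lam B p - revenueOn PX lam B p'| ≤ CL * |p - p'| := by
  obtain ⟨F, hF⟩ := hM.exists_isExtension
  have := hM.prob
  have hc : IsProbabilityMeasure (cond PX B) := cond_isProbabilityMeasure hPB
  rw [revenueOn_eq hF hB hBc hp, revenueOn_eq hF hB hBc hp',
    ← integral_sub (integrable_extension hF _ p) (integrable_extension hF _ p')]
  have := norm_integral_le_of_norm_le_const (μ := cond PX B) (C := CL * |p - p'|)
    (f := fun x => F (p, x) - F (p', x)) (by
      filter_upwards [ae_cond_mem hB] with x hx
      rw [hF.eq p hp x (hBc hx), hF.eq p' hp' x (hBc hx)]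
      simpa using hM.lipschitz p hp p' hp' x (hBc hx) x (hBc hx))
  simpa using this

lemma abs_revenueOn_sub_revenue_le (hM : Model pLo pHi CX CL σH CH Cp PX lam pstar)
    {a : Ctx d} {r : ℝ} (hBc : hypercube a r ⊆ unitCube d)
    (hPB : PX (hypercube a r) ≠ 0) {p : ℝ} (hp : p ∈ Set.Icc pLo pHi) {x : Ctx d}
    (hx : x ∈ hypercube a r) :
    |revenueOn PX lam (hypercube a r) p - revenue lam p x| ≤ CL * (Real.sqrt d * r) := by
  obtain ⟨F, hF⟩ := hM.exists_isExtension
  have := hM.prob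
  have hB := (isClosed_hypercube a r).measurableSet
  have hc : IsProbabilityMeasure (cond PX (hypercube a r)) := cond_isProbabilityMeasure hPB
  have e : revenue lam p x = ∫ _, revenue lam p x ∂(cond PX (hypercube a r)) := by simp
  rw [revenueOn_eq hF hB hBc hp, e,
    ← integral_sub (integrable_extension hF _ p) (integrable_const _)]
  have := norm_integral_le_of_norm_le_const (μ := cond PX (hypercube a r))
    (C := CL * (Real.sqrt d * r)) (f := fun y => F (p, y) - revenue lam p x) (by
      filter_upwards [ae_cond_mem hB] with y hy
      rw [hF.eq p hp y (hBc hy)]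
      refine (hM.lipschitz p hp p hp y (hBc hy) x (hBc hx)).trans ?_
      rw [sub_self, abs_zero, zero_add]
      exact mul_le_mul_of_nonneg_left (norm_sub_le_of_mem_hypercube hy hx) hM.CL_nonneg)
  simpa using this

lemma revenueOn_mem (hM : Model pLo pHi CX CL σH CH Cp PX lam pstar) {B : Set (Ctx d)}
    (hB : MeasurableSet B) (hBc : B ⊆ unitCube d) (hPB : PX B ≠ 0) {p : ℝ}
    (hp : p ∈ Set.Icc pLo pHi) : revenueOn PX lam B p ∈ Set.Icc (0 : ℝ) 1 := by
  obtain ⟨F, hF⟩ := hM.exists_isExtension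
  have := hM.prob
  have hc : IsProbabilityMeasure (cond PX B) := cond_isProbabilityMeasure hPB
  rw [revenueOn_eq hF hB hBc hp]
  refine ⟨integral_nonneg fun x => (hF.mem01 _).1, ?_⟩
  have := integral_mono (integrable_extension hF (cond PX B) p) (integrable_const 1)
    fun x => (hF.mem01 (p, x)).2
  simpa using this

/-- On a hypercube that has customers, the averaged revenue is strongly concave and smooth, and
its maximizer is close to the pointwise maximizers. -/
lemma exists_curved (hM : Model pLo pHi CX CL σH CH Cp PX lam pstar) {a : Ctx d} {r : ℝ}
    (hr : 0 < r) (hBc : hypercube a r ⊆ unitCube d) (hPB : PX (hypercube a r) ≠ 0) :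
    ∃ pB, Curved pLo pHi σH CH pB (revenueOn PX lam (hypercube a r)) ∧
      ∀ x ∈ hypercube a r, |pstar x - pB| ≤ |Cp| * (Real.sqrt d * r) := by
  obtain ⟨h1, h2, ⟨pB, hpB, hmax, hinf, hsup⟩, hdiff⟩ := hM.cubes a r hr hBc hPB
  refine ⟨pB, ⟨hpB, hmax, ?_, h1, h2⟩, ?_⟩
  · have : LipschitzOnWith (Real.toNNReal CL) (revenueOn PX lam (hypercube a r))
        (Set.Icc pLo pHi) := by
      refine LipschitzOnWith.of_dist_le_mul fun p hp p' hp' => ?_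
      rw [Real.dist_eq, Real.dist_eq, Real.coe_toNNReal _ hM.CL_nonneg]
      exact hM.revenueOn_sub_le (isClosed_hypercube a r).measurableSet hBc hPB hp hp'
    exact this.continuousOn
  · intro x hx
    have hbdd : pstar '' hypercube a r ⊆ Set.Icc pLo pHi := by
      rintro _ ⟨y, hy, rfl⟩
      exact hM.pstar_mem y (hBc hy)
    have h3 := csInf_le (bddBelow_Icc.mono hbdd) (Set.mem_image_of_mem pstar hx)
    have h4 := le_csSup (bddAbove_Icc.mono hbdd) (Set.mem_image_of_mem pstar hx)
    have h5 : Cp * Metric.diam (hypercube a r) ≤ |Cp| * (Real.sqrt d * r) :=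
      mul_le_mul (le_abs_self _) (diam_hypercube_le a hr.le) Metric.diam_nonneg (abs_nonneg _)
    rw [abs_le]
    constructor <;> linarith

/-- At almost every context, the loss is at most quadratic in the distance to the optimal price. -/
lemma ae_revenue_sub_le (hM : Model pLo pHi CX CL σH CH Cp PX lam pstar) :
    ∀ᵐ x ∂PX, ∀ p ∈ Set.Icc pLo pHi,
      revenue lam (pstar x) x - revenue lam p x ≤ CH ^ 2 / 2 * (pstar x - p) ^ 2 := by
  -- Almost every context is interior, so small centered cubes stay in the domain, and lies in the
  -- support of `PX`, so that all these cubes have customers.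
  have hint : ∀ᵐ x ∂PX, ∀ i, x i ≠ 0 ∧ x i ≠ 1 :=
    ae_all_iff.2 fun i => (hM.ae_coord_ne i 0).and (hM.ae_coord_ne i 1)
  filter_upwards [hM.ae_mem_unitCube, hint, Measure.support_mem_ae (μ := PX)] with x hx hx01 hsupp
  intro p hp
  have hps := hM.pstar_mem x hx
  -- On the cube of side `η` around `x`, the quadratic bound for the average passes to `f(·, x)`
  -- with errors that vanish with `η`: the oscillation of `f` on the cube and the distance from
  -- `p*(x)` to the maximizer of the average.
  have hlim : Filter.Tendsto (fun η : ℝ => CL * (|Cp| * (Real.sqrt d * η)) +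
      2 * (CL * (Real.sqrt d * η)) + CH ^ 2 / 2 * (|pstar x - p| + |Cp| * (Real.sqrt d * η)) ^ 2)
      (nhdsWithin 0 (Set.Ioi 0)) (nhds (CH ^ 2 / 2 * (pstar x - p) ^ 2)) := by
    refine tendsto_nhdsWithin_of_tendsto_nhds ?_
    refine (Continuous.tendsto (by fun_prop) 0).trans (le_of_eq ?_)
    simp
  refine ge_of_tendsto hlim ?_
  have hsmall : ∀ᶠ η : ℝ in nhdsWithin 0 (Set.Ioi 0), ∀ i, η / 2 ≤ x i ∧ x i + η / 2 ≤ 1 := by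
    rw [Filter.eventually_all]
    intro i
    have h0 : 0 < x i := lt_of_le_of_ne (hx i).1 (hx01 i).1.symm
    have h1 : 0 < 1 - x i := sub_pos.2 (lt_of_le_of_ne (hx i).2 (hx01 i).2)
    filter_upwards [nhdsWithin_le_nhds (Iio_mem_nhds h0), nhdsWithin_le_nhds (Iio_mem_nhds h1),
      self_mem_nhdsWithin] with η h2 h3 h4
    have h2' : η < x i := h2
    have h3' : η < 1 - x i := h3
    have h4' : 0 < η := h4
    constructor <;> linarith
  filter_upwards [hsmall, self_mem_nhdsWithin] with η h1 h2
  have hη : 0 < η := h2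
  have hxB : x ∈ centeredCube x η := mem_of_mem_nhds (centeredCube_mem_nhds x hη)
  have hBc : centeredCube x η ⊆ unitCube d := by
    intro y hy i
    have := mem_centeredCube.1 hy i
    have := h1 i
    constructor <;> linarith
  have hPB : PX (centeredCube x η) ≠ 0 :=
    ((Measure.mem_support_iff_forall x).1 hsupp _ (centeredCube_mem_nhds x hη)).ne'
  obtain ⟨pB, hC, hdist⟩ := hM.exists_curved hη hBc hPB
  have hpB : pB ∈ Set.Icc pLo pHi := Set.Ioo_subset_Icc_self hC.mem
  have hd := hdist x hxB
  set δ := |Cp| * (Real.sqrt d * η)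
  have e1 := hM.lipschitz _ hps _ hpB x hx x hx
  rw [sub_self, norm_zero, add_zero] at e1
  have e1' : CL * |pstar x - pB| ≤ CL * δ := mul_le_mul_of_nonneg_left hd hM.CL_nonneg
  have e2 := abs_le.1 (hM.abs_revenueOn_sub_revenue_le hBc hPB hpB hxB)
  have e3 := hC.le_quadratic hp
  have e4 := abs_le.1 (hM.abs_revenueOn_sub_revenue_le hBc hPB hp hxB)
  have e5 : (p - pB) ^ 2 ≤ (|pstar x - p| + δ) ^ 2 := by
    rw [← sq_abs (p - pB)]
    gcongr
    calc |p - pB| = |(pstar x - pB) - (pstar x - p)| := by ring_nf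
      _ ≤ |pstar x - pB| + |pstar x - p| := abs_sub _ _
      _ ≤ _ := by linarith
  have e6 : CH ^ 2 / 2 * (p - pB) ^ 2 ≤ CH ^ 2 / 2 * (|pstar x - p| + δ) ^ 2 := by gcongr
  have e7 := (abs_le.1 e1).2
  linarith [e2.1, e4.2]

end Model

/-! ### The cells of the partition -/

section Cells

variable {d m : ℕ}

/-- The closed hypercube of a cell. -/
def cellCube (j : Cell d m) : Set (Ctx d) :=
  hypercube (WithLp.toLp 2 fun i => ((j i : ℕ) : ℝ) / m) (1 / m)

lemma measurableSet_cellCube (j : Cell d m) : MeasurableSet (cellCube j) :=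
  (isClosed_hypercube _ _).measurableSet

variable [NeZero m]

lemma cellCube_subset (j : Cell d m) : cellCube j ⊆ unitCube d := by
  intro x hx i
  have h := hx i
  change ((j i : ℕ) : ℝ) / m ≤ x i ∧ x i ≤ ((j i : ℕ) : ℝ) / m + 1 / m at h
  have hm : (0 : ℝ) < m := by exact_mod_cast Nat.pos_of_ne_zero (NeZero.ne m)
  have hj : ((j i : ℕ) : ℝ) + 1 ≤ m := by exact_mod_cast (j i).2
  refine ⟨le_trans (by positivity) h.1, h.2.trans ?_⟩
  rw [← add_div, div_le_one hm]
  exact hj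

lemma measurable_cellOf : Measurable (cellOf : Ctx d → Cell d m) := by
  refine measurable_pi_iff.2 fun i => ?_
  have h1 : Measurable fun x : Ctx d => ⌊(m : ℝ) * x i⌋₊ := Nat.measurable_floor.comp (by fun_prop)
  have h2 : Measurable fun n : ℕ => (⟨min n (m - 1), lt_of_le_of_lt (min_le_right _ _)
    (Nat.sub_lt (Nat.pos_of_ne_zero (NeZero.ne m)) one_pos)⟩ : Fin m) := measurable_from_nat
  exact h2.comp h1

lemma measurableSet_cell (j : Cell d m) : MeasurableSet {x : Ctx d | cellOf x = j} :=
  measurable_cellOf (measurableSet_singleton j)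

/-- The half-open cells used by the algorithm and the closed cubes of the assumptions differ only on
grid hyperplanes, which are null sets. -/
lemma Model.ae_mem_cellCube_iff {pLo pHi CX CL σH CH Cp : ℝ} {PX : Measure (Ctx d)}
    {lam : ℝ → Ctx d → ℝ} {pstar : Ctx d → ℝ}
    (hM : Model pLo pHi CX CL σH CH Cp PX lam pstar) :
    ∀ᵐ x ∂PX, ∀ j : Cell d m, cellOf x = j ↔ x ∈ cellCube j := by
  have hne : ∀ᵐ x ∂PX, ∀ i, ∀ k : ℕ, x i ≠ (k : ℝ) / m :=
    ae_all_iff.2 fun i => ae_all_iff.2 fun k => hM.ae_coord_ne i _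
  filter_upwards [hM.ae_mem_unitCube, hne] with x hx hne j
  have hm0 : 0 < m := Nat.pos_of_ne_zero (NeZero.ne m)
  have hm : (0 : ℝ) < m := by exact_mod_cast hm0
  rw [funext_iff]
  refine forall_congr' fun i => ?_
  change _ ↔ ((j i : ℕ) : ℝ) / m ≤ x i ∧ x i ≤ ((j i : ℕ) : ℝ) / m + 1 / m
  have h0 := (hx i).1
  have hx1 : (m : ℝ) * x i < m := by
    have h1 : x i ≠ 1 := by
      have := hne i m
      rwa [div_self hm.ne'] at this
    have := lt_of_le_of_ne (hx i).2 h1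
    nlinarith
  have hfl : ⌊(m : ℝ) * x i⌋₊ < m := (Nat.floor_lt (by positivity)).2 hx1
  have hcell : cellOf (m := m) x i = j i ↔ ⌊(m : ℝ) * x i⌋₊ = (j i : ℕ) := by
    rw [Fin.ext_iff]
    change min _ _ = _ ↔ _
    rw [min_eq_left (by omega)]
  rw [hcell, Nat.floor_eq_iff (by positivity), ← add_div, div_le_iff₀ hm, le_div_iff₀ hm,
    mul_comm (m : ℝ)]
  refine and_congr_right fun _ => ⟨fun h => h.le, fun h => lt_of_le_of_ne h fun he => ?_⟩
  have := hne i (j i + 1)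
  push_cast at this
  exact this (by rw [← he]; field_simp)

end Cells

/-! ### The search within one cell, on a path with accurate statistics -/

/-- The numerator error splits as `(rh - S) + (S - n φ) + φ (n - mh)`: noise, sampling, noise. Since
`mh ≥ 3 e`, the true count satisfies `n ≤ 4/3 mh`; the weaker factor `(4/3)²` comes out of the
square root as `4/3`. -/
lemma abs_div_sub_le {n S mh rh φ e c μ : ℝ} (he : 0 < e) (hc : 0 ≤ c) (hm : |mh - n| ≤ e)
    (hr : |rh - S| ≤ e) (hS : |S - n * φ| ≤ c * Real.sqrt n) (h0 : 0 ≤ φ) (h1 : φ ≤ 1)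
    (hμ : μ ≤ mh) (h3 : 3 * e ≤ μ) :
    |rh / mh - φ| ≤ 4 / 3 * (c / Real.sqrt μ) + 2 * (e / μ) := by
  have hμ0 : 0 < μ := by linarith
  have hmh : 0 < mh := by linarith
  have hn : n ≤ (4 / 3) ^ 2 * mh := by linarith [(abs_le.1 hm).1]
  have hsq : Real.sqrt n ≤ 4 / 3 * Real.sqrt mh := by
    refine (Real.sqrt_le_sqrt hn).trans (le_of_eq ?_)
    rw [Real.sqrt_mul (by positivity), Real.sqrt_sq (by norm_num)]
  have hnum : |rh - φ * mh| ≤ 4 / 3 * c * Real.sqrt mh + 2 * e := by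
    have e1 : |φ * (n - mh)| ≤ e := by
      rw [abs_mul, abs_of_nonneg h0, abs_sub_comm]
      nlinarith [abs_nonneg (mh - n)]
    have e2 : rh - φ * mh = (rh - S) + (S - n * φ) + φ * (n - mh) := by ring
    rw [e2]
    refine (abs_add_three _ _ _).trans ?_
    nlinarith
  have hsm : 0 < Real.sqrt mh := Real.sqrt_pos.2 hmh
  have h4 : rh / mh - φ = (rh - φ * mh) / mh := by field_simp
  rw [h4, abs_div, abs_of_pos hmh, div_le_iff₀ hmh]
  refine hnum.trans ?_
  have e3 : c / Real.sqrt mh ≤ c / Real.sqrt μ :=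
    div_le_div_of_nonneg_left hc (Real.sqrt_pos.2 hμ0) (Real.sqrt_le_sqrt hμ)
  have e4 : e / mh ≤ e / μ := div_le_div_of_nonneg_left he.le hμ0 hμ
  have e5 : c * Real.sqrt mh = c / Real.sqrt mh * mh := by
    rw [div_mul_eq_mul_div, eq_div_iff hsm.ne', mul_assoc, Real.mul_self_sqrt hmh.le]
  have e6 : e = e / mh * mh := by field_simp
  have e7 := mul_le_mul_of_nonneg_right e3 hmh.le
  have e8 := mul_le_mul_of_nonneg_right e4 hmh.le
  nlinarith

section Decision

variable {A : Params} {rh mh φ : Fin 5 → ℝ} {e : ℝ} {k₀ k₁ k₂ : Fin 5}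

/-- The estimates `r̂ / μ̂` are accurate for all three prices of a triple. -/
def Accurate (A : Params) (rh mh φ : Fin 5 → ℝ) (e : ℝ) : Prop :=
  ∀ k, ∀ μ, μ ≤ mh k → 3 * e ≤ μ →
    |rh k / mh k - φ k| ≤ 4 / 3 * (A.c1 / Real.sqrt μ) + 2 * (e / μ)

/-- The threshold `3 c₁/√μ + 36 e/μ` exceeds twice the accuracy, `8/3 c₁/√μ + 4 e/μ`, so a decisive
comparison has the right sign. -/
lemma lt_of_increasing (he : 0 < e) (hc1 : 0 ≤ A.c1) (hc2 : A.c2 = 3 * e) (hc1' : A.c1' = 12 * e)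
    (hacc : Accurate A rh mh φ e) (h : Increasing A rh mh k₀ k₁ k₂) : φ k₁ < φ k₀ := by
  unfold Increasing at h
  set μ := min (mh k₀) (min (mh k₁) (mh k₂)) with hμ
  obtain ⟨h1, h2⟩ := h
  rw [hc2] at h1
  have a0 := abs_le.1 (hacc k₀ μ (min_le_left _ _) h1)
  have a1 := abs_le.1 (hacc k₁ μ ((min_le_right _ _).trans (min_le_left _ _)) h1)
  have h3 := h2.trans_le (min_le_left _ _)
  rw [hc1'] at h3
  have e1 : 0 ≤ A.c1 / Real.sqrt μ := div_nonneg hc1 (Real.sqrt_nonneg _)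
  have e2 : 0 < e / μ := div_pos he (by linarith)
  have e3 : 3 * A.c1 / Real.sqrt μ + 3 * (12 * e) / μ =
      3 * (A.c1 / Real.sqrt μ) + 36 * (e / μ) := by ring
  linarith [a0.1, a0.2, a1.1, a1.2]

/-- If all three counts were larger, then `c₁/√μ < G/12` and `e/μ < G/84`. Threshold plus twice the
accuracy would be below `(17/36 + 10/21) G < G`, making the triple decisive. -/
lemma exists_le_of_not_increasing (he : 0 < e) (hc1 : 0 < A.c1) (hc2 : A.c2 = 3 * e)
    (hc1' : A.c1' = 12 * e) (hacc : Accurate A rh mh φ e) (h : ¬ Increasing A rh mh k₀ k₁ k₂)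
    {G : ℝ} (hG : 0 < G) (h01 : G ≤ φ k₀ - φ k₁) (h12 : G ≤ φ k₁ - φ k₂) :
    ∃ k, mh k ≤ 3 * e + 144 * A.c1 ^ 2 / G ^ 2 + 84 * e / G := by
  by_contra! hcon
  apply h
  unfold Increasing
  set μ := min (mh k₀) (min (mh k₁) (mh k₂)) with hμ
  set M := 3 * e + 144 * A.c1 ^ 2 / G ^ 2 + 84 * e / G with hM
  have hMμ : M < μ := lt_min (hcon _) (lt_min (hcon _) (hcon _))
  have p1 : 0 < 144 * A.c1 ^ 2 / G ^ 2 := by positivity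
  have p2 : 0 < 84 * e / G := by positivity
  have h1 : 3 * e ≤ μ := by linarith
  have hμ0 : 0 < μ := by linarith
  have a0 := abs_le.1 (hacc k₀ μ (min_le_left _ _) h1)
  have a1 := abs_le.1 (hacc k₁ μ ((min_le_right _ _).trans (min_le_left _ _)) h1)
  have a2 := abs_le.1 (hacc k₂ μ ((min_le_right _ _).trans (min_le_right _ _)) h1)
  have b1 : A.c1 / Real.sqrt μ < G / 12 := by
    rw [div_lt_iff₀ (Real.sqrt_pos.2 hμ0)]
    have : 12 * A.c1 / G < Real.sqrt μ := by
      apply Real.lt_sqrt_of_sq_lt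
      calc (12 * A.c1 / G) ^ 2 = 144 * A.c1 ^ 2 / G ^ 2 := by ring
        _ < μ := by linarith
    rw [div_lt_iff₀ hG] at this
    linarith
  have b2 : e / μ < G / 84 := by
    rw [div_lt_iff₀ hμ0]
    have : 84 * e / G < μ := by linarith
    rw [div_lt_iff₀ hG] at this
    linarith
  have e3 : 3 * A.c1 / Real.sqrt μ + 3 * A.c1' / μ =
      3 * (A.c1 / Real.sqrt μ) + 36 * (e / μ) := by rw [hc1']; ring
  refine ⟨by rw [hc2]; exact h1, ?_⟩
  change 3 * A.c1 / Real.sqrt μ + 3 * A.c1' / μ < _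
  rw [e3]
  apply lt_min
  · linarith [a0.1, a0.2, a1.1, a1.2]
  · linarith [a2.1, a2.2, a1.1, a1.2]

end Decision

/-- A sum over periods that is organized in phases: a phase `i` with start `st` has weighted length
at most `F i`. -/
lemma sum_phases_le {q : ℝ} {T N : ℕ} {st ph : ℕ → ℕ} {F h : ℕ → ℝ} (hq1 : q ≤ 1)
    (hph0 : ph 0 = 0) (hst0 : st 0 = 0)
    (hstep : ∀ t < T, (ph (t + 1) = ph t ∧ st (t + 1) = st t) ∨
      (ph (t + 1) = ph t + 1 ∧ st (t + 1) = t + 1))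
    (hF : ∀ t ≤ T, q * ((t : ℝ) - st t) ≤ F (ph t)) (hF0 : ∀ i, 0 ≤ F i)
    (hh : ∀ i, 0 ≤ h i) (hN : ∀ i, N ≤ i → h i = 0) :
    ∑ t ∈ Finset.range T, q * h (ph t) ≤ ∑ i ∈ Finset.range N, (F i + 1) * h i := by
  -- Completed phases are charged `F i + 1`, the current one its length so far. `F` controls a phase
  -- up to the last period before its update; the updating period adds `q ≤ 1`.
  have hind : ∀ t ≤ T, ∑ τ ∈ Finset.range t, q * h (ph τ) ≤
      ∑ i ∈ Finset.range (ph t), (F i + 1) * h i + q * ((t : ℝ) - st t) * h (ph t) := by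
    intro t
    induction t with
    | zero => intro _; simp [hph0, hst0]
    | succ t ih =>
      intro ht
      have h1 := ih (by omega)
      rw [Finset.sum_range_succ]
      have hF1 := hF t (by omega)
      rcases hstep t (by omega) with ⟨e1, e2⟩ | ⟨e1, e2⟩
      · rw [e1, e2]
        push_cast
        linarith
      · rw [e1, e2, Finset.sum_range_succ]
        push_cast
        have := mul_le_mul_of_nonneg_right hF1 (hh (ph t))
        have := mul_le_mul_of_nonneg_right hq1 (hh (ph t))
        linarith
  refine (hind T le_rfl).trans ?_
  have h1 : q * ((T : ℝ) - st T) * h (ph T) ≤ (F (ph T) + 1) * h (ph T) :=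
    mul_le_mul_of_nonneg_right ((hF T le_rfl).trans (by linarith)) (hh _)
  have h2 : ∑ i ∈ Finset.range (ph T), (F i + 1) * h i + (F (ph T) + 1) * h (ph T) ≤
      ∑ i ∈ Finset.range N, (F i + 1) * h i := by
    rw [← Finset.sum_range_succ]
    have hz : ∀ i, 0 ≤ (F i + 1) * h i := fun i => mul_nonneg (by linarith [hF0 i]) (hh i)
    calc _ ≤ ∑ i ∈ Finset.range (max N (ph T + 1)), (F i + 1) * h i :=
          Finset.sum_le_sum_of_subset_of_nonneg (Finset.range_mono (le_max_right _ _))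
            fun i _ _ => hz i
      _ = _ := by
          symm
          refine Finset.sum_subset (Finset.range_mono (le_max_left _ _)) fun i _ hi => ?_
          rw [hN i (by simpa using hi), mul_zero]
  linarith

lemma card_priceIdx_ge (k : Fin 5) (ς t : ℕ) :
    ((t : ℝ) - ς) / 5 - 1 ≤ ((Finset.Ioc ς t).filter fun τ => priceIdx τ = k).card := by
  have hk : ∀ τ : ℕ, priceIdx τ = k ↔ τ ≡ (k : ℕ) + 1 [MOD 5] := by
    intro τ
    rw [priceIdx, Fin.ext_iff, Nat.ModEq]
    have := k.2
    constructor <;> intro h <;> simp only at * <;> omega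
  simp_rw [hk]
  have h1 := Nat.Ioc_filter_modEq_card ς t (r := 5) (by norm_num) ((k : ℕ) + 1)
  have h2 := Int.sub_one_lt_floor (((t : ℚ) - ((k : ℕ) + 1 : ℕ)) / (5 : ℕ))
  have h3 := Int.floor_le (((ς : ℚ) - ((k : ℕ) + 1 : ℕ)) / (5 : ℕ))
  have h5 := le_max_left (⌊((t : ℚ) - ((k : ℕ) + 1 : ℕ)) / (5 : ℕ)⌋ -
    ⌊((ς : ℚ) - ((k : ℕ) + 1 : ℕ)) / (5 : ℕ)⌋) 0
  rw [← h1] at h5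
  have h6 : (((⌊((t : ℚ) - ((k : ℕ) + 1 : ℕ)) / (5 : ℕ)⌋ -
    ⌊((ς : ℚ) - ((k : ℕ) + 1 : ℕ)) / (5 : ℕ)⌋ : ℤ)) : ℚ) ≤ _ := Int.cast_le.2 h5
  push_cast at h2 h3 h6
  have h7 : ((t : ℚ) - ς) / 5 - 1 ≤
      ((Finset.Ioc ς t).filter fun τ => τ ≡ (k : ℕ) + 1 [MOD 5]).card := by
    linarith
  have h8 := (Rat.cast_le (K := ℝ)).2 h7
  push_cast at h8
  exact h8

section Path

variable {d m : ℕ} [NeZero m]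

/-- The number of phases of cell `j` that ended by period `t`. -/
def phase (A : Params) (s : ℕ → Obs d) (W : Noise d m A.T) (j : Cell d m) : ℕ → ℕ
  | 0 => 0
  | t + 1 => if (cellState A s W j (t + 1)).start = t + 1 then phase A s W j t + 1
    else phase A s W j t

/-- Increase of the exact statistics. -/
def exactDiff (s : ℕ → Obs d) (q : StatKind) (j : Cell d m) (k : Fin 5) (ς t : ℕ) : ℝ :=
  ∑ τ ∈ Finset.Ioc ς t, increment s q j k τ

lemma prefixSum_sub (u : ℕ → ℝ) {ς t : ℕ} (h : ς ≤ t) :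
    prefixSum u t - prefixSum u ς = ∑ τ ∈ Finset.Ioc ς t, u τ := by
  induction t, h using Nat.le_induction with
  | base => simp
  | succ t h ih =>
    rw [prefixSum_succ, ← Finset.insert_Ioc_right_eq_Ioc_add_one h, Finset.sum_insert (by simp), ← ih]
    ring

/-- The centered revenue of period `τ`, given the price that cell `j` offers for index `k`. -/
def centered (A : Params) (s : ℕ → Obs d) (W : Noise d m A.T) (j : Cell d m) (g : ℝ → ℝ)
    (k : Fin 5) (τ : ℕ) : ℝ :=
  increment s .revenue j k τ - increment s .count j k τ * g ((cellState A s W j (τ - 1)).rho k)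

/-- A path on which noise, revenues and arrivals of cell `j` are close to their expectations. -/
structure GoodPath (A : Params) (s : ℕ → Obs d) (W : Noise d m A.T) (j : Cell d m) (g : ℝ → ℝ)
    (q Λ e : ℝ) : Prop where
  noise : ∀ i k, ∀ t ≤ A.T, |stat A.T s W i j k t - prefixSum (increment s i j k) t| ≤ e / 2
  revenue : ∀ k, ∀ t ≤ A.T, ∀ ς ≤ t, |∑ τ ∈ Finset.Ioc ς t, centered A s W j g k τ| ≤
    A.c1 * Real.sqrt (exactDiff s .count j k ς t)
  arrivals : ∀ k, ∀ t ≤ A.T, ∀ ς ≤ t,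
    q / 2 * ((Finset.Ioc ς t).filter fun τ => priceIdx τ = k).card - Λ ≤
      exactDiff s .count j k ς t

/-- Bound on the weighted length of a phase whose price interval has width `Δ`. -/
def phaseBound (A : Params) (σ e Λ Δ : ℝ) : ℝ :=
  10 * (4 * e + 144 * A.c1 ^ 2 / (σ ^ 2 * Δ ^ 2 / 32) ^ 2 + 84 * e / (σ ^ 2 * Δ ^ 2 / 32) + Λ) + 5

variable {A : Params} {s : ℕ → Obs d} {W : Noise d m A.T} {j : Cell d m} {g : ℝ → ℝ}
  {q Λ e σ C c : ℝ}

/-- The invariant of the search at the end of period `t`. -/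
structure Invariant (A : Params) (s : ℕ → Obs d) (W : Noise d m A.T) (j : Cell d m)
    (q Λ e σ c : ℝ) (t : ℕ) : Prop where
  exists_grid : ∃ a b, (cellState A s W j t).rho = grid a b ∧ A.pLo ≤ a ∧ a ≤ c ∧ c ≤ b ∧ b ≤ A.pHi ∧
    b - a = (3 / 4) ^ phase A s W j t * (A.pHi - A.pLo)
  rho_eq : ∀ τ, (cellState A s W j t).start ≤ τ → τ ≤ t →
    (cellState A s W j τ).rho = (cellState A s W j t).rho
  length : q * ((t : ℝ) - (cellState A s W j t).start) ≤
    phaseBound A σ e Λ ((3 / 4) ^ phase A s W j t * (A.pHi - A.pLo))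

lemma phaseBound_nonneg {Δ : ℝ} (he : 0 < e) (hΛ : 0 ≤ Λ) : 0 ≤ phaseBound A σ e Λ Δ := by
  unfold phaseBound; positivity

/-- Prices are constant within a phase, so the centered sums compare the revenue of index `k` with
`n` times one value of `g`. A statistic has error `e / 2`, hence an increment has error `e`. -/
lemma GoodPath.accurate (hG : GoodPath A s W j g q Λ e) (he : 0 < e) (hc1 : 0 < A.c1)
    (h01 : ∀ p ∈ Set.Icc A.pLo A.pHi, g p ∈ Set.Icc (0 : ℝ) 1)
    {t : ℕ} (ht : t + 1 ≤ A.T) (hI : Invariant A s W j q Λ e σ c t) :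
    Accurate A (statDiff s W .revenue j (cellState A s W j t).start (t + 1))
      (statDiff s W .count j (cellState A s W j t).start (t + 1))
      (fun k => g ((cellState A s W j t).rho k)) e ∧
    ∀ k, exactDiff s .count j k (cellState A s W j t).start (t + 1) ≤
      statDiff s W .count j (cellState A s W j t).start (t + 1) k + e := by
  set ς := (cellState A s W j t).start with hς
  have hςt : ς ≤ t := cellState_start_le A s W j t
  obtain ⟨a, b, hab, ha, hac, hcb, hb, -⟩ := hI.exists_grid
  have hdiff : ∀ i k, |statDiff s W i j ς (t + 1) k - exactDiff s i j k ς (t + 1)| ≤ e := by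
    intro i k
    have h1 := abs_le.1 (hG.noise i k (t + 1) ht)
    have h2 := abs_le.1 (hG.noise i k ς (by omega))
    rw [exactDiff, ← prefixSum_sub _ (by omega : ς ≤ t + 1), statDiff, abs_le]
    constructor <;> linarith [h1.1, h1.2, h2.1, h2.2]
  refine ⟨?_, fun k => by linarith [(abs_le.1 (hdiff .count k)).1]⟩
  intro k μ hμ h3
  have hrho : (cellState A s W j t).rho k ∈ Set.Icc A.pLo A.pHi := by
    rw [hab]
    have hk : ((k : ℕ) : ℝ) ≤ 4 := by exact_mod_cast Nat.lt_succ_iff.1 k.2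
    have hk0 : (0 : ℝ) ≤ ((k : ℕ) : ℝ) := by positivity
    have hab' : a ≤ b := hac.trans hcb
    unfold grid
    constructor <;> nlinarith
  obtain ⟨g0, g1⟩ := h01 _ hrho
  refine abs_div_sub_le he hc1.le (hdiff .count k) (hdiff .revenue k) ?_ g0 g1 hμ h3
  have := hG.revenue k (t + 1) ht ς (by omega)
  refine le_trans (le_of_eq ?_) this
  congr 1
  rw [exactDiff, exactDiff, Finset.sum_mul, ← Finset.sum_sub_distrib]
  refine Finset.sum_congr rfl fun τ hτ => ?_
  rw [Finset.mem_Ioc] at hτ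
  -- Period `τ` uses the state at the end of period `τ - 1`, and `ς < τ ≤ t + 1` places `τ - 1` in
  -- the current phase.
  rw [centered, hI.rho_eq (τ - 1) (by omega) (by omega)]

/-- A decisive triple certifies a strict revenue comparison, so the discarded quarter misses the
maximizer. If no triple is decisive, one count must be small, and the arrival bound turns a small
count into a short phase. -/
lemma GoodPath.invariant (hG : GoodPath A s W j g q Λ e) (he : 0 < e) (hc1 : 0 < A.c1) (hΛ : 0 ≤ Λ)
    (hc2 : A.c2 = 3 * e) (hc1' : A.c1' = 12 * e) (hσ : 0 < σ) (hq0 : 0 ≤ q) (hq1 : q ≤ 1)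
    (hc : Curved A.pLo A.pHi σ C c g) (h01 : ∀ p ∈ Set.Icc A.pLo A.pHi, g p ∈ Set.Icc (0 : ℝ) 1)
    {t : ℕ} (ht : t ≤ A.T) :
    Invariant A s W j q Λ e σ c t ∧
    ∀ r, t = r + 1 → (phase A s W j (r + 1) = phase A s W j r ∧
        (cellState A s W j (r + 1)).start = (cellState A s W j r).start) ∨
      (phase A s W j (r + 1) = phase A s W j r + 1 ∧ (cellState A s W j (r + 1)).start = r + 1) := by
  induction t with
  | zero =>
    refine ⟨⟨⟨A.pLo, A.pHi, rfl, le_rfl, hc.mem.1.le, hc.mem.2.le, le_rfl, ?_⟩, ?_, ?_⟩, ?_⟩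
    · simp [phase]
    · intro τ _ hτ
      rw [Nat.le_zero.1 hτ]
    · simpa [cellState] using phaseBound_nonneg he hΛ
    · simp
  | succ t ih =>
    obtain ⟨hI, -⟩ := ih (by omega)
    obtain ⟨hacc, hcount⟩ := hG.accurate he hc1 h01 ht hI
    obtain ⟨a, b, hab, ha, hac, hcb, hb, hw⟩ := hI.exists_grid
    have hstart := cellState_start_le A s W j t
    have hpos : 0 < b - a := by
      rw [hw]
      have : A.pLo < A.pHi := hc.mem.1.trans hc.mem.2
      have := sub_pos.2 this
      positivity
    have g0 : grid a b 0 = a := by simp [grid]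
    have g1 : grid a b 1 = a + (b - a) / 4 := by simp [grid]; ring
    have g2 : grid a b 2 = a + (b - a) / 2 := by simp [grid]; ring
    have g3 : grid a b 3 = b - (b - a) / 4 := by simp [grid]; ring
    have g4 : grid a b 4 = b := by simp [grid]
    have hnew : ∀ a' b', a' ≤ c → c ≤ b' → A.pLo ≤ a' → b' ≤ A.pHi → b' - a' = 3 / 4 * (b - a) →
        cellState A s W j (t + 1) = ⟨grid a' b', t + 1⟩ →
        Invariant A s W j q Λ e σ c (t + 1) ∧ ∀ r, t + 1 = r + 1 →
          (phase A s W j (r + 1) = phase A s W j r ∧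
            (cellState A s W j (r + 1)).start = (cellState A s W j r).start) ∨
          (phase A s W j (r + 1) = phase A s W j r + 1 ∧
            (cellState A s W j (r + 1)).start = r + 1) := by
      intro a' b' h1 h2 h3 h4 h5 h6
      have hph : phase A s W j (t + 1) = phase A s W j t + 1 := by simp [phase, h6]
      refine ⟨⟨⟨a', b', by rw [h6], h3, h1, h2, h4, ?_⟩, ?_, ?_⟩, ?_⟩
      · rw [hph, h5, hw]; ring
      · intro τ hτ1 hτ2
        rw [h6] at hτ1
        rw [show τ = t + 1 from le_antisymm hτ2 hτ1]
      · rw [h6]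
        simpa using phaseBound_nonneg he hΛ
      · intro r hr
        obtain rfl : t = r := by omega
        exact Or.inr ⟨hph, by rw [h6]⟩
    have hsucc := cellState_succ A s W j t
    split_ifs at hsucc with hA hB
    · have hlt := lt_of_increasing he hc1.le hc2 hc1' hacc hA
      rw [hab] at hlt
      simp only [g1, g2] at hlt
      have := hc.lt_max_of_lt (by linarith) (by linarith) hlt
      rw [hab, g1, g4] at hsucc
      exact hnew _ _ this.le hcb (by linarith) hb (by ring) hsucc
    · have hlt := lt_of_increasing he hc1.le hc2 hc1' hacc hB
      rw [hab] at hlt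
      simp only [g2, g3] at hlt
      have := hc.max_lt_of_lt (by linarith) (by linarith) hlt
      rw [hab, g0, g3] at hsucc
      exact hnew _ _ hac this.le ha (by linarith) (by ring) hsucc
    · have hph : phase A s W j (t + 1) = phase A s W j t := by
        simp only [phase, hsucc]
        rw [if_neg (by omega)]
      refine ⟨⟨⟨a, b, by rw [hsucc, hab], ha, hac, hcb, hb, by rw [hph, hw]⟩, ?_, ?_⟩, ?_⟩
      · intro τ hτ1 hτ2
        rw [hsucc] at hτ1
        rcases Nat.lt_or_ge τ (t + 1) with h | h
        · rw [hsucc, hI.rho_eq τ hτ1 (by omega)]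
        · rw [show τ = t + 1 by omega]
      · rw [hsucc, hph, ← hw]
        set ς := (cellState A s W j t).start with hς
        -- Neighbouring grid prices are `(b - a) / 4` apart, and `σ²/2 · ((b - a)/4)² = σ² (b - a)²
        -- / 32`.
        set G := σ ^ 2 * (b - a) ^ 2 / 32 with hGdef
        have hG0 : 0 < G := by positivity
        have hlow : ∃ k, statDiff s W .count j ς (t + 1) k ≤
            3 * e + 144 * A.c1 ^ 2 / G ^ 2 + 84 * e / G := by
          rw [hab] at hacc
          -- The middle price is on one side of the maximizer, so one of the two triples lies
          -- entirely on that side and is ordered with gaps `G`.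
          rcases le_total (grid a b 2) c with h2 | h2
          · refine exists_le_of_not_increasing he hc1 hc2 hc1' hacc hA hG0 ?_ ?_
            · simp only [g1, g2] at h2 ⊢
              refine le_trans (le_of_eq ?_) (hc.gap_left (by linarith) (by linarith) h2)
              rw [hGdef]; ring
            · simp only [g0, g1, g2] at h2 ⊢
              refine le_trans (le_of_eq ?_) (hc.gap_left ha (by linarith) (by linarith))
              rw [hGdef]; ring
          · refine exists_le_of_not_increasing he hc1 hc2 hc1' hacc hB hG0 ?_ ?_
            · simp only [g3, g2] at h2 ⊢
              refine le_trans (le_of_eq ?_) (hc.gap_right h2 (by linarith) (by linarith))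
              rw [hGdef]; ring
            · simp only [g3, g4, g2] at h2 ⊢
              refine le_trans (le_of_eq ?_) (hc.gap_right (by linarith) (by linarith) hb)
              rw [hGdef]; ring
        obtain ⟨k, hk⟩ := hlow
        have h1 := hcount k
        have h2 := hG.arrivals k (t + 1) ht ς (by omega)
        have h3 := card_priceIdx_ge k ς (t + 1)
        have h4 := mul_le_mul_of_nonneg_left h3 hq0
        -- With `n` the exact count and `ℓ` the phase length, `q/2 (ℓ/5 - 1) - Λ ≤ n ≤ 4 e + 144
        -- c₁²/G² + 84 e/G`. Solving for `q ℓ` gives the factor 10 and the summand 5.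
        unfold phaseBound
        rw [← hGdef]
        linarith
      · intro r hr
        obtain rfl : t = r := by omega
        exact Or.inl ⟨hph, by rw [hsucc]⟩

/-- The regret of one cell on a good path. -/
theorem GoodPath.regret_le (hG : GoodPath A s W j g q Λ e) (he : 0 < e) (hc1 : 0 < A.c1)
    (hΛ : A.c1 ^ 2 = Λ) (hc2 : A.c2 = 3 * e) (hc1' : A.c1' = 12 * e) (hσ : 0 < σ) (hq0 : 0 ≤ q)
    (hq1 : q ≤ 1) (hc : Curved A.pLo A.pHi σ C c g)
    (h01 : ∀ p ∈ Set.Icc A.pLo A.pHi, g p ∈ Set.Icc (0 : ℝ) 1) (hp : A.pHi - A.pLo ≤ 1)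
    {D : ℝ} (hD : 0 < D) {N : ℕ} (hN : (3 / 4) ^ N ≤ D) :
    ∑ t ∈ Finset.range A.T, q * (g c - g ((cellState A s W j t).rho (priceIdx (t + 1)))) ≤
      C ^ 2 / 2 * (N * (1474560 * Λ / (σ ^ 4 * D ^ 2) + 27200 * e / σ ^ 2 + 10 * Λ + 6) +
        q * A.T * D ^ 2) := by
  have hΛ0 : 0 ≤ Λ := by rw [← hΛ]; positivity
  have hinv := fun t (ht : t ≤ A.T) => hG.invariant he hc1 hΛ0 hc2 hc1' hσ hq0 hq1 hc h01 ht
  set Δ : ℕ → ℝ := fun i => (3 / 4) ^ i * (A.pHi - A.pLo) with hΔ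
  have hp0 : 0 < A.pHi - A.pLo := sub_pos.2 (hc.mem.1.trans hc.mem.2)
  have hΔ0 : ∀ i, 0 < Δ i := fun i => by positivity
  -- Phases wider than `D` are charged their squared width; in all others the loss of a period is
  -- bounded through `D²`. Only the first `N` phases can be wide.
  set h : ℕ → ℝ := fun i => if D < Δ i then Δ i ^ 2 else 0 with hh
  set ph := phase A s W j
  have hstep : ∀ t < A.T, q * (g c - g ((cellState A s W j t).rho (priceIdx (t + 1)))) ≤
      C ^ 2 / 2 * (q * h (ph t) + q * D ^ 2) := by
    intro t ht
    obtain ⟨a, b, hab, ha, hac, hcb, hb, hw⟩ := (hinv t ht.le).1.exists_grid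
    set k := priceIdx (t + 1)
    have hk : ((k : ℕ) : ℝ) ≤ 4 := by exact_mod_cast Nat.lt_succ_iff.1 k.2
    have hk0 : (0 : ℝ) ≤ ((k : ℕ) : ℝ) := by positivity
    have hr1 : a ≤ grid a b k := by unfold grid; nlinarith
    have hr2 : grid a b k ≤ b := by unfold grid; nlinarith
    rw [hab]
    have h1 := hc.le_quadratic (p := grid a b k) ⟨ha.trans hr1, hr2.trans hb⟩
    have h2 : (grid a b k - c) ^ 2 ≤ Δ (ph t) ^ 2 := by
      rw [← sq_abs (grid a b k - c)]
      have : |grid a b k - c| ≤ Δ (ph t) := by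
        change _ ≤ (3 / 4) ^ ph t * (A.pHi - A.pLo)
        rw [← hw, abs_le]
        constructor <;> linarith
      gcongr
    have h3 : Δ (ph t) ^ 2 ≤ h (ph t) + D ^ 2 := by
      simp only [hh]
      split_ifs with hlt
      · nlinarith
      · rw [zero_add]
        have := hΔ0 (ph t)
        gcongr
        exact not_lt.1 hlt
    calc q * (g c - g (grid a b k)) ≤ q * (C ^ 2 / 2 * (h (ph t) + D ^ 2)) := by
          refine mul_le_mul_of_nonneg_left (h1.trans ?_) hq0
          gcongr
          exact h2.trans h3
      _ = _ := by ring
  have hsum := Finset.sum_le_sum fun t (ht : t ∈ Finset.range A.T) => hstep t (Finset.mem_range.1 ht)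
  refine hsum.trans ?_
  rw [← Finset.mul_sum, Finset.sum_add_distrib]
  have hphases := sum_phases_le (q := q) (T := A.T) (N := N)
    (st := fun t => (cellState A s W j t).start) (ph := ph)
    (F := fun i => phaseBound A σ e Λ (Δ i)) (h := h) hq1 rfl rfl
    (fun t ht => (hinv (t + 1) ht).2 t rfl) (fun t ht => (hinv t ht).1.length)
    (fun i => phaseBound_nonneg he hΛ0) (fun i => by simp only [hh]; split_ifs <;> positivity)
    (fun i hi => by
      have h1 : Δ i ≤ D := by
        calc Δ i ≤ (3 / 4) ^ i * 1 := by simp only [hΔ]; gcongr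
          _ ≤ (3 / 4) ^ N := by
            rw [mul_one]
            exact pow_le_pow_of_le_one (by norm_num) (by norm_num) hi
          _ ≤ D := hN
      simp only [hh]
      rw [if_neg (not_lt.2 h1)])
  have hterm : ∀ i, (phaseBound A σ e Λ (Δ i) + 1) * h i ≤
      1474560 * Λ / (σ ^ 4 * D ^ 2) + 27200 * e / σ ^ 2 + 10 * Λ + 6 := by
    intro i
    simp only [hh]
    split_ifs with hlt
    · have hΔi := hΔ0 i
      have hΔ1 : Δ i ^ 2 ≤ 1 := by
        have : Δ i ≤ 1 := by
          have h34 : ((3 : ℝ) / 4) ^ i ≤ 1 := pow_le_one₀ (by norm_num) (by norm_num)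
          calc Δ i ≤ 1 * 1 := by simp only [hΔ]; gcongr
            _ = 1 := one_mul _
        exact pow_le_one₀ hΔi.le this
      have hw := hc.sq_mul_sq_width_le h01
      have hσΔ : σ ^ 2 * Δ i ^ 2 ≤ 8 := by
        refine le_trans ?_ hw
        gcongr
        have h34 : ((3 : ℝ) / 4) ^ i ≤ 1 := pow_le_one₀ (by norm_num) (by norm_num)
        simp only [hΔ]
        nlinarith
      -- Here `147456 = 144 · 32²`. The squared width cancels one of the two factors `Δ²` in the
      -- phase length, and the other is bounded below by `D²`. In the privacy term both factors
      -- cancel (`t2`), so it does not depend on the width.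
      have t1 : 144 * A.c1 ^ 2 / (σ ^ 2 * Δ i ^ 2 / 32) ^ 2 * Δ i ^ 2 ≤
          147456 * Λ / (σ ^ 4 * D ^ 2) := by
        rw [hΛ]
        calc _ = 147456 * Λ / (σ ^ 4 * Δ i ^ 2) := by field_simp; ring
          _ ≤ _ := by gcongr
      have t2 : 84 * e / (σ ^ 2 * Δ i ^ 2 / 32) * Δ i ^ 2 = 2688 * e / σ ^ 2 := by
        field_simp; norm_num
      have t3 : 4 * e * Δ i ^ 2 ≤ 32 * e / σ ^ 2 := by
        rw [le_div_iff₀ (by positivity)]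
        nlinarith
      have t4 : Λ * Δ i ^ 2 ≤ Λ := mul_le_of_le_one_right hΛ0 hΔ1
      have t5 : 1474560 * Λ / (σ ^ 4 * D ^ 2) = 10 * (147456 * Λ / (σ ^ 4 * D ^ 2)) := by ring
      have t6 : 27200 * e / σ ^ 2 = 10 * (2688 * e / σ ^ 2) + 10 * (32 * e / σ ^ 2) := by ring
      rw [t5, t6]
      unfold phaseBound
      calc _ = 10 * (4 * e * Δ i ^ 2) +
            10 * (144 * A.c1 ^ 2 / (σ ^ 2 * Δ i ^ 2 / 32) ^ 2 * Δ i ^ 2) +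
            10 * (84 * e / (σ ^ 2 * Δ i ^ 2 / 32) * Δ i ^ 2) + 10 * (Λ * Δ i ^ 2) +
            6 * Δ i ^ 2 := by ring
        _ ≤ _ := by rw [t2]; linarith
    · rw [mul_zero]; positivity
  have htot := Finset.sum_le_sum fun i (_ : i ∈ Finset.range N) => hterm i
  rw [Finset.sum_const, Finset.card_range, nsmul_eq_mul] at htot
  rw [Finset.sum_const, Finset.card_range, nsmul_eq_mul]
  have := hphases.trans htot
  refine mul_le_mul_of_nonneg_left ?_ (by positivity)
  linarith

end Path

/-! ### Measurability of the algorithm -/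

section Measurability

lemma measurable_seq {d m T : ℕ} {Ω : Type*} [MeasurableSpace Ω] {W : Ω → Noise d m T}
    (hW : Measurable W) (q : StatKind) (j : Cell d m) (k : Fin 5) (t : ℕ) :
    Measurable fun ω => (W ω).seq q j k t := by
  unfold Noise.seq
  split_ifs with h
  · exact (measurable_pi_apply _).comp hW
  · exact measurable_const

variable {d m : ℕ} [NeZero m] {Ω : Type*} [MeasurableSpace Ω]

/-- Needed because statistics are subtracted at the random period in which the phase began. -/
lemma measurable_apply_of_le {N : Ω → ℕ} {f : ℕ → Ω → ℝ} {t : ℕ} (hN : Measurable N)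
    (hle : ∀ ω, N ω ≤ t) (hf : ∀ i ≤ t, Measurable (f i)) : Measurable fun ω => f (N ω) ω := by
  have h : (fun ω => f (N ω) ω) =
      fun ω => ∑ i ∈ Finset.range (t + 1), if N ω = i then f i ω else 0 := by
    funext ω
    rw [Finset.sum_ite_eq, if_pos (Finset.mem_range.2 (Nat.lt_succ_of_le (hle ω)))]
  rw [h]
  refine Finset.measurable_sum _ fun i hi => ?_
  exact Measurable.ite (hN (measurableSet_singleton i))
    (hf i (Nat.lt_succ_iff.1 (Finset.mem_range.1 hi))) measurable_const

/-- A random element whose first `n` observations are measurable. -/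
structure MeasurableUpTo (s : Ω → ℕ → Obs d) (n : ℕ) : Prop where
  x : ∀ i ∈ Finset.Icc 1 n, Measurable fun ω => (s ω i).x
  y : ∀ i ∈ Finset.Icc 1 n, Measurable fun ω => (s ω i).y
  p : ∀ i ∈ Finset.Icc 1 n, Measurable fun ω => (s ω i).p

variable {s : Ω → ℕ → Obs d} {n : ℕ}

lemma MeasurableUpTo.increment (hs : MeasurableUpTo s n) (q : StatKind) (j : Cell d m) (k : Fin 5)
    {i : ℕ} (hi : i ∈ Finset.Icc 1 n) : Measurable fun ω => increment (s ω) q j k i := by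
  unfold CPPQ.increment
  have hset : MeasurableSet {ω | cellOf (s ω i).x = j ∧ priceIdx i = k} :=
    (((measurable_cellOf (m := m)).comp (hs.x i hi)) (measurableSet_singleton j)).inter
      (MeasurableSet.const _)
  refine Measurable.ite hset ?_ measurable_const
  cases q
  · exact (hs.y i hi).mul (hs.p i hi)
  · exact measurable_const

lemma MeasurableUpTo.prefixSum (hs : MeasurableUpTo s n) (q : StatKind) (j : Cell d m) (k : Fin 5)
    {t : ℕ} (ht : t ≤ n) : Measurable fun ω => prefixSum (CPPQ.increment (s ω) q j k) t := by
  unfold CPPQ.prefixSum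
  exact Finset.measurable_sum _ fun i hi => hs.increment q j k
    (Finset.Icc_subset_Icc_right ht hi)

lemma MeasurableUpTo.stat (hs : MeasurableUpTo s n) {T : ℕ} {W : Ω → Noise d m T}
    (hW : Measurable W) (q : StatKind) (j : Cell d m) (k : Fin 5) {t : ℕ} (ht : t ≤ n) :
    Measurable fun ω => stat T (s ω) (W ω) q j k t := by
  induction t with
  | zero => exact measurable_const
  | succ t ih =>
    simp only [CPPQ.stat]
    split_ifs
    · simp_rw [treeAgg_eq_sum]
      refine Finset.measurable_sum _ fun l _ => ?_
      split_ifs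
      · have h1 := (node_le (t + 1) l).trans ht
        exact ((hs.prefixSum q j k h1).sub (hs.prefixSum q j k ((Nat.sub_le _ _).trans h1))).add
          (measurable_seq hW q j k _)
      · exact measurable_const
    · exact ih (by omega)

lemma measurableSet_increasing (A : Params) {rh mh : Ω → Fin 5 → ℝ}
    (hr : ∀ k, Measurable fun ω => rh ω k) (hm : ∀ k, Measurable fun ω => mh ω k)
    (k₀ k₁ k₂ : Fin 5) : MeasurableSet {ω | Increasing A (rh ω) (mh ω) k₀ k₁ k₂} := by
  have hμ : Measurable fun ω => min (mh ω k₀) (min (mh ω k₁) (mh ω k₂)) :=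
    (hm _).min ((hm _).min (hm _))
  exact (measurableSet_le measurable_const hμ).inter (measurableSet_lt
    ((measurable_const.div hμ.sqrt).add (measurable_const.div hμ))
    ((((hr _).div (hm _)).sub ((hr _).div (hm _))).min (((hr _).div (hm _)).sub
      ((hr _).div (hm _)))))

lemma MeasurableUpTo.cellState (hs : MeasurableUpTo s n) {A : Params} {W : Ω → Noise d m A.T}
    (hW : Measurable W) (j : Cell d m) {t : ℕ} (ht : t ≤ n) :
    (∀ k, Measurable fun ω => (cellState A (s ω) (W ω) j t).rho k) ∧
      Measurable fun ω => (cellState A (s ω) (W ω) j t).start := by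
  induction t with
  | zero => exact ⟨fun k => measurable_const, measurable_const⟩
  | succ t ih =>
    obtain ⟨ih1, ih2⟩ := ih (by omega)
    have hd : ∀ q k, Measurable fun ω =>
        statDiff (s ω) (W ω) q j (CPPQ.cellState A (s ω) (W ω) j t).start (t + 1) k := by
      intro q k
      refine (hs.stat hW q j k ht).sub ?_
      exact measurable_apply_of_le (f := fun i ω => CPPQ.stat A.T (s ω) (W ω) q j k i) ih2
        (fun ω => cellState_start_le A (s ω) (W ω) j t)
        fun i hi => hs.stat hW q j k (by omega)
    have hA := measurableSet_increasing A (hd .revenue) (hd .count) 2 1 0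
    have hB := measurableSet_increasing A (hd .revenue) (hd .count) 2 3 4
    have hgrid : ∀ {a b : Ω → ℝ} (k : Fin 5), Measurable a → Measurable b →
        Measurable fun ω => grid (a ω) (b ω) k := by
      intro a b k ha hb
      unfold grid
      exact (ha.const_mul _).add (hb.const_mul _)
    simp_rw [cellState_succ]
    constructor
    · intro k
      simp_rw [apply_ite (fun S : CellState => S.rho k)]
      exact Measurable.ite hA (hgrid k (ih1 _) (ih1 _))
        (Measurable.ite hB (hgrid k (ih1 _) (ih1 _)) (ih1 k))
    · simp_rw [apply_ite (fun S : CellState => S.start)]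
      exact Measurable.ite hA measurable_const (Measurable.ite hB measurable_const ih2)

lemma MeasurableUpTo.price (hs : MeasurableUpTo s n) {A : Params} {W : Ω → Noise d m A.T}
    (hW : Measurable W) {x : Ω → Ctx d} (hx : Measurable x) {t : ℕ} (ht : t ≤ n + 1) :
    Measurable fun ω => price m A t (s ω) (x ω) (W ω) := by
  have h : (fun ω => CPPQ.price m A t (s ω) (x ω) (W ω)) = fun ω => ∑ j : Cell d m,
      if cellOf (x ω) = j then (CPPQ.cellState A (s ω) (W ω) j (t - 1)).rho (priceIdx t) else 0 := by
    funext ω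
    rw [Finset.sum_ite_eq, if_pos (Finset.mem_univ _)]
    rfl
  rw [h]
  refine Finset.measurable_sum _ fun j _ => ?_
  exact Measurable.ite ((measurable_cellOf.comp hx) (measurableSet_singleton j))
    ((hs.cellState hW j (by omega)).1 _) measurable_const

end Measurability

lemma cellState_rho_mem {d m : ℕ} [NeZero m] {A : Params} (hA : A.pLo ≤ A.pHi) (s : ℕ → Obs d)
    (W : Noise d m A.T) (j : Cell d m) (t : ℕ) (k : Fin 5) :
    (cellState A s W j t).rho k ∈ Set.Icc A.pLo A.pHi := by
  have hgrid : ∀ a b k, a ∈ Set.Icc A.pLo A.pHi → b ∈ Set.Icc A.pLo A.pHi →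
      grid a b k ∈ Set.Icc A.pLo A.pHi := by
    intro a b k ha hb
    have hk : ((k : ℕ) : ℝ) ≤ 4 := by exact_mod_cast Nat.lt_succ_iff.1 k.2
    have hk0 : (0 : ℝ) ≤ ((k : ℕ) : ℝ) := by positivity
    exact convex_Icc A.pLo A.pHi ha hb (show (0 : ℝ) ≤ 1 - ((k : ℕ) : ℝ) / 4 by linarith)
      (show (0 : ℝ) ≤ ((k : ℕ) : ℝ) / 4 by positivity) (by ring)
  induction t generalizing k with
  | zero => exact hgrid _ _ k ⟨le_rfl, hA⟩ ⟨hA, le_rfl⟩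
  | succ t ih =>
    rw [cellState_succ]
    split_ifs
    · exact hgrid _ _ k (ih _) (ih _)
    · exact hgrid _ _ k (ih _) (ih _)
    · exact ih k

/-! ### The information structure of a run -/

/-- Pulling out a known factor for arbitrary nonnegative `Z`, with no integrability assumption: the
measures weighted by `v` and by its conditional expectation have the same restriction to `m₀`, and
`Z` sees only that restriction. -/
lemma lintegral_mul_condExp {Ω : Type*} {m₀ mΩ : MeasurableSpace Ω} {P : Measure Ω} (hm : m₀ ≤ mΩ)
    [IsFiniteMeasure P] {v h : Ω → ℝ} (hv : Integrable v P) (hv0 : 0 ≤ᵐ[P] v) (hc : P[v | m₀] =ᵐ[P] h)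
    {Z : Ω → ENNReal} (hZ : Measurable[m₀] Z) :
    ∫⁻ ω, Z ω * ENNReal.ofReal (v ω) ∂P = ∫⁻ ω, Z ω * ENNReal.ofReal (h ω) ∂P := by
  have hvm : AEMeasurable (fun ω => ENNReal.ofReal (v ω)) P := hv.aemeasurable.ennreal_ofReal
  set H := P⁻[fun ω => ENNReal.ofReal (v ω) | m₀] with hH
  have hHm : Measurable[m₀] H := measurable_condLExp m₀ P _
  have h1 : H =ᵐ[P] fun ω => ENNReal.ofReal (h ω) := by
    refine (condLExp_ofReal m₀ hv hv0).trans ?_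
    filter_upwards [hc] with ω hω
    rw [hω]
  have h2 : (P.withDensity fun ω => ENNReal.ofReal (v ω)).trim hm = (P.withDensity H).trim hm := by
    refine @Measure.ext _ m₀ _ _ fun s hs => ?_
    rw [trim_measurableSet_eq hm hs, trim_measurableSet_eq hm hs, withDensity_apply _ (hm s hs),
      withDensity_apply _ (hm s hs), hH, setLIntegral_condLExp hm P _ hs]
  have hZ' : Measurable Z := hZ.mono hm le_rfl
  have h3 : ∫⁻ ω, Z ω ∂(P.withDensity fun ω => ENNReal.ofReal (v ω)) =
      ∫⁻ ω, Z ω ∂(P.withDensity H) := by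
    rw [← lintegral_trim hm hZ, h2, lintegral_trim hm hZ]
  rw [lintegral_withDensity_eq_lintegral_mul₀ hvm hZ'.aemeasurable,
    lintegral_withDensity_eq_lintegral_mul _ (hHm.mono hm le_rfl) hZ'] at h3
  simp only [Pi.mul_apply] at h3
  calc _ = ∫⁻ ω, ENNReal.ofReal (v ω) * Z ω ∂P := by simp_rw [mul_comm]
    _ = _ := h3
    _ = _ := by
      refine lintegral_congr_ae ?_
      filter_upwards [h1] with ω hω
      rw [hω, mul_comm]

section Run

variable {d m : ℕ} {A : Params} {Ω : Type*} {x : ℕ → Ω → Ctx d} {y p : ℕ → Ω → ℝ}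
  {W : Ω → Noise d m A.T}

/-- The data of a run. -/
def runData (x : ℕ → Ω → Ctx d) (y p : ℕ → Ω → ℝ) (ω : Ω) (i : ℕ) : Obs d := ⟨x i ω, y i ω, p i ω⟩

/-- The events known when customer `t` has arrived. -/
@[reducible] def known (x : ℕ → Ω → Ctx d) (y : ℕ → Ω → ℝ) (W : Ω → Noise d m A.T) (t : ℕ) :
    MeasurableSpace Ω :=
  past x y W t ⊔ MeasurableSpace.comap (x t) inferInstance

lemma measurable_past_x {i t : ℕ} (hi : i ∈ Finset.Ico 1 t) : Measurable[past x y W t] (x i) := by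
  have h : MeasurableSpace.comap (x i) inferInstance ≤ past x y W t :=
    le_trans (le_trans le_sup_left (le_iSup₂_of_le i hi le_rfl)) le_sup_left
  exact measurable_iff_comap_le.2 h

lemma measurable_past_y {i t : ℕ} (hi : i ∈ Finset.Ico 1 t) : Measurable[past x y W t] (y i) := by
  have h : MeasurableSpace.comap (y i) inferInstance ≤ past x y W t :=
    le_trans (le_trans le_sup_right (le_iSup₂_of_le i hi le_rfl)) le_sup_left
  exact measurable_iff_comap_le.2 h

lemma measurable_past_W {t : ℕ} : Measurable[past x y W t] W :=
  measurable_iff_comap_le.2 le_sup_right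

lemma measurable_known_x {t : ℕ} : Measurable[known x y W t] (x t) :=
  measurable_iff_comap_le.2 le_sup_right

lemma past_mono {t t' : ℕ} (h : t ≤ t') : past x y W t ≤ past x y W t' :=
  sup_le_sup_right (biSup_mono fun _ hi => Finset.Ico_subset_Ico_right h hi) _

lemma known_le_past {t : ℕ} (ht : 1 ≤ t) : known x y W t ≤ past x y W (t + 1) :=
  sup_le (past_mono (Nat.le_succ t))
    (measurable_iff_comap_le.1 (measurable_past_x (Finset.mem_Ico.2 ⟨ht, Nat.lt_succ_self t⟩)))

variable [NeZero m] {PX : Measure (Ctx d)} {lam : ℝ → Ctx d → ℝ} [mΩ : MeasurableSpace Ω]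
  {P : Measure Ω}

namespace IsRun

lemma past_le (hR : IsRun A PX lam P x y p W) (t : ℕ) : past x y W t ≤ mΩ :=
  sup_le (iSup₂_le fun i _ => sup_le (measurable_iff_comap_le.1 (hR.measurable_x i))
    (measurable_iff_comap_le.1 (hR.measurable_y i))) (measurable_iff_comap_le.1 hR.measurable_W)

lemma known_le (hR : IsRun A PX lam P x y p W) (t : ℕ) : known x y W t ≤ mΩ :=
  sup_le (hR.past_le t) (measurable_iff_comap_le.1 (hR.measurable_x t))

/-- The price reads past prices as well as past contexts and demands, so the past prices have to be
eliminated by strong induction. -/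
lemma measurable_p (hR : IsRun A PX lam P x y p W) {t : ℕ} (ht : t ∈ Finset.Icc 1 A.T) :
    Measurable[known x y W t] (p t) := by
  induction t using Nat.strong_induction_on with
  | _ t ih =>
    rw [Finset.mem_Icc] at ht
    have hs : @MeasurableUpTo d Ω (known x y W t) (runData x y p) (t - 1) := by
      have hi : ∀ i ∈ Finset.Icc 1 (t - 1), i ∈ Finset.Ico 1 t := fun i hi => by
        rw [Finset.mem_Icc] at hi; rw [Finset.mem_Ico]; omega
      refine @MeasurableUpTo.mk d Ω (known x y W t) _ _ ?_ ?_ ?_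
      · exact fun i h => (measurable_past_x (hi i h)).mono le_sup_left le_rfl
      · exact fun i h => (measurable_past_y (hi i h)).mono le_sup_left le_rfl
      · intro i h
        have h1 := Finset.mem_Ico.1 (hi i h)
        exact (ih i h1.2 (Finset.mem_Icc.2 ⟨h1.1, by omega⟩)).mono
          ((known_le_past h1.1).trans ((past_mono h1.2).trans le_sup_left)) le_rfl
    have h := @MeasurableUpTo.price d m _ Ω (known x y W t) (runData x y p) (t - 1) hs A W
      (measurable_past_W.mono le_sup_left le_rfl) (x t) measurable_known_x t (by omega)
    have e : p t = fun ω => price m A t (runData x y p ω) (x t ω) (W ω) :=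
      funext fun ω => hR.price_eq t (Finset.mem_Icc.2 ht) ω
    rw [e]
    exact h

lemma measurableUpTo (hR : IsRun A PX lam P x y p W) {t : ℕ} (ht : t ≤ A.T) :
    @MeasurableUpTo d Ω (past x y W (t + 1)) (runData x y p) t := by
  have hi : ∀ i ∈ Finset.Icc 1 t, i ∈ Finset.Ico 1 (t + 1) := fun i hi => by
    rw [Finset.mem_Icc] at hi; rw [Finset.mem_Ico]; omega
  refine @MeasurableUpTo.mk d Ω (past x y W (t + 1)) _ _ ?_ ?_ ?_
  · exact fun i h => measurable_past_x (hi i h)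
  · exact fun i h => measurable_past_y (hi i h)
  · intro i h
    have h1 := Finset.mem_Icc.1 h
    exact (hR.measurable_p (Finset.mem_Icc.2 ⟨h1.1, h1.2.trans ht⟩)).mono
      ((known_le_past h1.1).trans (past_mono (by omega))) le_rfl

lemma measurable_rho (hR : IsRun A PX lam P x y p W) {t : ℕ} (ht : t ∈ Finset.Icc 1 A.T)
    (j : Cell d m) (k : Fin 5) :
    Measurable[past x y W t] fun ω => (cellState A (runData x y p ω) (W ω) j (t - 1)).rho k := by
  rw [Finset.mem_Icc] at ht
  have h := (@MeasurableUpTo.cellState d m _ Ω (past x y W (t - 1 + 1)) (runData x y p) (t - 1)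
    (hR.measurableUpTo (by omega)) A W measurable_past_W j (t - 1) le_rfl).1 k
  rwa [Nat.sub_add_cancel ht.1] at h

lemma measurable_increment (hR : IsRun A PX lam P x y p W) {t : ℕ} (ht : t ∈ Finset.Icc 1 A.T)
    (q : StatKind) (j : Cell d m) (k : Fin 5) :
    Measurable[past x y W (t + 1)] fun ω => increment (runData x y p ω) q j k t :=
  @MeasurableUpTo.increment d m _ Ω (past x y W (t + 1)) (runData x y p) t
    (hR.measurableUpTo (Finset.mem_Icc.1 ht).2) q j k t
    (Finset.mem_Icc.2 ⟨(Finset.mem_Icc.1 ht).1, le_rfl⟩)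

/-- The current context is independent of the past. -/
lemma lintegral_past_context (hR : IsRun A PX lam P x y p W) {t : ℕ} (ht : t ∈ Finset.Icc 1 A.T)
    {E : Type*} [MeasurableSpace E] {Y : Ω → E} (hY : Measurable[past x y W t] Y)
    {φ : E × Ctx d → ENNReal} (hφ : Measurable φ) :
    ∫⁻ ω, φ (Y ω, x t ω) ∂P = ∫⁻ ω, ∫⁻ z, φ (Y ω, z) ∂PX ∂P := by
  have := hR.prob
  have hY' : Measurable Y := hY.mono (hR.past_le t) le_rfl
  have hx := hR.measurable_x t
  have hind : IndepFun Y (x t) P := by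
    rw [IndepFun_iff_Indep]
    exact indep_of_indep_of_le_left (hR.context_indep t ht).symm (measurable_iff_comap_le.1 hY)
  have hmap := (indepFun_iff_map_prod_eq_prod_map_map hY'.aemeasurable hx.aemeasurable).1 hind
  rw [hR.context_law t ht] at hmap
  have hPX : IsProbabilityMeasure PX := by
    rw [← hR.context_law t ht]
    exact Measure.isProbabilityMeasure_map hx.aemeasurable
  rw [← lintegral_map (f := φ) hφ (hY'.prodMk hx), hmap, lintegral_prod _ hφ.aemeasurable,
    lintegral_map (hφ.lintegral_prod_right') hY']

end IsRun

/-- A product of factors with conditional expectation at most one has expectation at most one. -/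
lemma IsRun.lintegral_prod_le_one (hR : IsRun A PX lam P x y p W) {G : ℕ → Ω → ENNReal}
    (hmeas : ∀ τ ∈ Finset.Icc 1 A.T, Measurable[past x y W (τ + 1)] (G τ))
    (hG : ∀ τ ∈ Finset.Icc 1 A.T, ∀ Z : Ω → ENNReal, Measurable[past x y W τ] Z →
      ∫⁻ ω, Z ω * G τ ω ∂P ≤ ∫⁻ ω, Z ω ∂P) {ς t : ℕ} (hςt : ς ≤ t) (ht : t ≤ A.T) :
    ∫⁻ ω, ∏ τ ∈ Finset.Ioc ς t, G τ ω ∂P ≤ 1 := by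
  have := hR.prob
  induction t, hςt using Nat.le_induction with
  | base => simp
  | succ t h ih =>
    have hmem : t + 1 ∈ Finset.Icc 1 A.T := Finset.mem_Icc.2 ⟨by omega, ht⟩
    simp_rw [← Finset.insert_Ioc_right_eq_Ioc_add_one h,
      Finset.prod_insert (show t + 1 ∉ Finset.Ioc ς t by simp), mul_comm (G (t + 1) _)]
    refine (hG (t + 1) hmem _ ?_).trans (ih (by omega))
    refine Finset.measurable_prod _ fun τ hτ => ?_
    rw [Finset.mem_Ioc] at hτ
    exact (hmeas τ (Finset.mem_Icc.2 ⟨by omega, by omega⟩)).mono (past_mono (by omega)) le_rfl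

end Run

/-! ### Exponential supermartingales -/

/-- Hoeffding's lemma for the two-point law with mean `u`. -/
lemma bernoulli_mgf_le {u : ℝ} (h0 : 0 ≤ u) (h1 : u ≤ 1) (l : ℝ) :
    1 - u + u * Real.exp l ≤ Real.exp (l * u + l ^ 2 / 8) := by
  set μ : Measure ℝ := ENNReal.ofReal u • Measure.dirac 1 + ENNReal.ofReal (1 - u) • Measure.dirac 0
    with hμ
  have hP : IsProbabilityMeasure μ := ⟨by
    simp [hμ, ← ENNReal.ofReal_add h0 (sub_nonneg.2 h1)]⟩
  have hint : ∀ f : ℝ → ℝ, ∫ z, f z ∂μ = u * f 1 + (1 - u) * f 0 := by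
    intro f
    have hi : ∀ (a c : ℝ), Integrable f (ENNReal.ofReal a • Measure.dirac c) := fun a c =>
      (integrable_dirac (by simp)).smul_measure ENNReal.ofReal_ne_top
    rw [hμ, integral_add_measure (hi _ _) (hi _ _), integral_smul_measure, integral_smul_measure,
      integral_dirac, integral_dirac, ENNReal.toReal_ofReal h0,
      ENNReal.toReal_ofReal (sub_nonneg.2 h1)]
    simp
  have hae : ∀ᵐ z ∂μ, id z ∈ Set.Icc (0 : ℝ) 1 := by
    rw [hμ, ae_add_measure_iff]
    constructor
    · refine Measure.ae_smul_measure ?_ _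
      rw [ae_dirac_eq]
      exact ⟨zero_le_one, le_rfl⟩
    · refine Measure.ae_smul_measure ?_ _
      rw [ae_dirac_eq]
      exact ⟨le_rfl, zero_le_one⟩
  have h := (hasSubgaussianMGF_of_mem_Icc (μ := μ) (X := id) aemeasurable_id hae).mgf_le l
  rw [mgf, hint, hint] at h
  simp only [id] at h
  have e1 : ((((‖(1 : ℝ) - 0‖₊ / 2) ^ 2 : NNReal)) : ℝ) * l ^ 2 / 2 = l ^ 2 / 8 := by
    push_cast
    simp
    ring
  rw [e1] at h
  have h2 := mul_le_mul_of_nonneg_left h (Real.exp_pos (l * u)).le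
  rw [← Real.exp_add] at h2
  refine le_trans (le_of_eq ?_) h2
  rw [mul_add, mul_left_comm, ← Real.exp_add, mul_left_comm (Real.exp (l * u)), ← Real.exp_add,
    show l * u + l * (1 - (u * 1 + (1 - u) * 0)) = l by ring,
    show l * u + l * (0 - (u * 1 + (1 - u) * 0)) = 0 by ring, Real.exp_zero]
  ring

/-- The exponential lies below its chord. The chord is affine in `u`, so conditional expectations
may be taken inside it. -/
lemma exp_mul_le_of_mem_Icc {u : ℝ} (h0 : 0 ≤ u) (h1 : u ≤ 1) (l : ℝ) :
    Real.exp (l * u) ≤ 1 - u + u * Real.exp l := by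
  have h := convexOn_exp.2 (Set.mem_univ 0) (Set.mem_univ l) (sub_nonneg.2 h1) h0 (by ring)
  simp only [smul_eq_mul, mul_zero, zero_add, Real.exp_zero, mul_one] at h
  rwa [mul_comm]

section CellMean

variable {d m : ℕ} [NeZero m] {pLo pHi CX CL σH CH Cp : ℝ} {PX : Measure (Ctx d)}
  {lam : ℝ → Ctx d → ℝ} {pstar : Ctx d → ℝ} {F : ℝ × Ctx d → ℝ}

/-- The probability that a context lies in cell `j`. -/
def cellProb (PX : Measure (Ctx d)) (j : Cell d m) : ℝ := PX.real {z | cellOf z = j}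

lemma cellProb_nonneg (PX : Measure (Ctx d)) (j : Cell d m) : 0 ≤ cellProb PX j :=
  measureReal_nonneg

lemma cell_ae_eq_cellCube (hM : Model pLo pHi CX CL σH CH Cp PX lam pstar) (j : Cell d m) :
    ({z | cellOf z = j} : Set (Ctx d)) =ᵐ[PX] cellCube j := by
  filter_upwards [hM.ae_mem_cellCube_iff (m := m)] with z hz
  exact propext (hz j)

lemma measure_cellCube_ne_zero (hM : Model pLo pHi CX CL σH CH Cp PX lam pstar) {j : Cell d m}
    (hq : 0 < cellProb PX j) : PX (cellCube j) ≠ 0 := by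
  rw [← measure_congr (cell_ae_eq_cellCube hM j)]
  intro h
  rw [cellProb, measureReal_def, h] at hq
  simp at hq

lemma setIntegral_cell (hM : Model pLo pHi CX CL σH CH Cp PX lam pstar)
    (hF : IsExtension pLo pHi lam F) {j : Cell d m} (hq : 0 < cellProb PX j) {p : ℝ}
    (hp : p ∈ Set.Icc pLo pHi) :
    ∫ z in {z | cellOf z = j}, F (p, z) ∂PX = cellProb PX j * revenueOn PX lam (cellCube j) p := by
  have hq' : PX.real (cellCube j) = cellProb PX j := by
    rw [cellProb, measureReal_def, measureReal_def, measure_congr (cell_ae_eq_cellCube hM j)]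
  rw [setIntegral_congr_set (cell_ae_eq_cellCube hM j),
    Model.revenueOn_eq hF (measurableSet_cellCube j) (cellCube_subset j) hp, ProbabilityTheory.cond, integral_smul_measure,
    smul_eq_mul, ENNReal.toReal_inv, ← measureReal_def, hq', mul_inv_cancel_left₀ hq.ne']

lemma measurable_revenueOn_comp (hM : Model pLo pHi CX CL σH CH Cp PX lam pstar) {j : Cell d m}
    (hq : 0 < cellProb PX j) {Ω : Type*} [MeasurableSpace Ω] {Y : Ω → ℝ} (hY : Measurable Y)
    (hmem : ∀ ω, Y ω ∈ Set.Icc pLo pHi) :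
    Measurable fun ω => revenueOn PX lam (cellCube j) (Y ω) := by
  obtain ⟨F, hF⟩ := hM.exists_isExtension
  have := hM.prob
  have h1 : StronglyMeasurable fun p => ∫ z in {z | cellOf z = j}, F (p, z) ∂PX :=
    hF.cont.stronglyMeasurable.integral_prod_right'
  have h2 : (fun ω => revenueOn PX lam (cellCube j) (Y ω)) =
      fun ω => (cellProb PX j)⁻¹ * ∫ z in {z | cellOf z = j}, F (Y ω, z) ∂PX := by
    funext ω
    rw [setIntegral_cell hM hF hq (hmem ω), inv_mul_cancel_left₀ hq.ne']
  rw [h2]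
  exact (h1.measurable.comp hY).const_mul _

lemma measure_cell_eq (hM : Model pLo pHi CX CL σH CH Cp PX lam pstar) (j : Cell d m) :
    PX {z | cellOf z = j} = ENNReal.ofReal (cellProb PX j) := by
  have := hM.prob
  rw [cellProb, ofReal_measureReal]

lemma measure_cell_compl (hM : Model pLo pHi CX CL σH CH Cp PX lam pstar) (j : Cell d m) :
    PX {z | cellOf z = j}ᶜ = ENNReal.ofReal (1 - cellProb PX j) := by
  have := hM.prob
  rw [prob_compl_eq_one_sub (measurableSet_cell j), measure_cell_eq hM,
    ENNReal.ofReal_sub 1 (cellProb_nonneg PX j), ENNReal.ofReal_one]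

lemma cellProb_le_one (hM : Model pLo pHi CX CL σH CH Cp PX lam pstar) (j : Cell d m) :
    cellProb PX j ≤ 1 := by
  have := hM.prob
  exact measureReal_le_one

/-- Bernoulli bound on the exponential of the revenue of one customer, given the price of cell `j`,
its averaged revenue `γ`, and the context. -/
def expBound (F : ℝ × Ctx d → ℝ) (j : Cell d m) (l p γ : ℝ) (z : Ctx d) : ENNReal :=
  open Classical in
  if cellOf z = j then ENNReal.ofReal
    (Real.exp (-(l * γ) - l ^ 2 / 8) * (1 - F (p, z) + F (p, z) * Real.exp l)) else 1

/-- The integrand is affine in `F(p, z)`, so averaging over the cell replaces `F(p, z)` by `γ`, and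
Hoeffding's lemma at mean `γ` cancels the prefactor. -/
lemma lintegral_expBound_le (hM : Model pLo pHi CX CL σH CH Cp PX lam pstar)
    (hF : IsExtension pLo pHi lam F) {j : Cell d m} (hq : 0 < cellProb PX j) (l : ℝ) {p : ℝ}
    (hp : p ∈ Set.Icc pLo pHi) :
    ∫⁻ z, expBound F j l p (revenueOn PX lam (cellCube j) p) z ∂PX ≤ 1 := by
  have := hM.prob
  set γ := revenueOn PX lam (cellCube j) p with hγ
  set q := cellProb PX j with hqdef
  obtain ⟨hγ0, hγ1⟩ := hM.revenueOn_mem (measurableSet_cellCube j) (cellCube_subset j)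
    (measure_cellCube_ne_zero hM hq) hp
  rw [← lintegral_add_compl _ (measurableSet_cell j)]
  have h1 : ∫⁻ z in {z | cellOf z = j}ᶜ, expBound F j l p γ z ∂PX = ENNReal.ofReal (1 - q) := by
    rw [setLIntegral_congr_fun (f := fun z => expBound F j l p γ z) (g := fun _ => 1)
      (measurableSet_cell j).compl fun z hz => if_neg hz]
    rw [setLIntegral_one, measure_cell_compl hM]
  have h2 : ∫⁻ z in {z | cellOf z = j}, expBound F j l p γ z ∂PX ≤ ENNReal.ofReal q := by
    rw [setLIntegral_congr_fun (f := fun z => expBound F j l p γ z)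
      (g := fun z => ENNReal.ofReal (Real.exp (-(l * γ) - l ^ 2 / 8) *
        (1 - F (p, z) + F (p, z) * Real.exp l))) (measurableSet_cell j) fun z hz => if_pos hz]
    have hFi := (Model.integrable_extension hF (PX.restrict {z | cellOf z = j}) p)
    have hint : Integrable (fun z => Real.exp (-(l * γ) - l ^ 2 / 8) *
        (1 - F (p, z) + F (p, z) * Real.exp l)) (PX.restrict {z | cellOf z = j}) :=
      (((integrable_const 1).sub hFi).add (hFi.mul_const _)).const_mul _
    rw [← ofReal_integral_eq_lintegral_ofReal hint (Filter.Eventually.of_forall fun z => by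
      have := hF.mem01 (p, z)
      exact mul_nonneg (Real.exp_pos _).le
        (add_nonneg (sub_nonneg.2 this.2) (mul_nonneg this.1 (Real.exp_pos _).le)))]
    refine ENNReal.ofReal_le_ofReal ?_
    have hFi' : Integrable (fun z => 1 - F (p, z)) (PX.restrict {z | cellOf z = j}) :=
      (integrable_const 1).sub hFi
    rw [integral_const_mul, integral_add hFi' (hFi.mul_const _),
      integral_sub (integrable_const 1) hFi, integral_mul_const, setIntegral_cell hM hF hq hp,
      setIntegral_const, ← hγ, smul_eq_mul, mul_one]
    change _ * (q - q * γ + q * γ * Real.exp l) ≤ q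
    have hb := bernoulli_mgf_le hγ0 hγ1 l
    calc _ = q * (Real.exp (-(l * γ) - l ^ 2 / 8) * (1 - γ + γ * Real.exp l)) := by ring
      _ ≤ q * (Real.exp (-(l * γ) - l ^ 2 / 8) * Real.exp (l * γ + l ^ 2 / 8)) := by gcongr
      _ = q := by rw [← Real.exp_add]; ring_nf; simp
  rw [h1]
  refine (add_le_add_left h2 _).trans (le_of_eq ?_)
  rw [← ENNReal.ofReal_add hq.le (sub_nonneg.2 (cellProb_le_one hM j))]
  change ENNReal.ofReal (q + (1 - q)) = 1
  simp

end CellMean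

section Supermartingale

variable {d m : ℕ} [NeZero m] {A : Params} {CX CL σH CH Cp : ℝ} {PX : Measure (Ctx d)}
  {lam : ℝ → Ctx d → ℝ} {pstar : Ctx d → ℝ} {F : ℝ × Ctx d → ℝ}
  {Ω : Type*} [mΩ : MeasurableSpace Ω] {P : Measure Ω} {x : ℕ → Ω → Ctx d} {y p : ℕ → Ω → ℝ}
  {W : Ω → Noise d m A.T}

namespace IsRun

lemma price_mem (hR : IsRun A PX lam P x y p W) (hM : Model A.pLo A.pHi CX CL σH CH Cp PX lam pstar)
    {t : ℕ} (ht : t ∈ Finset.Icc 1 A.T) (ω : Ω) : p t ω ∈ Set.Icc A.pLo A.pHi := by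
  rw [hR.price_eq t ht ω]
  exact cellState_rho_mem hM.price_range.2.1.le _ _ _ _ _

lemma price_eq_rho (hR : IsRun A PX lam P x y p W) {t : ℕ} (ht : t ∈ Finset.Icc 1 A.T) {ω : Ω}
    {j : Cell d m} (hj : cellOf (x t ω) = j) :
    p t ω = (cellState A (runData x y p ω) (W ω) j (t - 1)).rho (priceIdx t) := by
  rw [hR.price_eq t ht ω, ← hj]
  rfl

lemma ae_context (hR : IsRun A PX lam P x y p W) {t : ℕ} (ht : t ∈ Finset.Icc 1 A.T)
    {S : Ctx d → Prop} (h : ∀ᵐ z ∂PX, S z) : ∀ᵐ ω ∂P, S (x t ω) := by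
  rw [← hR.context_law t ht] at h
  exact ae_of_ae_map (hR.measurable_x t).aemeasurable h

lemma ae_demand_mul_price (hR : IsRun A PX lam P x y p W)
    (hM : Model A.pLo A.pHi CX CL σH CH Cp PX lam pstar) {t : ℕ} (ht : t ∈ Finset.Icc 1 A.T) :
    ∀ᵐ ω ∂P, y t ω * p t ω ∈ Set.Icc (0 : ℝ) 1 := by
  obtain ⟨h0, -, h1⟩ := hM.price_range
  filter_upwards [hR.demand_range t ht] with ω hy
  have hp := hR.price_mem hM ht ω
  exact ⟨mul_nonneg hy.1 (h0.trans hp.1), mul_le_one₀ hy.2 (h0.trans hp.1) (hp.2.trans h1)⟩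

lemma integrable_demand_mul_price (hR : IsRun A PX lam P x y p W)
    (hM : Model A.pLo A.pHi CX CL σH CH Cp PX lam pstar) {t : ℕ} (ht : t ∈ Finset.Icc 1 A.T) :
    Integrable (fun ω => y t ω * p t ω) P := by
  have := hR.prob
  exact Integrable.of_mem_Icc 0 1 ((hR.measurable_y t).mul
    ((hR.measurable_p ht).mono (hR.known_le t) le_rfl)).aemeasurable (hR.ae_demand_mul_price hM ht)

lemma condExp_demand_mul_price (hR : IsRun A PX lam P x y p W)
    (hM : Model A.pLo A.pHi CX CL σH CH Cp PX lam pstar) (hF : IsExtension A.pLo A.pHi lam F)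
    {t : ℕ} (ht : t ∈ Finset.Icc 1 A.T) :
    P[fun ω => y t ω * p t ω | known x y W t] =ᵐ[P] fun ω => F (p t ω, x t ω) := by
  have := hR.prob
  have hy : Integrable (y t) P :=
    Integrable.of_mem_Icc 0 1 (hR.measurable_y t).aemeasurable (hR.demand_range t ht)
  have h1 : P[y t * p t | known x y W t] =ᵐ[P] P[y t | known x y W t] * p t :=
    condExp_mul_of_stronglyMeasurable_right (hR.measurable_p ht).stronglyMeasurable
      (hR.integrable_demand_mul_price hM ht) hy
  refine (show _ =ᵐ[P] _ from h1).trans ?_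
  filter_upwards [hR.demand_mean t ht, hR.ae_context ht hM.ae_mem_unitCube] with ω hω hx
  rw [Pi.mul_apply, hω, hF.eq _ (hR.price_mem hM ht ω) _ hx, revenue, mul_comm]

lemma measurable_revenueOn_rho (hR : IsRun A PX lam P x y p W)
    (hM : Model A.pLo A.pHi CX CL σH CH Cp PX lam pstar) {j : Cell d m} (hq : 0 < cellProb PX j)
    {t : ℕ} (ht : t ∈ Finset.Icc 1 A.T) (k : Fin 5) :
    Measurable[past x y W t] fun ω => revenueOn PX lam (cellCube j)
      ((cellState A (runData x y p ω) (W ω) j (t - 1)).rho k) :=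
  @measurable_revenueOn_comp d m _ A.pLo A.pHi CX CL σH CH Cp PX lam pstar hM j hq Ω (past x y W t)
    _ (hR.measurable_rho ht j k) fun _ => cellState_rho_mem hM.price_range.2.1.le _ _ _ _ _

/-- One supermartingale step. The chord bound makes the exponential affine in `y p` (`step1`);
conditioning on context and price replaces `y p` by `F` (`step2`); on the cell the price equals `ρ`,
known from the past (`step3`). Independence then lets the context be integrated out with `ρ` fixed.
-/
lemma lintegral_exp_centered_le (hR : IsRun A PX lam P x y p W)
    (hM : Model A.pLo A.pHi CX CL σH CH Cp PX lam pstar) {j : Cell d m} (hq : 0 < cellProb PX j)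
    (k : Fin 5) (l : ℝ) {t : ℕ} (ht : t ∈ Finset.Icc 1 A.T) {Z : Ω → ENNReal}
    (hZ : Measurable[past x y W t] Z) :
    ∫⁻ ω, Z ω * ENNReal.ofReal (Real.exp (l * centered A (runData x y p ω) (W ω) j
        (revenueOn PX lam (cellCube j)) k t -
        l ^ 2 / 8 * increment (runData x y p ω) .count j k t)) ∂P ≤ ∫⁻ ω, Z ω ∂P := by
  classical
  by_cases hk : priceIdx t = k
  swap
  · simp [centered, increment, hk]
  have := hR.prob
  obtain ⟨F, hF⟩ := hM.exists_isExtension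
  set ρ : Ω → ℝ := fun ω => (cellState A (runData x y p ω) (W ω) j (t - 1)).rho k with hρ
  set γ : Ω → ℝ := fun ω => revenueOn PX lam (cellCube j) (ρ ω) with hγ
  have hρm : Measurable[past x y W t] ρ := hR.measurable_rho ht j k
  have hγm : Measurable[past x y W t] γ := hR.measurable_revenueOn_rho hM hq ht k
  have hF' := hF.cont.measurable
  set C : Set Ω := {ω | cellOf (x t ω) = j} with hC
  have hCm : MeasurableSet[known x y W t] C :=
    (measurable_cellOf.comp measurable_known_x) (measurableSet_singleton j)
  set κ : Ω → ENNReal := fun ω => ENNReal.ofReal (Real.exp (-(l * γ ω) - l ^ 2 / 8)) with hκ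
  have hκm : Measurable[past x y W t] κ :=
    ((((hγm.const_mul l).neg).sub_const _).exp).ennreal_ofReal
  have hu := hR.ae_demand_mul_price hM ht
  have hce := hR.condExp_demand_mul_price hM hF ht
  have hui := hR.integrable_demand_mul_price hM ht
  have hce1 : P[fun ω => 1 - y t ω * p t ω | known x y W t] =ᵐ[P]
      fun ω => 1 - F (p t ω, x t ω) := by
    refine (condExp_sub (integrable_const 1) hui _).trans ?_
    filter_upwards [hce] with ω hω
    rw [Pi.sub_apply, hω, condExp_const (hR.known_le t)]
  set Z₁ : Ω → ENNReal := C.indicator fun ω => Z ω * κ ω with hZ₁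
  have hZκ : Measurable[known x y W t] fun ω => Z ω * κ ω :=
    (hZ.mul hκm).mono le_sup_left le_rfl
  have hZ₁m : Measurable[known x y W t] Z₁ := hZκ.indicator hCm
  have hZ₂m : Measurable[known x y W t] fun ω => Z₁ ω * ENNReal.ofReal (Real.exp l) :=
    hZ₁m.mul_const _
  have hZm' : Measurable Z := hZ.mono (hR.past_le t) le_rfl
  have hCm' : MeasurableSet C := hR.known_le t _ hCm
  have hA : Measurable (Cᶜ.indicator Z) := hZm'.indicator hCm'.compl
  have hpm : Measurable (p t) := (hR.measurable_p ht).mono (hR.known_le t) le_rfl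
  have hxm := hR.measurable_x t
  have hB : Measurable fun ω => Z₁ ω * ENNReal.ofReal (1 - y t ω * p t ω) :=
    (hZ₁m.mono (hR.known_le t) le_rfl).mul
      ((((hR.measurable_y t).mul hpm).const_sub 1).ennreal_ofReal)
  have hB' : Measurable fun ω => Z₁ ω * ENNReal.ofReal (1 - F (p t ω, x t ω)) :=
    (hZ₁m.mono (hR.known_le t) le_rfl).mul
      (((hF'.comp (hpm.prodMk hxm)).const_sub 1).ennreal_ofReal)
  have step1 : ∫⁻ ω, Z ω * ENNReal.ofReal (Real.exp (l * centered A (runData x y p ω) (W ω) j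
        (revenueOn PX lam (cellCube j)) k t -
        l ^ 2 / 8 * increment (runData x y p ω) .count j k t)) ∂P ≤
      ∫⁻ ω, (Cᶜ.indicator Z ω + (Z₁ ω * ENNReal.ofReal (1 - y t ω * p t ω) +
        Z₁ ω * ENNReal.ofReal (Real.exp l) * ENNReal.ofReal (y t ω * p t ω))) ∂P := by
    refine lintegral_mono_ae ?_
    filter_upwards [hu] with ω hω
    by_cases hω' : ω ∈ C
    · have hω'' : cellOf (x t ω) = j := hω'
      have e1 : increment (runData x y p ω) .count j k t = 1 := by
        simp [increment, runData, hω'', hk]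
      have e2 : centered A (runData x y p ω) (W ω) j (revenueOn PX lam (cellCube j)) k t =
          y t ω * p t ω - γ ω := by
        simp [centered, increment, runData, hω'', hk, hγ, hρ]
      rw [e1, e2, hZ₁, Set.indicator_of_mem hω', Set.indicator_of_notMem (by simpa using hω'),
        zero_add, mul_assoc, mul_assoc (Z ω), mul_assoc (Z ω), ← mul_add]
      refine mul_le_mul_right ?_ _
      rw [hκ, mul_assoc, ← mul_add, ← ENNReal.ofReal_mul (Real.exp_pos _).le,
        ← ENNReal.ofReal_add (sub_nonneg.2 hω.2) (mul_nonneg (Real.exp_pos _).le hω.1),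
        ← ENNReal.ofReal_mul (Real.exp_pos _).le]
      refine ENNReal.ofReal_le_ofReal ?_
      have h := exp_mul_le_of_mem_Icc hω.1 hω.2 l
      calc _ = Real.exp (-(l * γ ω) - l ^ 2 / 8) * Real.exp (l * (y t ω * p t ω)) := by
            rw [← Real.exp_add]; ring_nf
        _ ≤ _ := by rw [mul_comm (Real.exp l)]; gcongr
    · have hω'' : ¬ cellOf (x t ω) = j := hω'
      have e1 : ∀ q, increment (runData x y p ω) q j k t = 0 := by
        intro q
        simp [increment, runData, hω'']
      rw [centered, e1, e1, hZ₁, Set.indicator_of_notMem hω', Set.indicator_of_mem hω']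
      simp
  have step2 : ∫⁻ ω, (Cᶜ.indicator Z ω + (Z₁ ω * ENNReal.ofReal (1 - y t ω * p t ω) +
        Z₁ ω * ENNReal.ofReal (Real.exp l) * ENNReal.ofReal (y t ω * p t ω))) ∂P =
      ∫⁻ ω, (Cᶜ.indicator Z ω + (Z₁ ω * ENNReal.ofReal (1 - F (p t ω, x t ω)) +
        Z₁ ω * ENNReal.ofReal (Real.exp l) * ENNReal.ofReal (F (p t ω, x t ω)))) ∂P := by
    rw [lintegral_add_left hA, lintegral_add_left hB, lintegral_add_left hA,
      lintegral_add_left hB',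
      lintegral_mul_condExp (v := fun ω => 1 - y t ω * p t ω) (hR.known_le t)
        ((integrable_const 1).sub hui)
        (hu.mono fun ω h => sub_nonneg.2 h.2) hce1 hZ₁m,
      lintegral_mul_condExp (hR.known_le t) hui (hu.mono fun ω h => h.1) hce hZ₂m]
  have step3 : ∫⁻ ω, (Cᶜ.indicator Z ω + (Z₁ ω * ENNReal.ofReal (1 - F (p t ω, x t ω)) +
        Z₁ ω * ENNReal.ofReal (Real.exp l) * ENNReal.ofReal (F (p t ω, x t ω)))) ∂P =
      ∫⁻ ω, Z ω * expBound F j l (ρ ω) (γ ω) (x t ω) ∂P := by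
    refine lintegral_congr fun ω => ?_
    by_cases hω' : ω ∈ C
    · have hω'' : cellOf (x t ω) = j := hω'
      have e1 : p t ω = ρ ω := by rw [hR.price_eq_rho ht hω'', hk]
      obtain ⟨f0, f1⟩ := hF.mem01 (ρ ω, x t ω)
      rw [e1, hZ₁, Set.indicator_of_mem hω', Set.indicator_of_notMem (by simpa using hω'), expBound,
        if_pos hω'', zero_add, mul_assoc, mul_assoc (Z ω), mul_assoc (Z ω), ← mul_add, hκ, mul_assoc,
        ← mul_add, ← ENNReal.ofReal_mul (Real.exp_pos _).le,
        ← ENNReal.ofReal_add (sub_nonneg.2 f1) (mul_nonneg (Real.exp_pos _).le f0),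
        ← ENNReal.ofReal_mul (Real.exp_pos _).le, mul_comm (Real.exp l)]
    · have hω'' : ¬ cellOf (x t ω) = j := hω'
      rw [hZ₁, Set.indicator_of_notMem hω', Set.indicator_of_mem hω', expBound, if_neg hω'']
      simp
  refine step1.trans (le_of_eq_of_le (step2.trans step3) ?_)
  have hφ : Measurable fun v : (ENNReal × ℝ × ℝ) × Ctx d =>
      v.1.1 * expBound F j l v.1.2.1 v.1.2.2 v.2 := by
    refine Measurable.mul (by fun_prop) ?_
    unfold expBound
    refine Measurable.ite ((measurable_cellOf.comp measurable_snd) (measurableSet_singleton j)) ?_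
      measurable_const
    have hFv : Measurable fun v : (ENNReal × ℝ × ℝ) × Ctx d => F (v.1.2.1, v.2) :=
      hF'.comp (by fun_prop)
    fun_prop
  have hY : Measurable[past x y W t] fun ω => (Z ω, ρ ω, γ ω) := hZ.prodMk (hρm.prodMk hγm)
  rw [hR.lintegral_past_context ht hY (φ := fun v => v.1.1 * expBound F j l v.1.2.1 v.1.2.2 v.2) hφ]
  refine lintegral_mono fun ω => ?_
  have hρmem : ρ ω ∈ Set.Icc A.pLo A.pHi := cellState_rho_mem hM.price_range.2.1.le _ _ _ _ _
  have hm2 : Measurable fun z => expBound F j l (ρ ω) (γ ω) z := by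
    unfold expBound
    refine Measurable.ite (measurable_cellOf (measurableSet_singleton j)) ?_ measurable_const
    have hFv : Measurable fun z : Ctx d => F (ρ ω, z) := hF'.comp (by fun_prop)
    fun_prop
  change ∫⁻ z, Z ω * expBound F j l (ρ ω) (γ ω) z ∂PX ≤ Z ω
  rw [lintegral_const_mul _ hm2]
  exact mul_le_of_le_one_right' (lintegral_expBound_le hM hF hq l hρmem)

/-- Lower tail of Bernoulli arrivals at rate one: `1 - e⁻¹ ≥ 1/2`, hence `1 - q (1 - e⁻¹) ≤ 1 - q/2
≤ e^(-q/2)`. This is why half of the expected arrivals are guaranteed. -/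
lemma exp_half_mul_le_one {q : ℝ} (h0 : 0 ≤ q) :
    q * Real.exp (q / 2 - 1) + (1 - q) * Real.exp (q / 2) ≤ 1 := by
  have he := Real.exp_neg_one_lt_d9
  have h1 : 1 - q * (1 - Real.exp (-1)) ≤ Real.exp (-(q / 2)) := by
    have := Real.add_one_le_exp (-(q / 2))
    nlinarith
  have e1 : Real.exp (q / 2 - 1) = Real.exp (q / 2) * Real.exp (-1) := by
    rw [← Real.exp_add]; ring_nf
  have e2 : Real.exp (q / 2) * Real.exp (-(q / 2)) = 1 := by rw [← Real.exp_add]; simp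
  have := mul_le_mul_of_nonneg_left h1 (Real.exp_pos (q / 2)).le
  rw [e2] at this
  rw [e1]
  linarith

lemma lintegral_exp_arrivals_le (hR : IsRun A PX lam P x y p W)
    (hM : Model A.pLo A.pHi CX CL σH CH Cp PX lam pstar) (j : Cell d m)
    (k : Fin 5) {t : ℕ} (ht : t ∈ Finset.Icc 1 A.T) {Z : Ω → ENNReal}
    (hZ : Measurable[past x y W t] Z) :
    ∫⁻ ω, Z ω * ENNReal.ofReal (Real.exp ((if priceIdx t = k then cellProb PX j / 2 else 0) -
      increment (runData x y p ω) .count j k t)) ∂P ≤ ∫⁻ ω, Z ω ∂P := by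
  classical
  by_cases hk : priceIdx t = k
  swap
  · simp [increment, hk]
  have := hM.prob
  set q := cellProb PX j
  set φ : ENNReal × Ctx d → ENNReal := fun v => v.1 *
    (if cellOf v.2 = j then ENNReal.ofReal (Real.exp (q / 2 - 1))
      else ENNReal.ofReal (Real.exp (q / 2))) with hφdef
  have hφ : Measurable φ := measurable_fst.mul
    (Measurable.ite ((measurable_cellOf.comp measurable_snd) (measurableSet_singleton j))
      measurable_const measurable_const)
  have e : ∀ ω, Z ω * ENNReal.ofReal (Real.exp ((if priceIdx t = k then q / 2 else 0) -
      increment (runData x y p ω) .count j k t)) = φ (Z ω, x t ω) := by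
    intro ω
    simp only [hφdef, increment, hk, if_true, and_true, runData]
    split_ifs <;> simp
  simp_rw [e]
  rw [hR.lintegral_past_context ht hZ hφ]
  refine lintegral_mono fun ω => ?_
  simp only [hφdef]
  have hm2 : Measurable fun z : Ctx d => if cellOf z = j then ENNReal.ofReal (Real.exp (q / 2 - 1))
      else ENNReal.ofReal (Real.exp (q / 2)) :=
    Measurable.ite (measurable_cellOf (measurableSet_singleton j)) measurable_const measurable_const
  rw [lintegral_const_mul _ hm2]
  refine mul_le_of_le_one_right' ?_
  rw [← lintegral_add_compl _ (measurableSet_cell j),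
    setLIntegral_congr_fun (f := fun z : Ctx d => if cellOf z = j then
      ENNReal.ofReal (Real.exp (q / 2 - 1)) else ENNReal.ofReal (Real.exp (q / 2)))
      (g := fun _ => ENNReal.ofReal (Real.exp (q / 2 - 1)))
      (measurableSet_cell j) fun z hz => if_pos hz,
    setLIntegral_congr_fun (f := fun z : Ctx d => if cellOf z = j then
      ENNReal.ofReal (Real.exp (q / 2 - 1)) else ENNReal.ofReal (Real.exp (q / 2)))
      (g := fun _ => ENNReal.ofReal (Real.exp (q / 2)))
      (measurableSet_cell j).compl fun z hz => if_neg hz,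
    setLIntegral_const, setLIntegral_const, measure_cell_compl hM, measure_cell_eq hM,
    ← ENNReal.ofReal_mul (Real.exp_pos _).le, ← ENNReal.ofReal_mul (Real.exp_pos _).le,
    ← ENNReal.ofReal_add (mul_nonneg (Real.exp_pos _).le (cellProb_nonneg PX j))
      (mul_nonneg (Real.exp_pos _).le (sub_nonneg.2 (cellProb_le_one hM j)))]
  rw [← ENNReal.ofReal_one]
  refine ENNReal.ofReal_le_ofReal ?_
  have := exp_half_mul_le_one (cellProb_nonneg PX j)
  change Real.exp (q / 2 - 1) * q + Real.exp (q / 2) * (1 - q) ≤ 1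
  linarith

/-- Exponential tail bound for sums with a supermartingale property. -/
lemma measure_sum_ge_le (hR : IsRun A PX lam P x y p W) {V : ℕ → Ω → ℝ}
    (hmeas : ∀ τ ∈ Finset.Icc 1 A.T, Measurable[past x y W (τ + 1)] (V τ))
    (hV : ∀ τ ∈ Finset.Icc 1 A.T, ∀ Z : Ω → ENNReal, Measurable[past x y W τ] Z →
      ∫⁻ ω, Z ω * ENNReal.ofReal (Real.exp (V τ ω)) ∂P ≤ ∫⁻ ω, Z ω ∂P) {ς t : ℕ} (hςt : ς ≤ t)
    (ht : t ≤ A.T) (a : ℝ) :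
    P {ω | a ≤ ∑ τ ∈ Finset.Ioc ς t, V τ ω} ≤ ENNReal.ofReal (Real.exp (-a)) := by
  have h1 := hR.lintegral_prod_le_one (G := fun τ ω => ENNReal.ofReal (Real.exp (V τ ω)))
    (fun τ hτ => ((hmeas τ hτ).exp).ennreal_ofReal) hV hςt ht
  have hm : Measurable fun ω => ∏ τ ∈ Finset.Ioc ς t, ENNReal.ofReal (Real.exp (V τ ω)) := by
    refine Finset.measurable_prod _ fun τ hτ => ?_
    rw [Finset.mem_Ioc] at hτ
    exact (((hmeas τ (Finset.mem_Icc.2 ⟨by omega, by omega⟩)).mono (hR.past_le _) le_rfl).exp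
      ).ennreal_ofReal
  have h2 := mul_meas_ge_le_lintegral (μ := P) hm (ENNReal.ofReal (Real.exp a))
  have hset : {ω | a ≤ ∑ τ ∈ Finset.Ioc ς t, V τ ω} ⊆ {ω | ENNReal.ofReal (Real.exp a) ≤
      ∏ τ ∈ Finset.Ioc ς t, ENNReal.ofReal (Real.exp (V τ ω))} := by
    intro ω hω
    have hω' : a ≤ ∑ τ ∈ Finset.Ioc ς t, V τ ω := hω
    change _ ≤ ∏ τ ∈ Finset.Ioc ς t, ENNReal.ofReal (Real.exp (V τ ω))
    rw [← ENNReal.ofReal_prod_of_nonneg fun _ _ => (Real.exp_pos _).le, ← Real.exp_sum]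
    gcongr
  have h3 := (mul_le_mul_right (measure_mono (μ := P) hset)
    (ENNReal.ofReal (Real.exp a))).trans (h2.trans h1)
  rw [Real.exp_neg, ENNReal.ofReal_inv_of_pos (Real.exp_pos _), ← one_div,
    ENNReal.le_div_iff_mul_le (by simp [Real.exp_pos]) (by simp), mul_comm]
  exact h3

end IsRun

end Supermartingale

/-! ### Good paths have high probability -/

lemma measure_biUnion_le_card_mul {ι Ω : Type*} [MeasurableSpace Ω] {P : Measure Ω} (I : Finset ι)
    (E : ι → Set Ω) {c : ℝ} (h : ∀ i ∈ I, P (E i) ≤ ENNReal.ofReal c) :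
    P (⋃ i ∈ I, E i) ≤ ENNReal.ofReal (I.card * c) := by
  refine (measure_biUnion_finset_le I E).trans ((Finset.sum_le_sum h).trans (le_of_eq ?_))
  rw [Finset.sum_const, nsmul_eq_mul, ENNReal.ofReal_mul (by positivity), ENNReal.ofReal_natCast]

section Good

variable {d m : ℕ} [NeZero m] {A : Params} {CX CL σH CH Cp : ℝ} {PX : Measure (Ctx d)}
  {lam : ℝ → Ctx d → ℝ} {pstar : Ctx d → ℝ}
  {Ω : Type*} [mΩ : MeasurableSpace Ω] {P : Measure Ω} {x : ℕ → Ω → Ctx d} {y p : ℕ → Ω → ℝ}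
  {W : Ω → Noise d m A.T}

lemma exactDiff_count (s : ℕ → Obs d) (j : Cell d m) (k : Fin 5) (ς t : ℕ) :
    exactDiff s .count j k ς t =
      ((Finset.Ioc ς t).filter fun τ => cellOf (s τ).x = j ∧ priceIdx τ = k).card := by
  unfold exactDiff increment
  rw [Finset.sum_ite, Finset.sum_const_zero, add_zero, Finset.sum_const, nsmul_eq_mul, mul_one]

lemma sum_centered_eq_zero {s : ℕ → Obs d} {W : Noise d m A.T} {j : Cell d m} {g : ℝ → ℝ}
    {k : Fin 5} {ς t : ℕ}
    (h : ((Finset.Ioc ς t).filter fun τ => cellOf (s τ).x = j ∧ priceIdx τ = k).card = 0) :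
    ∑ τ ∈ Finset.Ioc ς t, centered A s W j g k τ = 0 := by
  rw [Finset.card_eq_zero, Finset.filter_eq_empty_iff] at h
  refine Finset.sum_eq_zero fun τ hτ => ?_
  rw [centered, increment, increment, if_neg (h hτ), if_neg (h hτ), zero_mul, sub_zero]

namespace IsRun

lemma measure_noiseSum_ge_le (hR : IsRun A PX lam P x y p W) (hε : 0 < A.ε) (hT : 1 ≤ A.T) {t : ℕ}
    (ht : t ≤ A.T) (q : StatKind) (j : Cell d m) (k : Fin 5) :
    P {ω | 2 * treeScale (A.ε / 2) A.T * Real.log (2 * (A.T : ℝ) ^ 3) ≤ noiseSum (W ω) q j k t} ≤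
      ENNReal.ofReal (1 / (A.T : ℝ) ^ 2) := by
  refine le_trans ?_ (noiseSum_tail hε ht hT q j k)
  rw [← hR.noise_law]
  exact Measure.le_map_apply hR.measurable_W.aemeasurable _

lemma measurable_centered (hR : IsRun A PX lam P x y p W)
    (hM : Model A.pLo A.pHi CX CL σH CH Cp PX lam pstar) {j : Cell d m} (hq : 0 < cellProb PX j)
    (k : Fin 5) {τ : ℕ} (hτ : τ ∈ Finset.Icc 1 A.T) :
    Measurable[past x y W (τ + 1)] fun ω => centered A (runData x y p ω) (W ω) j
      (revenueOn PX lam (cellCube j)) k τ :=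
  (hR.measurable_increment hτ _ j k).sub ((hR.measurable_increment hτ _ j k).mul
    ((hR.measurable_revenueOn_rho hM hq hτ k).mono (past_mono (by omega)) le_rfl))

/-- The best rate depends on the random number of samples, so the count is fixed to `N` in the
event. With `l = 4 c₁/√N` the exponent is `l c₁ √N - l² N / 8 = 2 c₁²`; the sign `θ` covers both
tails. -/
lemma measure_sum_centered_gt_le (hR : IsRun A PX lam P x y p W)
    (hM : Model A.pLo A.pHi CX CL σH CH Cp PX lam pstar) {j : Cell d m} (hq : 0 < cellProb PX j)
    (hc1 : 0 < A.c1) (k : Fin 5) {ς t N : ℕ} (hςt : ς ≤ t) (ht : t ≤ A.T) (hN : 1 ≤ N) {θ : ℝ}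
    (hθ : θ ^ 2 = 1) :
    P {ω | exactDiff (runData x y p ω) .count j k ς t = N ∧ A.c1 * Real.sqrt N <
      θ * ∑ τ ∈ Finset.Ioc ς t, centered A (runData x y p ω) (W ω) j
        (revenueOn PX lam (cellCube j)) k τ} ≤ ENNReal.ofReal (Real.exp (-(2 * A.c1 ^ 2))) := by
  have hN0 : (0 : ℝ) < N := by exact_mod_cast hN
  have hsq : 0 < Real.sqrt N := Real.sqrt_pos.2 hN0
  set l : ℝ := θ * (4 * A.c1 / Real.sqrt N) with hl
  refine le_trans (measure_mono ?_) (hR.measure_sum_ge_le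
    (V := fun τ ω => l * centered A (runData x y p ω) (W ω) j (revenueOn PX lam (cellCube j)) k τ -
      l ^ 2 / 8 * increment (runData x y p ω) .count j k τ)
    (fun τ hτ => ((hR.measurable_centered hM hq k hτ).const_mul l).sub
      ((hR.measurable_increment hτ _ j k).const_mul _))
    (fun τ hτ Z hZ => hR.lintegral_exp_centered_le hM hq k l hτ hZ) hςt ht _)
  rintro ω ⟨h1, h2⟩
  change _ ≤ ∑ τ ∈ Finset.Ioc ς t, (l * centered A (runData x y p ω) (W ω) j
    (revenueOn PX lam (cellCube j)) k τ - l ^ 2 / 8 * increment (runData x y p ω) .count j k τ)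
  rw [Finset.sum_sub_distrib, ← Finset.mul_sum, ← Finset.mul_sum]
  unfold exactDiff at h1
  rw [h1]
  set M := ∑ τ ∈ Finset.Ioc ς t, centered A (runData x y p ω) (W ω) j
    (revenueOn PX lam (cellCube j)) k τ
  have e1 : l * M = 4 * A.c1 / Real.sqrt N * (θ * M) := by rw [hl]; ring
  have e2 : l ^ 2 / 8 * (N : ℝ) = 2 * A.c1 ^ 2 := by
    rw [hl, mul_pow, hθ, div_pow, Real.sq_sqrt hN0.le]
    field_simp
    norm_num
  have e3 : 4 * A.c1 / Real.sqrt N * (A.c1 * Real.sqrt N) = 4 * A.c1 ^ 2 := by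
    field_simp
  have e4 := mul_le_mul_of_nonneg_left h2.le (show 0 ≤ 4 * A.c1 / Real.sqrt N by positivity)
  rw [e1, e2]
  linarith

lemma measure_arrivals_lt_le (hR : IsRun A PX lam P x y p W)
    (hM : Model A.pLo A.pHi CX CL σH CH Cp PX lam pstar) (j : Cell d m) (Λ : ℝ)
    (k : Fin 5) {ς t : ℕ} (hςt : ς ≤ t) (ht : t ≤ A.T) :
    P {ω | exactDiff (runData x y p ω) .count j k ς t <
      cellProb PX j / 2 * ((Finset.Ioc ς t).filter fun τ => priceIdx τ = k).card - Λ} ≤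
      ENNReal.ofReal (Real.exp (-Λ)) := by
  refine le_trans (measure_mono ?_) (hR.measure_sum_ge_le
    (V := fun τ ω => (if priceIdx τ = k then cellProb PX j / 2 else 0) -
      increment (runData x y p ω) .count j k τ)
    (fun τ hτ => (hR.measurable_increment hτ _ j k).const_sub _)
    (fun τ hτ Z hZ => hR.lintegral_exp_arrivals_le hM j k hτ hZ) hςt ht _)
  intro ω hω
  have hω' : exactDiff (runData x y p ω) .count j k ς t <
      cellProb PX j / 2 * ((Finset.Ioc ς t).filter fun τ => priceIdx τ = k).card - Λ := hω
  change Λ ≤ ∑ τ ∈ Finset.Ioc ς t, ((if priceIdx τ = k then cellProb PX j / 2 else 0) -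
    increment (runData x y p ω) .count j k τ)
  rw [Finset.sum_sub_distrib, ← Finset.sum_filter, Finset.sum_const, nsmul_eq_mul]
  unfold exactDiff at hω'
  linarith

/-- The paths that are not good for cell `j` have probability at most `30 / T`. -/
theorem measure_not_goodPath_le (hR : IsRun A PX lam P x y p W)
    (hM : Model A.pLo A.pHi CX CL σH CH Cp PX lam pstar) {j : Cell d m} (hq : 0 < cellProb PX j)
    (hε : 0 < A.ε) (hT : 1 ≤ A.T) (hc1 : 0 < A.c1) {Λ e : ℝ}
    (hΛ : Λ = Real.log (2 * (A.T : ℝ) ^ 3)) (hcΛ : A.c1 ^ 2 = Λ)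
    (he : 2 * treeScale (A.ε / 2) A.T * Λ ≤ e / 2) (he0 : 0 < e) :
    P {ω | ¬ GoodPath A (runData x y p ω) (W ω) j (revenueOn PX lam (cellCube j))
      (cellProb PX j) Λ e} ≤ ENNReal.ofReal (30 / A.T) := by
  have hT1 : (1 : ℝ) ≤ A.T := by exact_mod_cast hT
  have hT0 : (0 : ℝ) < A.T := by linarith
  set EN : StatKind × Fin 5 × ℕ → Set Ω := fun i =>
    {ω | 2 * treeScale (A.ε / 2) A.T * Λ ≤ noiseSum (W ω) i.1 j i.2.1 i.2.2} with hEN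
  set IN : Finset (StatKind × Fin 5 × ℕ) := Finset.univ ×ˢ Finset.univ ×ˢ Finset.Icc 1 A.T with hIN
  set sg : Bool → ℝ := fun b => if b = true then 1 else -1 with hsg
  -- Both the interval and the number of samples in it are random, so the union runs over all their
  -- values and both signs.
  set ER : Fin 5 × ℕ × ℕ × ℕ × Bool → Set Ω := fun i =>
    {ω | i.2.1 ≤ i.2.2.1 ∧ exactDiff (runData x y p ω) .count j i.1 i.2.1 i.2.2.1 = i.2.2.2.1 ∧
      A.c1 * Real.sqrt i.2.2.2.1 < sg i.2.2.2.2 * ∑ τ ∈ Finset.Ioc i.2.1 i.2.2.1,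
        centered A (runData x y p ω) (W ω) j (revenueOn PX lam (cellCube j)) i.1 τ} with hER
  set IR : Finset (Fin 5 × ℕ × ℕ × ℕ × Bool) := Finset.univ ×ˢ Finset.range (A.T + 1) ×ˢ
    Finset.range (A.T + 1) ×ˢ Finset.Icc 1 A.T ×ˢ Finset.univ with hIR
  set EA : Fin 5 × ℕ × ℕ → Set Ω := fun i =>
    {ω | i.2.1 ≤ i.2.2 ∧ exactDiff (runData x y p ω) .count j i.1 i.2.1 i.2.2 <
      cellProb PX j / 2 * ((Finset.Ioc i.2.1 i.2.2).filter fun τ => priceIdx τ = i.1).card - Λ}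
    with hEA
  set IA : Finset (Fin 5 × ℕ × ℕ) := Finset.univ ×ˢ Finset.range (A.T + 1) ×ˢ
    Finset.range (A.T + 1) with hIA
  have hsub : {ω | ¬ GoodPath A (runData x y p ω) (W ω) j (revenueOn PX lam (cellCube j))
      (cellProb PX j) Λ e} ⊆ (⋃ i ∈ IN, EN i) ∪ ((⋃ i ∈ IR, ER i) ∪ ⋃ i ∈ IA, EA i) := by
    intro ω hω
    by_contra hcon
    simp only [Set.mem_union, not_or, Set.mem_iUnion, not_exists] at hcon
    obtain ⟨h1, h2, h3⟩ := hcon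
    refine hω ⟨?_, ?_, ?_⟩
    · intro i k t ht
      obtain ⟨τ, hτ, h⟩ := exists_abs_stat_sub_le (runData x y p ω) (W ω) i j k ht
      refine h.trans ?_
      rcases Nat.eq_zero_or_pos τ with rfl | hτ0
      · rw [noiseSum_zero]; linarith
      · have := h1 (i, k, τ) (by simp [hIN]; omega)
        have h4 : ¬ (2 * treeScale (A.ε / 2) A.T * Λ ≤ noiseSum (W ω) i j k τ) := this
        linarith
    · intro k t ht ς hς
      rw [exactDiff_count]
      set N := ((Finset.Ioc ς t).filter fun τ => cellOf (runData x y p ω τ).x = j ∧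
        priceIdx τ = k).card with hN
      rcases Nat.eq_zero_or_pos N with h0 | h0
      · rw [sum_centered_eq_zero h0, h0]
        simp
      · have hNT : N ≤ A.T := by
          refine (Finset.card_filter_le _ _).trans ?_
          rw [Nat.card_Ioc]
          omega
        have hmem : ∀ b, (k, ς, t, N, b) ∈ IR := fun b => by simp [hIR]; omega
        have hdiff : exactDiff (runData x y p ω) .count j k ς t = N := exactDiff_count _ _ _ _ _
        have ha := h2 _ (hmem true)
        have hb := h2 _ (hmem false)
        rw [abs_le]
        constructor
        · by_contra! hlt
          refine hb ⟨hς, hdiff, ?_⟩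
          simp only [hsg]
          norm_num
          linarith
        · by_contra! hlt
          refine ha ⟨hς, hdiff, ?_⟩
          simp only [hsg, if_true, one_mul]
          exact hlt
    · intro k t ht ς hς
      by_contra! hlt
      exact h3 (k, ς, t) (by simp [hIA]; omega) ⟨hς, hlt⟩
  have hNb : P (⋃ i ∈ IN, EN i) ≤ ENNReal.ofReal (10 / A.T) := by
    refine (measure_biUnion_le_card_mul IN EN (c := 1 / (A.T : ℝ) ^ 2) ?_).trans (le_of_eq ?_)
    · rintro ⟨i, k, τ⟩ hi
      simp only [hIN, Finset.mem_product, Finset.mem_univ, true_and, Finset.mem_Icc] at hi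
      simp only [hEN, hΛ]
      exact hR.measure_noiseSum_ge_le hε hT hi.2 i j k
    · have hu : (Finset.univ : Finset StatKind).card = 2 := by
        have : (Finset.univ : Finset StatKind) = {.revenue, .count} := by
          ext q; cases q <;> simp
        rw [this]; simp
      rw [hIN, Finset.card_product, Finset.card_product, hu, Finset.card_univ, Fintype.card_fin,
        Nat.card_Icc]
      congr 1
      push_cast [Nat.add_sub_cancel]
      field_simp
      norm_num
  have hexp : Real.exp (-Λ) = (2 * (A.T : ℝ) ^ 3)⁻¹ := by
    rw [hΛ, Real.exp_neg, Real.exp_log (by positivity)]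
  have hT2 : ((A.T : ℝ) + 1) ^ 2 ≤ 4 * (A.T : ℝ) ^ 2 := by nlinarith
  have hRb : P (⋃ i ∈ IR, ER i) ≤ ENNReal.ofReal (10 / A.T) := by
    refine (measure_biUnion_le_card_mul IR ER (c := Real.exp (-(2 * A.c1 ^ 2))) ?_).trans
      (ENNReal.ofReal_le_ofReal ?_)
    · rintro ⟨k, ς, t, N, b⟩ hi
      simp only [hIR, Finset.mem_product, Finset.mem_univ, true_and, and_true, Finset.mem_Icc,
        Finset.mem_range] at hi
      by_cases hςt : ς ≤ t
      · refine (measure_mono ?_).trans (hR.measure_sum_centered_gt_le hM hq hc1 k hςt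
          (show t ≤ A.T by omega) hi.2.2.1 (θ := sg b) (by cases b <;> simp [hsg]))
        rintro ω ⟨-, h⟩
        exact h
      · have : ER (k, ς, t, N, b) = ∅ := by
          ext ω
          simp only [hER, Set.mem_empty_iff_false, iff_false]
          rintro ⟨h, -⟩
          exact hςt h
        rw [this, measure_empty]
        exact zero_le
    -- About `10 T³` events, each of probability at most `e^(-2Λ) = 1 / (4 T⁶)`.
    · have e1 : Real.exp (-(2 * A.c1 ^ 2)) = ((2 * (A.T : ℝ) ^ 3)⁻¹) ^ 2 := by
        rw [← hexp, ← Real.exp_nat_mul, hcΛ]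
        congr 1
        push_cast; ring
      rw [e1, hIR]
      simp only [Finset.card_product, Finset.card_univ, Fintype.card_fin, Nat.card_Icc,
        Finset.card_range, Fintype.card_bool]
      push_cast [Nat.add_sub_cancel]
      calc (5 * (((A.T : ℝ) + 1) * ((A.T + 1) * (A.T * 2)))) * ((2 * (A.T : ℝ) ^ 3)⁻¹) ^ 2 =
            (10 * A.T * ((A.T : ℝ) + 1) ^ 2) * ((2 * (A.T : ℝ) ^ 3)⁻¹) ^ 2 := by ring
        _ ≤ (10 * A.T * (4 * (A.T : ℝ) ^ 2)) * ((2 * (A.T : ℝ) ^ 3)⁻¹) ^ 2 := by gcongr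
        _ = 10 / (A.T : ℝ) ^ 3 := by field_simp; norm_num
        _ ≤ 10 / A.T := by
          gcongr
          exact le_self_pow₀ hT1 (by norm_num)
  have hAb : P (⋃ i ∈ IA, EA i) ≤ ENNReal.ofReal (10 / A.T) := by
    refine (measure_biUnion_le_card_mul IA EA (c := Real.exp (-Λ)) ?_).trans
      (ENNReal.ofReal_le_ofReal ?_)
    · rintro ⟨k, ς, t⟩ hi
      simp only [hIA, Finset.mem_product, Finset.mem_univ, true_and, Finset.mem_range] at hi
      by_cases hςt : ς ≤ t
      · refine (measure_mono ?_).trans (hR.measure_arrivals_lt_le hM j Λ k hςt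
          (show t ≤ A.T by omega))
        rintro ω ⟨-, h⟩
        exact h
      · have : EA (k, ς, t) = ∅ := by
          ext ω
          simp only [hEA, Set.mem_empty_iff_false, iff_false]
          rintro ⟨h, -⟩
          exact hςt h
        rw [this, measure_empty]
        exact zero_le
    · rw [hexp, hIA]
      simp only [Finset.card_product, Finset.card_univ, Fintype.card_fin, Finset.card_range]
      push_cast
      calc (5 * (((A.T : ℝ) + 1) * (A.T + 1))) * (2 * (A.T : ℝ) ^ 3)⁻¹ =
            (5 * ((A.T : ℝ) + 1) ^ 2) * (2 * (A.T : ℝ) ^ 3)⁻¹ := by ring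
        _ ≤ (5 * (4 * (A.T : ℝ) ^ 2)) * (2 * (A.T : ℝ) ^ 3)⁻¹ := by gcongr
        _ = 10 / A.T := by field_simp; norm_num
  refine (measure_mono hsub).trans ((measure_union_le _ _).trans ?_)
  refine (add_le_add hNb ((measure_union_le _ _).trans (add_le_add hRb hAb))).trans (le_of_eq ?_)
  rw [← ENNReal.ofReal_add (by positivity) (by positivity),
    ← ENNReal.ofReal_add (by positivity) (by positivity)]
  congr 1
  ring

end IsRun

end Good

/-! ### Expected regret as a sum over the cells -/

/-- A continuous function that agrees with the optimal revenue on the context domain. -/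
structure IsBestExtension {d : ℕ} (lam : ℝ → Ctx d → ℝ) (pstar : Ctx d → ℝ) (G : Ctx d → ℝ) :
    Prop where
  cont : Continuous G
  eq : ∀ x ∈ unitCube d, G x = revenue lam (pstar x) x

/-- No measurability of `pstar` is assumed, but the maximum of `f(·, x)` inherits the Lipschitz
bound in `x`. -/
lemma Model.exists_isBestExtension {d : ℕ} {pLo pHi CX CL σH CH Cp : ℝ} {PX : Measure (Ctx d)}
    {lam : ℝ → Ctx d → ℝ} {pstar : Ctx d → ℝ}
    (hM : Model pLo pHi CX CL σH CH Cp PX lam pstar) : ∃ G, IsBestExtension lam pstar G := by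
  have hCL := hM.CL_nonneg
  have hle : ∀ x ∈ unitCube d, ∀ x' ∈ unitCube d,
      revenue lam (pstar x) x ≤ revenue lam (pstar x') x' + CL * ‖x - x'‖ := by
    intro x hx x' hx'
    have h1 := hM.lipschitz _ (hM.pstar_mem x hx) _ (hM.pstar_mem x hx) x hx x' hx'
    rw [sub_self, abs_zero, zero_add] at h1
    have h2 : revenue lam (pstar x) x' ≤ revenue lam (pstar x') x' :=
      hM.pstar_max x' hx' (hM.pstar_mem x hx)
    have h3 := (abs_le.1 h1).2
    linarith
  have hlip : LipschitzOnWith (Real.toNNReal CL) (fun x => revenue lam (pstar x) x)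
      (unitCube d) := by
    refine LipschitzOnWith.of_dist_le_mul fun x hx x' hx' => ?_
    rw [Real.dist_eq, Real.coe_toNNReal _ hCL, dist_eq_norm, abs_le]
    have h1 := hle x hx x' hx'
    have h2 := hle x' hx' x hx
    rw [norm_sub_rev] at h2
    constructor <;> linarith
  obtain ⟨G, hG, heq⟩ := hlip.extend_real
  exact ⟨G, hG.continuous, fun x hx => (heq hx).symm⟩

section Decomposition

variable {d m : ℕ} [NeZero m] {pLo pHi CX CL σH CH Cp : ℝ} {PX : Measure (Ctx d)}
  {lam : ℝ → Ctx d → ℝ} {pstar : Ctx d → ℝ} {F : ℝ × Ctx d → ℝ} {G : Ctx d → ℝ}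

lemma sum_cellProb (hM : Model pLo pHi CX CL σH CH Cp PX lam pstar) :
    ∑ j : Cell d m, cellProb PX j = 1 := by
  have := hM.prob
  have h := sum_measureReal_preimage_singleton (μ := PX) (f := (cellOf : Ctx d → Cell d m))
    Finset.univ fun j _ => measurableSet_cell j
  exact h.trans (by simp)

lemma best_sub_mem (hM : Model pLo pHi CX CL σH CH Cp PX lam pstar)
    (hF : IsExtension pLo pHi lam F) (hG : IsBestExtension lam pstar G) {p : ℝ}
    (hp : p ∈ Set.Icc pLo pHi) {z : Ctx d} (hz : z ∈ unitCube d) :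
    G z - F (p, z) ∈ Set.Icc (0 : ℝ) 1 := by
  have h1 : revenue lam p z ≤ revenue lam (pstar z) z := hM.pstar_max z hz hp
  have h2 := hM.revenue_mem (hM.pstar_mem z hz) hz
  have h3 := hM.revenue_mem hp hz
  rw [hG.eq z hz, hF.eq p hp z hz]
  exact ⟨by linarith, by linarith [h2.2, h3.1]⟩

lemma setLIntegral_cell_le (hM : Model pLo pHi CX CL σH CH Cp PX lam pstar)
    (hF : IsExtension pLo pHi lam F) (hG : IsBestExtension lam pstar G) {j : Cell d m}
    (hq : 0 < cellProb PX j) {c p δ : ℝ} (hc : c ∈ Set.Icc pLo pHi) (hp : p ∈ Set.Icc pLo pHi)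
    (hδ : ∀ᵐ z ∂PX, cellOf z = j → G z ≤ F (c, z) + δ) :
    ∫⁻ z in {z | cellOf z = j}, ENNReal.ofReal (G z - F (p, z)) ∂PX ≤
      ENNReal.ofReal (cellProb PX j * (revenueOn PX lam (cellCube j) c -
        revenueOn PX lam (cellCube j) p) + cellProb PX j * δ) := by
  have := hM.prob
  set S : Set (Ctx d) := {z | cellOf z = j} with hS
  have hFi := fun p => Model.integrable_extension hF (PX.restrict S) p
  have hmem : ∀ᵐ z ∂PX.restrict S, G z - F (p, z) ∈ Set.Icc (0 : ℝ) 1 :=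
    ae_restrict_of_ae (hM.ae_mem_unitCube.mono fun z hz => best_sub_mem hM hF hG hp hz)
  have hint : Integrable (fun z => G z - F (p, z)) (PX.restrict S) := by
    have h1 := hF.cont
    have h2 := hG.cont
    exact Integrable.of_mem_Icc 0 1 (by fun_prop) hmem
  have hint2 : Integrable (fun z => F (c, z) - F (p, z) + δ) (PX.restrict S) :=
    ((hFi c).sub (hFi p)).add (integrable_const δ)
  rw [← ofReal_integral_eq_lintegral_ofReal hint (hmem.mono fun z hz => hz.1)]
  refine ENNReal.ofReal_le_ofReal ((integral_mono_ae hint hint2 ?_).trans (le_of_eq ?_))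
  · filter_upwards [ae_restrict_of_ae hδ, ae_restrict_mem (measurableSet_cell j)] with z h1 h2
    have := h1 h2
    linarith
  · have hFs : Integrable (fun z => F (c, z) - F (p, z)) (PX.restrict S) := (hFi c).sub (hFi p)
    rw [integral_add hFs (integrable_const δ), integral_sub (hFi c) (hFi p),
      setIntegral_cell hM hF hq hc, setIntegral_cell hM hF hq hp, setIntegral_const, smul_eq_mul,
      mul_sub]
    rfl

end Decomposition

lemma sum_Icc_one_eq_sum_range {M : Type*} [AddCommMonoid M] (f : ℕ → M) (n : ℕ) :
    ∑ t ∈ Finset.Icc 1 n, f t = ∑ t ∈ Finset.range n, f (t + 1) := by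
  induction n with
  | zero => simp
  | succ n ih => rw [Finset.sum_Icc_succ_top (by omega), ih, Finset.sum_range_succ]

section Regret

variable {d m : ℕ} [NeZero m] {A : Params} {CX CL σH CH Cp : ℝ} {PX : Measure (Ctx d)}
  {lam : ℝ → Ctx d → ℝ} {pstar : Ctx d → ℝ} {F : ℝ × Ctx d → ℝ} {G : Ctx d → ℝ}
  {Ω : Type*} [mΩ : MeasurableSpace Ω] {P : Measure Ω} {x : ℕ → Ω → Ctx d} {y p : ℕ → Ω → ℝ}
  {W : Ω → Noise d m A.T}

/-- The expected loss of averaged revenue on cell `j`, summed over all periods, of the prices that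
the algorithm keeps for that cell. -/
def cellLoss (A : Params) (PX : Measure (Ctx d)) (lam : ℝ → Ctx d → ℝ) (s : ℕ → Obs d)
    (w : Noise d m A.T) (j : Cell d m) (c : ℝ) : ℝ :=
  ∑ t ∈ Finset.range A.T, cellProb PX j * (revenueOn PX lam (cellCube j) c -
    revenueOn PX lam (cellCube j) ((cellState A s w j t).rho (priceIdx (t + 1))))

lemma cellLoss_term_mem (hM : Model A.pLo A.pHi CX CL σH CH Cp PX lam pstar) {j : Cell d m}
    (hq : 0 < cellProb PX j) {c : ℝ}
    (hc : Curved A.pLo A.pHi σH CH c (revenueOn PX lam (cellCube j))) {u : ℝ}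
    (hu : u ∈ Set.Icc A.pLo A.pHi) :
    revenueOn PX lam (cellCube j) c - revenueOn PX lam (cellCube j) u ∈ Set.Icc (0 : ℝ) 1 := by
  have hB := measure_cellCube_ne_zero hM hq
  have h1 := hM.revenueOn_mem (measurableSet_cellCube j) (cellCube_subset j) hB
    (Set.Ioo_subset_Icc_self hc.mem)
  have h2 := hM.revenueOn_mem (measurableSet_cellCube j) (cellCube_subset j) hB hu
  have h3 : revenueOn PX lam (cellCube j) u ≤ revenueOn PX lam (cellCube j) c := hc.isMax hu
  exact ⟨by linarith, by linarith [h1.2, h2.1]⟩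

namespace IsRun

lemma measurable_price (hR : IsRun A PX lam P x y p W) {t : ℕ} (ht : t ∈ Finset.Icc 1 A.T) :
    Measurable (p t) := (hR.measurable_p ht).mono (hR.known_le t) le_rfl

lemma measurable_loss (hR : IsRun A PX lam P x y p W) (hF : IsExtension A.pLo A.pHi lam F)
    (hG : IsBestExtension lam pstar G) {t : ℕ} (ht : t ∈ Finset.Icc 1 A.T) :
    Measurable fun ω => G (x t ω) - F (p t ω, x t ω) :=
  (hG.cont.measurable.comp (hR.measurable_x t)).sub
    (hF.cont.measurable.comp ((hR.measurable_price ht).prodMk (hR.measurable_x t)))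

lemma regret_ae_eq (hR : IsRun A PX lam P x y p W)
    (hM : Model A.pLo A.pHi CX CL σH CH Cp PX lam pstar) (hF : IsExtension A.pLo A.pHi lam F)
    (hG : IsBestExtension lam pstar G) :
    ∀ᵐ ω ∂P, (∀ t ∈ Finset.Icc 1 A.T, G (x t ω) - F (p t ω, x t ω) ∈ Set.Icc (0 : ℝ) 1) ∧
      regret A.T lam pstar x p ω = ∑ t ∈ Finset.Icc 1 A.T, (G (x t ω) - F (p t ω, x t ω)) := by
  have h : ∀ᵐ ω ∂P, ∀ t, t ∈ Finset.Icc 1 A.T → x t ω ∈ unitCube d := by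
    rw [ae_all_iff]
    intro t
    by_cases ht : t ∈ Finset.Icc 1 A.T
    · filter_upwards [hR.ae_context ht hM.ae_mem_unitCube] with ω hω _ using hω
    · exact Filter.Eventually.of_forall fun ω h => absurd h ht
  filter_upwards [h] with ω hω
  refine ⟨fun t ht => best_sub_mem hM hF hG (hR.price_mem hM ht ω) (hω t ht), ?_⟩
  refine Finset.sum_congr rfl fun t ht => ?_
  rw [hG.eq _ (hω t ht), hF.eq _ (hR.price_mem hM ht ω) _ (hω t ht)]

lemma regret_mem (hR : IsRun A PX lam P x y p W)
    (hM : Model A.pLo A.pHi CX CL σH CH Cp PX lam pstar) :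
    ∀ᵐ ω ∂P, regret A.T lam pstar x p ω ∈ Set.Icc (0 : ℝ) A.T := by
  obtain ⟨F, hF⟩ := hM.exists_isExtension
  obtain ⟨G, hG⟩ := hM.exists_isBestExtension
  filter_upwards [hR.regret_ae_eq hM hF hG] with ω hω
  rw [hω.2]
  refine ⟨Finset.sum_nonneg fun t ht => (hω.1 t ht).1, ?_⟩
  refine (Finset.sum_le_sum fun t ht => (hω.1 t ht).2).trans ?_
  simp

lemma integrable_regret (hR : IsRun A PX lam P x y p W)
    (hM : Model A.pLo A.pHi CX CL σH CH Cp PX lam pstar) :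
    Integrable (regret A.T lam pstar x p) P := by
  have := hR.prob
  obtain ⟨F, hF⟩ := hM.exists_isExtension
  obtain ⟨G, hG⟩ := hM.exists_isBestExtension
  refine Integrable.of_mem_Icc 0 A.T ?_ (hR.regret_mem hM)
  refine AEMeasurable.congr (Finset.measurable_sum _ fun t ht =>
    hR.measurable_loss hF hG ht).aemeasurable ((hR.regret_ae_eq hM hF hG).mono fun ω hω => hω.2.symm)

lemma integral_regret_le_horizon (hR : IsRun A PX lam P x y p W)
    (hM : Model A.pLo A.pHi CX CL σH CH Cp PX lam pstar) :
    ∫ ω, regret A.T lam pstar x p ω ∂P ≤ A.T := by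
  have := hR.prob
  refine (integral_mono_ae (hR.integrable_regret hM) (integrable_const (A.T : ℝ))
    ((hR.regret_mem hM).mono fun ω h => h.2)).trans (le_of_eq ?_)
  simp

/-- The loss of one period on one cell, in terms of the averaged revenue. -/
lemma setLIntegral_loss_le (hR : IsRun A PX lam P x y p W)
    (hM : Model A.pLo A.pHi CX CL σH CH Cp PX lam pstar) (hF : IsExtension A.pLo A.pHi lam F)
    (hG : IsBestExtension lam pstar G) {j : Cell d m}
    (hq : 0 < cellProb PX j) {c δ : ℝ} (hc : c ∈ Set.Icc A.pLo A.pHi)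
    (hδ : ∀ᵐ z ∂PX, cellOf z = j → G z ≤ F (c, z) + δ) {t : ℕ} (ht : t ∈ Finset.Icc 1 A.T) :
    ∫⁻ ω in {ω | cellOf (x t ω) = j}, ENNReal.ofReal (G (x t ω) - F (p t ω, x t ω)) ∂P ≤
      ∫⁻ ω, ENNReal.ofReal (cellProb PX j * (revenueOn PX lam (cellCube j) c -
        revenueOn PX lam (cellCube j)
          ((cellState A (runData x y p ω) (W ω) j (t - 1)).rho (priceIdx t))) +
        cellProb PX j * δ) ∂P := by
  classical
  set ρ : Ω → ℝ := fun ω => (cellState A (runData x y p ω) (W ω) j (t - 1)).rho (priceIdx t)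
  have hρm : Measurable[past x y W t] ρ := hR.measurable_rho ht j _
  have hρ : ∀ ω, ρ ω ∈ Set.Icc A.pLo A.pHi := fun ω =>
    cellState_rho_mem hM.price_range.2.1.le _ _ _ _ _
  set φ : ℝ × Ctx d → ENNReal :=
    {v : ℝ × Ctx d | cellOf v.2 = j}.indicator fun v => ENNReal.ofReal (G v.2 - F v) with hφdef
  have hφ : Measurable φ := by
    refine Measurable.indicator ?_ (measurable_snd (measurableSet_cell j))
    exact ((hG.cont.measurable.comp measurable_snd).sub hF.cont.measurable).ennreal_ofReal
  -- On the event that the context falls in the cell, the price is the past-measurable `ρ`, so the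
  -- context can be integrated out independently.
  have h1 : ∫⁻ ω in {ω | cellOf (x t ω) = j}, ENNReal.ofReal (G (x t ω) - F (p t ω, x t ω)) ∂P =
      ∫⁻ ω, φ (ρ ω, x t ω) ∂P := by
    have hS : MeasurableSet {ω | cellOf (x t ω) = j} := hR.measurable_x t (measurableSet_cell j)
    rw [← lintegral_indicator hS]
    refine lintegral_congr fun ω => ?_
    by_cases h : cellOf (x t ω) = j
    · rw [hφdef, Set.indicator_of_mem (show ω ∈ {ω | cellOf (x t ω) = j} from h),
        Set.indicator_of_mem (show (ρ ω, x t ω) ∈ {v : ℝ × Ctx d | cellOf v.2 = j} from h),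
        hR.price_eq_rho ht h]
    · rw [hφdef, Set.indicator_of_notMem (show ω ∉ {ω | cellOf (x t ω) = j} from h),
        Set.indicator_of_notMem (show (ρ ω, x t ω) ∉ {v : ℝ × Ctx d | cellOf v.2 = j} from h)]
  rw [h1, hR.lintegral_past_context ht hρm hφ]
  refine lintegral_mono fun ω => ?_
  refine le_trans (le_of_eq ?_) (setLIntegral_cell_le hM hF hG hq hc (hρ ω) hδ)
  rw [← lintegral_indicator (measurableSet_cell j)]
  rfl

lemma lintegral_regret_eq (hR : IsRun A PX lam P x y p W)
    (hM : Model A.pLo A.pHi CX CL σH CH Cp PX lam pstar) (hF : IsExtension A.pLo A.pHi lam F)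
    (hG : IsBestExtension lam pstar G) :
    ∫⁻ ω, ENNReal.ofReal (regret A.T lam pstar x p ω) ∂P =
      ∑ j : Cell d m, ∑ t ∈ Finset.Icc 1 A.T,
        ∫⁻ ω in {ω | cellOf (x t ω) = j}, ENNReal.ofReal (G (x t ω) - F (p t ω, x t ω)) ∂P := by
  have h1 : ∫⁻ ω, ENNReal.ofReal (regret A.T lam pstar x p ω) ∂P =
      ∫⁻ ω, ∑ t ∈ Finset.Icc 1 A.T, ENNReal.ofReal (G (x t ω) - F (p t ω, x t ω)) ∂P := by
    refine lintegral_congr_ae ?_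
    filter_upwards [hR.regret_ae_eq hM hF hG] with ω hω
    rw [hω.2, ENNReal.ofReal_sum_of_nonneg fun t ht => (hω.1 t ht).1]
  rw [h1, lintegral_finsetSum _ fun t ht => (hR.measurable_loss hF hG ht).ennreal_ofReal,
    Finset.sum_comm]
  refine Finset.sum_congr rfl fun t ht => ?_
  have h2 : (Set.univ : Set Ω) = ⋃ j ∈ (Finset.univ : Finset (Cell d m)), {ω | cellOf (x t ω) = j} := by
    ext ω; simp
  rw [← setLIntegral_univ, h2, lintegral_biUnion_finset]
  · intro i _ j _ hij
    refine Set.disjoint_left.2 fun ω h1 h2 => hij ?_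
    exact (show cellOf (x t ω) = i from h1).symm.trans h2
  · exact fun j _ => hR.measurable_x t (measurableSet_cell j)

/-- If the expected loss of every cell that has customers is at most `q a + b`, `q` being its
probability, then the expected regret is at most `a + m ^ d b`, up to the error of averaging. -/
theorem integral_regret_le (hR : IsRun A PX lam P x y p W)
    (hM : Model A.pLo A.pHi CX CL σH CH Cp PX lam pstar) {a b : ℝ} (ha : 0 ≤ a) (hb : 0 ≤ b)
    (h : ∀ j : Cell d m, 0 < cellProb PX j → ∀ c,
      Curved A.pLo A.pHi σH CH c (revenueOn PX lam (cellCube j)) →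
      ∫⁻ ω, ENNReal.ofReal (cellLoss A PX lam (runData x y p ω) (W ω) j c) ∂P ≤
        ENNReal.ofReal (cellProb PX j * a + b)) :
    ∫ ω, regret A.T lam pstar x p ω ∂P ≤
      a + (m : ℝ) ^ d * b + A.T * (CH ^ 2 * Cp ^ 2 * d / 2 / (m : ℝ) ^ 2) := by
  have := hR.prob
  obtain ⟨F, hF⟩ := hM.exists_isExtension
  obtain ⟨G, hG⟩ := hM.exists_isBestExtension
  have hm : (0 : ℝ) < m := by exact_mod_cast Nat.pos_of_ne_zero (NeZero.ne m)
  set δ : ℝ := CH ^ 2 * Cp ^ 2 * d / 2 / (m : ℝ) ^ 2 with hδ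
  have hδ0 : 0 ≤ δ := by positivity
  have hcell : ∀ j : Cell d m, ∑ t ∈ Finset.Icc 1 A.T,
      ∫⁻ ω in {ω | cellOf (x t ω) = j}, ENNReal.ofReal (G (x t ω) - F (p t ω, x t ω)) ∂P ≤
      ENNReal.ofReal (cellProb PX j * (a + A.T * δ) + b) := by
    intro j
    -- Cells without customers, for which no curvature is assumed, contribute nothing.
    rcases (cellProb_nonneg PX j).eq_or_lt with hq | hq
    · refine le_trans (le_of_eq (Finset.sum_eq_zero fun t ht => ?_)) zero_le
      refine setLIntegral_measure_zero _ _ ?_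
      have h1 : P.map (x t) {z | cellOf z = j} = 0 := by
        rw [hR.context_law t ht, measure_cell_eq hM, ← hq, ENNReal.ofReal_zero]
      rwa [Measure.map_apply (hR.measurable_x t) (measurableSet_cell j)] at h1
    · obtain ⟨c, hc, hps⟩ := hM.exists_curved (one_div_pos.2 hm) (cellCube_subset j)
        (measure_cellCube_ne_zero hM hq)
      have hcm : c ∈ Set.Icc A.pLo A.pHi := Set.Ioo_subset_Icc_self hc.mem
      -- The pointwise loss is quadratic at `p*(z)`, and `p*(z)` is within `|Cp| √d / m` of the
      -- maximizer `c`. So the discretization error is of order `m⁻²`, whereas the Lipschitz bound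
      -- alone would give `m⁻¹`.
      have hbd : ∀ᵐ z ∂PX, cellOf z = j → G z ≤ F (c, z) + δ := by
        filter_upwards [hM.ae_mem_unitCube, hM.ae_revenue_sub_le, hM.ae_mem_cellCube_iff (m := m)]
          with z h1 h2 h3 h4
        have h5 := h2 c hcm
        have h6 := hps z ((h3 j).1 h4)
        rw [hG.eq z h1, hF.eq c hcm z h1]
        have h7 : (pstar z - c) ^ 2 ≤ Cp ^ 2 * d / (m : ℝ) ^ 2 := by
          rw [← sq_abs]
          refine (pow_le_pow_left₀ (abs_nonneg _) h6 2).trans (le_of_eq ?_)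
          rw [mul_pow, mul_pow, sq_abs, Real.sq_sqrt (by positivity)]
          ring
        have h8 := mul_le_mul_of_nonneg_left h7 (show 0 ≤ CH ^ 2 / 2 by positivity)
        have h9 : CH ^ 2 / 2 * (Cp ^ 2 * d / (m : ℝ) ^ 2) = δ := by rw [hδ]; ring
        linarith
      refine (Finset.sum_le_sum fun t ht => hR.setLIntegral_loss_le hM hF hG hq hcm hbd ht).trans ?_
      have hmeas : ∀ t ∈ Finset.Icc 1 A.T, Measurable fun ω => ENNReal.ofReal (cellProb PX j *
          (revenueOn PX lam (cellCube j) c - revenueOn PX lam (cellCube j)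
            ((cellState A (runData x y p ω) (W ω) j (t - 1)).rho (priceIdx t))) +
          cellProb PX j * δ) := fun t ht =>
        ((((((hR.measurable_revenueOn_rho hM hq ht _).mono (hR.past_le t) le_rfl).const_sub
          _).const_mul _).add_const _)).ennreal_ofReal
      rw [← lintegral_finsetSum _ hmeas]
      have hterm : ∀ ω t, 0 ≤ cellProb PX j * (revenueOn PX lam (cellCube j) c -
          revenueOn PX lam (cellCube j)
            ((cellState A (runData x y p ω) (W ω) j t).rho (priceIdx (t + 1)))) := fun ω t =>
        mul_nonneg hq.le (cellLoss_term_mem hM hq hc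
          (cellState_rho_mem hM.price_range.2.1.le _ _ _ _ _)).1
      have hsum : ∀ ω, ∑ t ∈ Finset.Icc 1 A.T, ENNReal.ofReal (cellProb PX j *
          (revenueOn PX lam (cellCube j) c - revenueOn PX lam (cellCube j)
            ((cellState A (runData x y p ω) (W ω) j (t - 1)).rho (priceIdx t))) +
          cellProb PX j * δ) =
          ENNReal.ofReal (cellLoss A PX lam (runData x y p ω) (W ω) j c) +
            ENNReal.ofReal (cellProb PX j * (A.T * δ)) := by
        intro ω
        rw [sum_Icc_one_eq_sum_range]
        simp only [Nat.add_sub_cancel]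
        have h0 : 0 ≤ cellLoss A PX lam (runData x y p ω) (W ω) j c :=
          Finset.sum_nonneg fun t _ => hterm ω t
        rw [← ENNReal.ofReal_sum_of_nonneg fun t _ => add_nonneg (hterm ω t) (by positivity),
          ← ENNReal.ofReal_add h0 (by positivity), Finset.sum_add_distrib, Finset.sum_const, Finset.card_range, nsmul_eq_mul, cellLoss]
        congr 2
        ring
      simp_rw [hsum]
      rw [lintegral_add_right _ measurable_const, lintegral_const, measure_univ, mul_one]
      refine (add_le_add_left (h j hq c hc) _).trans (le_of_eq ?_)
      rw [← ENNReal.ofReal_add (by positivity) (by positivity)]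
      congr 1
      ring
  have htot : ∫⁻ ω, ENNReal.ofReal (regret A.T lam pstar x p ω) ∂P ≤
      ENNReal.ofReal (a + (m : ℝ) ^ d * b + A.T * δ) := by
    rw [hR.lintegral_regret_eq hM hF hG]
    refine (Finset.sum_le_sum fun j _ => hcell j).trans (le_of_eq ?_)
    rw [← ENNReal.ofReal_sum_of_nonneg fun j _ => add_nonneg
      (mul_nonneg (cellProb_nonneg PX j) (by positivity)) hb, Finset.sum_add_distrib,
      ← Finset.sum_mul, sum_cellProb hM, Finset.sum_const, Finset.card_univ]
    congr 1
    simp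
    ring
  rw [integral_eq_lintegral_of_nonneg_ae ((hR.regret_mem hM).mono fun ω hω => hω.1)
    (hR.integrable_regret hM).aestronglyMeasurable]
  exact ENNReal.toReal_le_of_le_ofReal (by positivity) htot

/-- On exceptional paths the loss is at most `q T`, and their probability `30 / T` turns this into
`30 q`, which sums to 30 over the cells. -/
lemma lintegral_cellLoss_le (hR : IsRun A PX lam P x y p W)
    (hM : Model A.pLo A.pHi CX CL σH CH Cp PX lam pstar) {j : Cell d m} (hq : 0 < cellProb PX j)
    (hε : 0 < A.ε) (hT : 1 ≤ A.T) (hc1 : 0 < A.c1) {Λ e : ℝ}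
    (hΛ : Λ = Real.log (2 * (A.T : ℝ) ^ 3)) (hcΛ : A.c1 ^ 2 = Λ)
    (he : 2 * treeScale (A.ε / 2) A.T * Λ ≤ e / 2) (he0 : 0 < e) (hc2 : A.c2 = 3 * e)
    (hc1' : A.c1' = 12 * e) {D : ℝ} (hD : 0 < D) {N : ℕ} (hN : (3 / 4) ^ N ≤ D) {c : ℝ}
    (hc : Curved A.pLo A.pHi σH CH c (revenueOn PX lam (cellCube j))) :
    ∫⁻ ω, ENNReal.ofReal (cellLoss A PX lam (runData x y p ω) (W ω) j c) ∂P ≤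
      ENNReal.ofReal (cellProb PX j * (CH ^ 2 / 2 * (A.T * D ^ 2) + 30) +
        CH ^ 2 / 2 * (N * (1474560 * Λ / (σH ^ 4 * D ^ 2) + 27200 * e / σH ^ 2 + 10 * Λ + 6))) := by
  have := hR.prob
  have hT0 : (0 : ℝ) < A.T := by exact_mod_cast hT
  have hΛ0 : 0 < Λ := by rw [← hcΛ]; positivity
  have hσ := hM.constants.1
  set E : Set Ω := {ω | ¬ GoodPath A (runData x y p ω) (W ω) j (revenueOn PX lam (cellCube j))
      (cellProb PX j) Λ e} with hE
  set B : ℝ := CH ^ 2 / 2 * (N * (1474560 * Λ / (σH ^ 4 * D ^ 2) + 27200 * e / σH ^ 2 + 10 * Λ + 6)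
    + cellProb PX j * A.T * D ^ 2) with hB
  have hB0 : 0 ≤ B := by positivity
  have hq1 := cellProb_le_one hM j
  -- A measurable hull replaces the exceptional set, so its own measurability is not needed.
  have hpt : ∀ ω, ENNReal.ofReal (cellLoss A PX lam (runData x y p ω) (W ω) j c) ≤
      ENNReal.ofReal B + (toMeasurable P E).indicator
        (fun _ => ENNReal.ofReal (cellProb PX j * A.T)) ω := by
    intro ω
    by_cases hω : ω ∈ E
    · rw [Set.indicator_of_mem (subset_toMeasurable P E hω)]
      refine le_add_left (ENNReal.ofReal_le_ofReal ?_)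
      have h1 : cellLoss A PX lam (runData x y p ω) (W ω) j c ≤
          ∑ t ∈ Finset.range A.T, cellProb PX j * 1 :=
        Finset.sum_le_sum fun t _ => mul_le_mul_of_nonneg_left (cellLoss_term_mem hM hq hc
          (cellState_rho_mem hM.price_range.2.1.le _ _ _ _ _)).2 hq.le
      rw [Finset.sum_const, Finset.card_range, nsmul_eq_mul, mul_one] at h1
      linarith
    · have hω' : GoodPath A (runData x y p ω) (W ω) j (revenueOn PX lam (cellCube j))
        (cellProb PX j) Λ e := by simpa [hE] using hω
      refine le_add_right (ENNReal.ofReal_le_ofReal ?_)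
      exact hω'.regret_le he0 hc1 hcΛ hc2 hc1' hσ hq.le hq1 hc (fun u hu => hM.revenueOn_mem
        (measurableSet_cellCube j) (cellCube_subset j) (measure_cellCube_ne_zero hM hq) hu)
        (by linarith [hM.price_range.1, hM.price_range.2.2]) hD hN
  refine (lintegral_mono hpt).trans ?_
  rw [lintegral_add_left measurable_const, lintegral_const, measure_univ, mul_one,
    lintegral_indicator_const (measurableSet_toMeasurable P E), measure_toMeasurable]
  have hPE := hR.measure_not_goodPath_le hM hq hε hT hc1 hΛ hcΛ he he0
  refine (add_le_add_right (mul_le_mul_right hPE _) _).trans (le_of_eq ?_)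
  rw [← ENNReal.ofReal_mul (by positivity), ← ENNReal.ofReal_add hB0 (by positivity)]
  congr 1
  rw [hB]
  field_simp
  ring

end IsRun

end Regret

/-! ### The tuned algorithm -/

section Side

variable {d T m : ℕ}

lemma root_pow_eq (d T : ℕ) (k : ℕ) :
    ((T : ℝ) ^ (1 / ((d : ℝ) + 4))) ^ k = (T : ℝ) ^ ((k : ℝ) / ((d : ℝ) + 4)) := by
  rw [← Real.rpow_natCast, ← Real.rpow_mul (Nat.cast_nonneg T)]
  congr 1
  ring

lemma IsTunedSide.root_le (h : IsTunedSide d T m) (hd : 1 ≤ d) :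
    (T : ℝ) ^ (1 / ((d : ℝ) + 4)) ≤ m := by
  have h1 := Nat.ceil_le.1 h.1
  rw [← root_pow_eq] at h1
  push_cast at h1
  exact le_of_pow_le_pow_left₀ (by omega) (Nat.cast_nonneg m) h1

lemma IsTunedSide.sub_one_le_root (h : IsTunedSide d T m) :
    (m : ℝ) - 1 ≤ (T : ℝ) ^ (1 / ((d : ℝ) + 4)) := by
  rcases Nat.eq_zero_or_pos m with rfl | hm
  · have : 0 ≤ (T : ℝ) ^ (1 / ((d : ℝ) + 4)) := by positivity
    push_cast
    linarith
  · have h1 : ¬ ⌈(T : ℝ) ^ ((d : ℝ) / ((d : ℝ) + 4))⌉₊ ≤ (m - 1) ^ d := fun h2 => by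
      have := h.2 h2
      omega
    rw [not_le, Nat.lt_ceil, ← root_pow_eq] at h1
    push_cast [Nat.cast_sub hm] at h1
    exact (lt_of_pow_lt_pow_left₀ d (by positivity) h1).le

/-- From `m ≤ r + 1 ≤ r e^(1/r)`, the rounding costs at most `e^(d/r) ≤ e < 3` once `d ≤ r`. -/
lemma IsTunedSide.pow_le (h : IsTunedSide d T m) (hd : 1 ≤ d)
    (hT : (d : ℝ) ≤ (T : ℝ) ^ (1 / ((d : ℝ) + 4))) :
    (m : ℝ) ^ d ≤ 3 * ((T : ℝ) ^ (1 / ((d : ℝ) + 4))) ^ d := by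
  set r := (T : ℝ) ^ (1 / ((d : ℝ) + 4))
  have hd1 : (1 : ℝ) ≤ d := by exact_mod_cast hd
  have hr : 0 < r := by linarith
  have h1 : (m : ℝ) ≤ r * Real.exp (1 / r) := by
    have h2 := h.sub_one_le_root
    have h3 := mul_le_mul_of_nonneg_left (Real.add_one_le_exp (1 / r)) hr.le
    rw [mul_add, mul_one, mul_one_div_cancel hr.ne'] at h3
    change (m : ℝ) - 1 ≤ r at h2
    linarith
  calc (m : ℝ) ^ d ≤ (r * Real.exp (1 / r)) ^ d := by gcongr
    _ = r ^ d * Real.exp (d * (1 / r)) := by rw [mul_pow, ← Real.exp_nat_mul]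
    _ ≤ r ^ d * 3 := by
      gcongr
      refine (Real.exp_le_exp.2 ?_).trans (Real.exp_one_lt_d9.le.trans (by norm_num))
      rw [mul_one_div, div_le_one hr]
      exact hT
    _ = _ := mul_comm _ _

end Side

lemma three_quarters_pow_le {Λ r : ℝ} (hr : 0 < r) (h : Real.log r ≤ Λ / 4) {N : ℕ} (hN : Λ ≤ N) :
    (3 / 4 : ℝ) ^ N ≤ 1 / r := by
  have h1 : (3 / 4 : ℝ) ≤ Real.exp (-(1 / 4)) := by
    have := Real.add_one_le_exp (-(1 / 4 : ℝ))
    linarith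
  calc (3 / 4 : ℝ) ^ N ≤ Real.exp (-(1 / 4)) ^ N := by gcongr
    _ = Real.exp (N * -(1 / 4)) := by rw [Real.exp_nat_mul]
    _ ≤ Real.exp (-Real.log r) := Real.exp_le_exp.2 (by linarith)
    _ = 1 / r := by rw [Real.exp_neg, Real.exp_log hr, one_div]

/-- Either `σ ≤ 1` and the first term suffices, or `C √K ≥ σ ≥ 1`. This lets terms without a
curvature constant be absorbed into the leading one. -/
lemma one_le_inv_pow_four_add {σ C K : ℝ} (hσ : 0 < σ) (hC : σ ≤ C) (hK : 1 ≤ K) :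
    1 ≤ (σ ^ 4)⁻¹ + C * Real.sqrt K := by
  have hs : 1 ≤ Real.sqrt K := Real.one_le_sqrt.2 hK
  have hCs : σ ≤ C * Real.sqrt K := by nlinarith
  rcases le_total σ 1 with h | h
  · have : 1 ≤ (σ ^ 4)⁻¹ := (one_le_inv₀ (by positivity)).2 (pow_le_one₀ hσ.le h)
    linarith
  · have : 0 ≤ (σ ^ 4)⁻¹ := by positivity
    linarith

/-- Terms of lower order are absorbed through `X ≥ 1`, `r ≥ 1` and `9 L² ≥ 1`; powers of `Λ` become
powers of `L` by `Λ ≤ 3/2 L`. The constant `10 ^ 8` is generous. -/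
lemma regret_constants_le {C σ X Λ L ε r s M N : ℝ} (hσ : 0 < σ) (hX1 : 1 ≤ X) (hXσ : (σ ^ 4)⁻¹ ≤ X)
    (hΛ : 0.69 ≤ Λ) (hΛL : Λ ≤ 3 / 2 * L) (hε : 0 < ε) (hr : 1 ≤ r) (hs : 0 ≤ s) (hM : M ≤ 3 * s)
    (hN0 : 0 ≤ N) (hN : N ≤ Λ + 1) :
    C ^ 2 / 2 * (s * r ^ 2) + M * (C ^ 2 / 2 * (N * (1474560 * Λ / (σ ^ 4 * (1 / r) ^ 2) +
        27200 * (76 * ε⁻¹ * Λ ^ 2 / 3) / σ ^ 2 + 10 * Λ + 6))) ≤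
      10 ^ 8 * (C ^ 2 * X * L ^ 2) * (s * r ^ 2) +
        10 ^ 8 * (C ^ 2 * (σ ^ 2)⁻¹ * L ^ 3) * ε⁻¹ * s := by
  have hΛ0 : 0 < Λ := by linarith
  have hL0 : 0 ≤ L := by linarith
  have hr2 : 1 ≤ r ^ 2 := one_le_pow₀ hr
  set E := ε⁻¹
  set G := (σ ^ 2)⁻¹
  have hE : 0 < E := inv_pos.2 hε
  have hG : 0 < G := by positivity
  have e1 : 1474560 * Λ / (σ ^ 4 * (1 / r) ^ 2) = 1474560 * Λ * (σ ^ 4)⁻¹ * r ^ 2 := by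
    field_simp
  have e2 : 27200 * (76 * E * Λ ^ 2 / 3) / σ ^ 2 = 27200 * 76 / 3 * E * Λ ^ 2 * G := by
    simp only [G]; ring
  have hXr : 1 ≤ X * r ^ 2 := one_le_mul_of_one_le_of_one_le hX1 hr2
  have hin : 1474560 * Λ * (σ ^ 4)⁻¹ * r ^ 2 + 27200 * 76 / 3 * E * Λ ^ 2 * G + 10 * Λ + 6 ≤
      1474579 * (Λ * (X * r ^ 2)) + 689067 * (E * G * Λ ^ 2) := by
    have h1 : Λ * (σ ^ 4)⁻¹ * r ^ 2 ≤ Λ * (X * r ^ 2) := by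
      rw [mul_assoc]; gcongr
    have h2 : Λ * 1 ≤ Λ * (X * r ^ 2) := by gcongr
    have h3 : 0 ≤ E * G * Λ ^ 2 := by positivity
    nlinarith
  have hN2 : N ≤ 5 / 2 * Λ := by linarith
  have hL2 : Λ ^ 2 ≤ 9 / 4 * L ^ 2 := by
    calc Λ ^ 2 ≤ (3 / 2 * L) ^ 2 := by gcongr
      _ = _ := by ring
  have hL3 : Λ ^ 3 ≤ 27 / 8 * L ^ 3 := by
    calc Λ ^ 3 ≤ (3 / 2 * L) ^ 3 := by gcongr
      _ = _ := by ring
  have h1L : 1 ≤ 9 * L ^ 2 := by nlinarith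
  rw [e1, e2]
  have step : M * (C ^ 2 / 2 * (N * (1474560 * Λ * (σ ^ 4)⁻¹ * r ^ 2 +
      27200 * 76 / 3 * E * Λ ^ 2 * G + 10 * Λ + 6))) ≤
      3 * s * (C ^ 2 / 2 * (5 / 2 * Λ * (1474579 * (Λ * (X * r ^ 2)) +
        689067 * (E * G * Λ ^ 2)))) := by
    gcongr
  have hA : C ^ 2 * s * X * r ^ 2 * Λ ^ 2 ≤ C ^ 2 * s * X * r ^ 2 * (9 / 4 * L ^ 2) := by gcongr
  have hB : C ^ 2 * s * E * G * Λ ^ 3 ≤ C ^ 2 * s * E * G * (27 / 8 * L ^ 3) := by gcongr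
  have hD : C ^ 2 * s * r ^ 2 * 1 ≤ C ^ 2 * s * r ^ 2 * (X * (9 * L ^ 2)) := by
    gcongr
    exact one_le_mul_of_one_le_of_one_le hX1 h1L
  have hA0 : 0 ≤ C ^ 2 * s * X * r ^ 2 * L ^ 2 := by positivity
  have hB0 : 0 ≤ C ^ 2 * s * E * G * L ^ 3 := by positivity
  refine (add_le_add le_rfl step).trans ?_
  nlinarith

section Tuned

variable {d T m : ℕ} [NeZero m] {ε pLo pHi CX CL σH CH Cp : ℝ} {PX : Measure (Ctx d)}
  {lam : ℝ → Ctx d → ℝ} {pstar : Ctx d → ℝ} {Ω : Type*} [MeasurableSpace Ω] {P : Measure Ω}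
  {x : ℕ → Ω → Ctx d} {y p : ℕ → Ω → ℝ} {W : Ω → Noise d m (tuned T ε pLo pHi).T}

/-- If `CH² T ≤ 1`, any prices lose at most `CH²/2` of averaged revenue per period, hence at most
one in total. This case is separate because `ln (2 CH² T³)` may then be far smaller than `ln (2
T³)`. -/
lemma IsRun.integral_regret_le_of_flat {A : Params} {W : Ω → Noise d m A.T}
    (hR : IsRun A PX lam P x y p W) (hM : Model A.pLo A.pHi CX CL σH CH Cp PX lam pstar)
    (hC : CH ^ 2 * A.T ≤ 1) :
    ∫ ω, regret A.T lam pstar x p ω ∂P ≤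
      1 + A.T * (CH ^ 2 * Cp ^ 2 * d / 2 / (m : ℝ) ^ 2) := by
  have := hR.prob
  have h := hR.integral_regret_le hM (a := 1) (b := 0) zero_le_one le_rfl fun j hq c hc => by
    refine (lintegral_mono (g := fun _ => ENNReal.ofReal (cellProb PX j * 1 + 0))
      fun ω => ENNReal.ofReal_le_ofReal ?_).trans (by simp)
    have hterm : ∀ t, cellProb PX j * (revenueOn PX lam (cellCube j) c -
        revenueOn PX lam (cellCube j)
          ((cellState A (runData x y p ω) (W ω) j t).rho (priceIdx (t + 1)))) ≤
        cellProb PX j * (CH ^ 2 / 2) := fun t => by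
      have hu := cellState_rho_mem hM.price_range.2.1.le (runData x y p ω) (W ω) j t
        (priceIdx (t + 1))
      refine mul_le_mul_of_nonneg_left ((hc.le_quadratic hu).trans ?_) hq.le
      refine mul_le_of_le_one_right (by positivity) ?_
      obtain ⟨h0, -, h1⟩ := hM.price_range
      have hc' := hc.mem
      rw [sq_le_one_iff_abs_le_one, abs_le]
      constructor <;> linarith [hu.1, hu.2, hc'.1, hc'.2]
    have hsum := Finset.sum_le_sum (s := Finset.range A.T) fun t _ => hterm t
    rw [Finset.sum_const, Finset.card_range, nsmul_eq_mul] at hsum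
    refine hsum.trans ?_
    have := mul_le_mul_of_nonneg_left hC hq.le
    nlinarith
  simpa using h

theorem IsRun.integral_regret_tuned_le (hR : IsRun (tuned T ε pLo pHi) PX lam P x y p W)
    (hM : Model pLo pHi CX CL σH CH Cp PX lam pstar) (hd : 1 ≤ d) (hT : 1 ≤ T) (hε : 0 < ε)
    (hm : IsTunedSide d T m) (hCT : 1 ≤ 2 * CH ^ 2 * (T : ℝ) ^ 3) :
    ∫ ω, regret T lam pstar x p ω ∂P ≤
      (10 ^ 8 * (CH ^ 2 * ((σH ^ 4)⁻¹ + CH * Real.sqrt CX)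
          * Real.log (2 * CH ^ 2 * (T : ℝ) ^ 3) ^ 2) + CH ^ 2 * Cp ^ 2 * d / 2)
        * (T : ℝ) ^ (((d : ℝ) + 2) / ((d : ℝ) + 4))
      + (10 ^ 8 * (CH ^ 2 * (σH ^ 2)⁻¹ * Real.log (2 * CH ^ 2 * (T : ℝ) ^ 3) ^ 3))
        * ε⁻¹ * (T : ℝ) ^ ((d : ℝ) / ((d : ℝ) + 4))
      + ((d : ℝ) ^ (d + 4) + 30) := by
  obtain ⟨hσ, hσC⟩ := hM.constants
  have hC : 0 < CH := hσ.trans_le hσC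
  have hT1 : (1 : ℝ) ≤ T := by exact_mod_cast hT
  have hT0 : (0 : ℝ) < T := by linarith
  have hX1 := one_le_inv_pow_four_add hσ hσC hM.one_le_CX
  set X := (σH ^ 4)⁻¹ + CH * Real.sqrt CX with hX
  have hXσ : (σH ^ 4)⁻¹ ≤ X := by
    have : 0 ≤ CH * Real.sqrt CX := by positivity
    linarith
  set L := Real.log (2 * CH ^ 2 * (T : ℝ) ^ 3) with hL
  have hL0 : 0 ≤ L := Real.log_nonneg hCT
  set r := (T : ℝ) ^ (1 / ((d : ℝ) + 4)) with hr
  have hr1 : 1 ≤ r := Real.one_le_rpow hT1 (by positivity)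
  have hr0 : 0 < r := by linarith
  have hrT : r ^ (d + 4) = T := by
    rw [hr, root_pow_eq]
    push_cast
    rw [div_self (by positivity), Real.rpow_one]
  have e1 : (T : ℝ) ^ (((d : ℝ) + 2) / ((d : ℝ) + 4)) = r ^ d * r ^ 2 := by
    rw [← pow_add, hr, root_pow_eq]
    push_cast
    rfl
  have e2 : (T : ℝ) ^ ((d : ℝ) / ((d : ℝ) + 4)) = r ^ d := by rw [hr, root_pow_eq]
  rw [e1, e2]
  have hrm : r ≤ m := hm.root_le hd
  have hδ : (T : ℝ) * (CH ^ 2 * Cp ^ 2 * d / 2 / (m : ℝ) ^ 2) ≤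
      CH ^ 2 * Cp ^ 2 * d / 2 * (r ^ d * r ^ 2) := by
    have h1 : (T : ℝ) * (CH ^ 2 * Cp ^ 2 * d / 2 / (m : ℝ) ^ 2) ≤
        T * (CH ^ 2 * Cp ^ 2 * d / 2 / r ^ 2) := by gcongr
    refine h1.trans (le_of_eq ?_)
    rw [← hrT]
    field_simp
    ring
  have hA0 : 0 ≤ 10 ^ 8 * (CH ^ 2 * X * L ^ 2) * (r ^ d * r ^ 2) := by positivity
  have hB0 : 0 ≤ 10 ^ 8 * (CH ^ 2 * (σH ^ 2)⁻¹ * L ^ 3) * ε⁻¹ * r ^ d := by positivity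
  have hD0 : 0 ≤ CH ^ 2 * Cp ^ 2 * d / 2 * (r ^ d * r ^ 2) := by positivity
  have hK0 : 0 ≤ (d : ℝ) ^ (d + 4) := by positivity
  -- For `r < d` the trivial bound `T = r ^ (d + 4)` is absorbed into `K_d`; otherwise the rounding
  -- of `m` is harmless.
  rcases lt_or_ge r d with hrd | hrd
  · have h1 : ∫ ω, regret T lam pstar x p ω ∂P ≤ T := hR.integral_regret_le_horizon hM
    have h2 : (T : ℝ) ≤ (d : ℝ) ^ (d + 4) := by rw [← hrT]; gcongr
    linarith
  rcases le_or_gt (CH ^ 2 * T) 1 with hflat | hflat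
  · have h1 : ∫ ω, regret T lam pstar x p ω ∂P ≤
      1 + T * (CH ^ 2 * Cp ^ 2 * d / 2 / (m : ℝ) ^ 2) := hR.integral_regret_le_of_flat hM hflat
    linarith
  set Λ := Real.log (2 * (T : ℝ) ^ 3) with hΛ
  have hlT : 0 ≤ Real.log T := Real.log_nonneg hT1
  have hΛe : Λ = Real.log 2 + 3 * Real.log T := by
    rw [hΛ, Real.log_mul (by norm_num) (by positivity), Real.log_pow]
    norm_num
  have hl2 := Real.log_two_gt_d9
  have hΛ1 : 0.69 ≤ Λ := by rw [hΛe]; linarith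
  have hΛ0 : 0 < Λ := by linarith
  -- Since `CH² T > 1`, `L ≥ ln (2 T²)`, and `ln 2 + 3 ln T ≤ 3/2 (ln 2 + 2 ln T)`.
  have hΛL : Λ ≤ 3 / 2 * L := by
    have h1 : Real.log (2 * (T : ℝ) ^ 2) ≤ L := by
      refine Real.log_le_log (by positivity) ?_
      have : (T : ℝ) ^ 2 * 1 ≤ (T : ℝ) ^ 2 * (CH ^ 2 * T) := by gcongr
      nlinarith
    rw [Real.log_mul (by norm_num) (by positivity), Real.log_pow] at h1
    push_cast at h1
    rw [hΛe]
    linarith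
  have hlr : Real.log r ≤ Λ / 4 := by
    have h1 : ((d + 4 : ℕ) : ℝ) * Real.log r = Real.log T := by rw [← Real.log_pow, hrT]
    have h2 : 0 ≤ Real.log r := Real.log_nonneg hr1
    push_cast at h1
    have h3 : 0 ≤ (d : ℝ) * Real.log r := by positivity
    rw [hΛe]
    nlinarith
  set e := 76 * ε⁻¹ * Λ ^ 2 / 3 with he
  have he0 : 0 < e := by positivity
  have hc1 : 0 < (tuned T ε pLo pHi).c1 := Real.sqrt_pos.2 hΛ0
  -- The cut-off width is `D = 1 / r`: then `T D² = r ^ (d + 2)`, and the wide phases of the `m ^ d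
  -- ≤ 3 r ^ d` cells contribute the same power. `⌈Λ⌉₊` phases reach this width.
  have h := hR.integral_regret_le hM
    (a := CH ^ 2 / 2 * (T * (1 / r) ^ 2) + 30)
    (b := CH ^ 2 / 2 * (⌈Λ⌉₊ * (1474560 * Λ / (σH ^ 4 * (1 / r) ^ 2) + 27200 * e / σH ^ 2 +
      10 * Λ + 6))) (by positivity) (by positivity) fun j hq c hc =>
      hR.lintegral_cellLoss_le hM hq hε hT hc1 hΛ (Real.sq_sqrt hΛ0.le)
        ((noise_width_le hε hT).trans (le_of_eq (by rw [he]; ring))) he0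
        (show 76 * ε⁻¹ * Λ ^ 2 = 3 * e by rw [he]; ring)
        (show 4 * (76 * ε⁻¹ * Λ ^ 2) = 12 * e by rw [he]; ring) (by positivity)
        (three_quarters_pow_le hr0 hlr (Nat.le_ceil Λ)) hc
  have h' : ∫ ω, regret T lam pstar x p ω ∂P ≤
    _ + T * (CH ^ 2 * Cp ^ 2 * d / 2 / (m : ℝ) ^ 2) := h
  have hfin := regret_constants_le (C := CH) hσ hX1 hXσ hΛ1 hΛL hε hr1 (by positivity)
    (hm.pow_le hd hrd) (Nat.cast_nonneg _) (Nat.ceil_lt_add_one hΛ0.le).le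
  have e3 : (T : ℝ) * (1 / r) ^ 2 = r ^ d * r ^ 2 := by
    rw [← hrT]
    field_simp
    ring
  rw [e3] at h'
  linarith

end Tuned

end CPPQ

end

theorem theorem1 :
    -- privacy, for all values of the parameters
    (∀ (d m : ℕ) [NeZero m] (A : CPPQ.Params), 1 ≤ d → 1 ≤ A.T → 0 < A.ε →
      0 ≤ A.pLo → A.pLo < A.pHi → A.pHi ≤ 1 →
      CPPQ.IsCDP (d := d) (CPPQ.noiseLaw d m A.T A.ε) A.T A.pLo A.pHi A.ε (CPPQ.price m A)) ∧
    -- regret, with a numerical constant `c`; the term `O(1)` is bounded by `K d`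
    (∃ (c : ℝ) (K : ℕ → ℝ), 0 < c ∧
      ∀ (d T m : ℕ) [NeZero m] (ε pLo pHi CX CL σH CH Cp : ℝ)
        (PX : Measure (CPPQ.Ctx d)) (lam : ℝ → CPPQ.Ctx d → ℝ) (pstar : CPPQ.Ctx d → ℝ)
        (Ω : Type*) [MeasurableSpace Ω] (P : Measure Ω) (x : ℕ → Ω → CPPQ.Ctx d) (y p : ℕ → Ω → ℝ)
        (W : Ω → CPPQ.Noise d m (CPPQ.tuned T ε pLo pHi).T),
        1 ≤ d → 1 ≤ T → 0 < ε → CPPQ.IsTunedSide d T m → 1 ≤ 2 * CH ^ 2 * (T : ℝ) ^ 3 →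
        CPPQ.Model pLo pHi CX CL σH CH Cp PX lam pstar →
        CPPQ.IsRun (CPPQ.tuned T ε pLo pHi) PX lam P x y p W →
        Integrable (CPPQ.regret T lam pstar x p) P ∧
        ∫ ω, CPPQ.regret T lam pstar x p ω ∂P
          ≤ (c * (CH ^ 2 * ((σH ^ 4)⁻¹ + CH * Real.sqrt CX)
                  * Real.log (2 * CH ^ 2 * (T : ℝ) ^ 3) ^ 2) + CH ^ 2 * Cp ^ 2 * d / 2)
              * (T : ℝ) ^ (((d : ℝ) + 2) / ((d : ℝ) + 4))
            + (c * (CH ^ 2 * (σH ^ 2)⁻¹ * Real.log (2 * CH ^ 2 * (T : ℝ) ^ 3) ^ 3))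
              * ε⁻¹ * (T : ℝ) ^ ((d : ℝ) / ((d : ℝ) + 4))
            + K d) := by
  refine ⟨fun d m _ A _ _ hε h0 _ h1 => CPPQ.isCDP_price A hε h0 h1,
    10 ^ 8, fun d => (d : ℝ) ^ (d + 4) + 30, by norm_num, ?_⟩
  intro d T m _ ε pLo pHi CX CL σH CH Cp PX lam pstar Ω _ P x y p W hd hT hε hm hCT hM hR
  exact ⟨hR.integrable_regret hM, hR.integral_regret_tuned_le hM hd hT hε hm hCT⟩
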